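/- Let $N$ be a lattice with basis $b_1,\dots,b_n$ ($n\ge 0$) and $N_{\mathbb R}=N\otimes\mathbb R$. A \emph{polyhedral complex} is a finite complex of nonempty polyhedra $\{f_j\le c_j\}$ with $f_j\in\operatorname{Hom}(N,\mathbb Z)$, $c_j\in\mathbb R$. For a polyhedron $\sigma$ let $N_\sigma$ be the lattice of vectors of $N$ parallel to the affine span of $\sigma$, and $\operatorname{link}_\omega(\sigma)=\{u:\exists\,\delta>0\ \forall\,0<\varepsilon<\delta:\ \omega+\varepsilon u\in\sigma\}$ for $\omega\in\sigma$; if $\gamma\subseteq\sigma$ is a polyhedron contained in $\sigma$, $\operatorname{link}_\gamma(\sigma)$ is the link at a relative interior point of $\gamma$. A \emph{tropical $k$-cycle} is a pure $k$-dimensional polyhedral complex $X$ with a rational weight $m_\sigma$ on each facet, such that $\sum_{\sigma\supset\tau}m_\sigma v_{\sigma/\tau}\in\operatorname{Span}_{\mathbb Q}(N_\tau)$ for every cell $\tau$ of dimension $k-1$, where $v_{\sigma/\tau}\in N\cap\operatorname{link}_\tau(\sigma)$ generates $N_\sigma$ together with $N_\tau$. Two weighted complexes are \emph{the same cycle} if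 their common refinements with some complete polyhedral complex agree with multiplicities, facets of weight $0$ being ignored; $\operatorname{supp}X$ is the union of the facets of nonzero weight. \emph{Stable intersection.} Let $X,Y$ be tropical cycles of dimensions $k,l$, and let $S(X,Y)$ be the set of $\omega$ such that $\operatorname{supp}(\operatorname{link}_\omega X)-\operatorname{supp}(\operatorname{link}_\omega Y)=N_{\mathbb R}$. The stable intersection $X\cdot Y$ is the $(k+l-n)$-dimensional weighted complex whose facets are the cells $\gamma\subseteq S(X,Y)$ of dimension $k+l-n$ of the common refinement $\{\sigma\cap\tau:\sigma\in X,\tau\in Y\}$; the weight of $\gamma$ is the constant value, for $v$ in a dense open subset of $N_{\mathbb R}$, of $$\sum_{\sigma,\tau} m_\sigma m_\tau\,[N:N_\sigma+N_\tau],$$ over all facets $\sigma\supseteq\gamma$ of $X$ and $\tau\supseteq\gamma$ of $Y$ with $v\in\operatorname{link}_\gamma(\sigma)-\operatorname{link}_\gamma(\tau)$. \emph{Allermann--Rau product.} If $Z$ is a tropical cycle and $\varphi$ is a function that is integral affine, with linear part $\varphi_\sigma$, on each cell $\sigma$ of a suitable representative of $Z$, then the product $\varphi\cdot Z$ of the Cartier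 divisor of $\varphi$ with $Z$ is the codimension one skeleton of that representative, with weights $$\sum_{\sigma\supset\tau}\varphi_\sigma(m_\sigma v_{\sigma/\tau})-\varphi_\tau\Big(\sum_{\sigma\supset\tau}m_\sigma v_{\sigma/\tau}\Big).$$ The push-forward $f_*Z$ along a linear map $f$ defined over the integers, from a space with lattice $M$ to a space with lattice $M'$, consists, for a suitable representative of $Z$, of the images of the cells lying in a facet on which $f$ is injective, with weight $\sum_{f(\sigma)=\rho}m_\sigma[M'_\rho:f(M_\sigma)]$ on a facet $\rho$, the sum being over facets $\sigma$ of the representative. The Allermann--Rau product of $X$ and $Y$ is $$\pi_*\big(\max(x_1,y_1)\cdot\max(x_2,y_2)\cdots\max(x_n,y_n)\cdot(X\times Y)\big),$$ where $x_i,y_i$ are the coordinates of the two factors of $N_{\mathbb R}\times N_{\mathbb R}$ with respect to $b_1,\dots,b_n$, the divisors are applied successively, $X\times Y$ has the product weights, and $\pi$ is the projection to the first factor. \textbf{Proposition.} For all tropical cycles $X,Y$ in $N_{\mathbb R}$, the stable intersection $X\cdot Y$ and the Allermann--Rau product of $X$ and $Y$ are the same cycle; that is, a weighted complex $P$ represents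 the Allermann--Rau product (for any choices of representatives made in its construction) if and only if $P$ and $X\cdot Y$ are the same cycle. If moreover all weights of $X$ and $Y$ are nonnegative, then the support of the Allermann--Rau product is exactly the set $S(X,Y)$. -/

import Mathlib

open scoped Pointwise

namespace TropInt

section Polyhedra

variable {V : Type*} [NormedAddCommGroup V] [NormedSpace ℝ V]

/-- Polyhedron with rational slopes (and arbitrary real constants) with respect to `Λ`. -/
def IsRationalPolyhedron (Λ : AddSubgroup V) (P : Set V) : Prop :=
  ∃ s : Finset ((V →ₗ[ℝ] ℝ) × ℝ),
    (∀ p ∈ s, ∀ u ∈ Λ, ∃ z : ℤ, p.1 u = z) ∧ P = {x | ∀ p ∈ s, p.1 x ≤ p.2}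

/-- Nonempty faces of `P`; `P` itself (when nonempty) is the face given by `l = 0`. -/
def IsFace (F P : Set V) : Prop :=
  F.Nonempty ∧ ∃ l : V →ₗ[ℝ] ℝ, F = {x | x ∈ P ∧ ∀ y ∈ P, l y ≤ l x}

/-- Dimension of (the affine span of) a nonempty polyhedron. -/
noncomputable def dim (σ : Set V) : ℤ := (Module.finrank ℝ (vectorSpan ℝ σ) : ℤ)

/-- The lattice `N_σ` of lattice vectors parallel to the affine span of `σ`. -/
def latticeOf (Λ : AddSubgroup V) (σ : Set V) : AddSubgroup V :=
  Λ ⊓ (vectorSpan ℝ σ).toAddSubgroup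

/-- The link of `σ` at the point `ω`. -/
def link (ω : V) (σ : Set V) : Set V :=
  {u | ∃ δ : ℝ, 0 < δ ∧ ∀ ε : ℝ, 0 < ε → ε < δ → ω + ε • u ∈ σ}

/-- The link of `σ` at a relative interior point of its subset `τ`. -/
def linkAlong (τ σ : Set V) : Set V :=
  {u | ∃ ω ∈ intrinsicInterior ℝ τ, u ∈ link ω σ}

/-- `v` points from `τ` into `σ` and generates `N_σ` together with `N_τ`. -/
def IsNormalVector (Λ : AddSubgroup V) (τ σ : Set V) (v : V) : Prop :=
  v ∈ linkAlong τ σ ∧ latticeOf Λ τ ⊔ AddSubgroup.zmultiples v = latticeOf Λ σ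

/-- A choice of the lattice vector `v_{σ/τ}` (unique modulo `N_τ`), for a codimension one
face `τ` of `σ`. -/
noncomputable def normalVector (Λ : AddSubgroup V) (τ σ : Set V) : V :=
  Classical.epsilon (IsNormalVector Λ τ σ)

/-- Finite rational polyhedral complexes. -/
structure PolyComplex (Λ : AddSubgroup V) where
  cells : Set (Set V)
  finite : cells.Finite
  nonempty : ∀ σ ∈ cells, σ.Nonempty
  polyhedral : ∀ σ ∈ cells, IsRationalPolyhedron Λ σ
  face_mem : ∀ σ ∈ cells, ∀ F, IsFace F σ → F ∈ cells
  inter_face : ∀ σ ∈ cells, ∀ τ ∈ cells, (σ ∩ τ).Nonempty → IsFace (σ ∩ τ) σ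

def PolyComplex.IsComplete {Λ : AddSubgroup V} (Z : PolyComplex Λ) : Prop :=
  ∀ x : V, ∃ σ ∈ Z.cells, x ∈ σ

/-- Pure `d`-dimensional rational polyhedral complexes with a rational weight on each
`d`-dimensional cell. The values of `weight` on other sets are never used. For `d < 0` only the
empty complex qualifies. -/
structure WeightedComplex (Λ : AddSubgroup V) extends PolyComplex Λ where
  d : ℤ
  pure : ∀ σ ∈ cells, ∃ τ ∈ cells, σ ⊆ τ ∧ dim τ = d
  weight : Set V → ℚ

namespace WeightedComplex

variable {Λ : AddSubgroup V}

def facets (X : WeightedComplex Λ) : Set (Set V) := {σ | σ ∈ X.cells ∧ dim σ = X.d}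

def support (X : WeightedComplex Λ) : Set V :=
  {x | ∃ σ ∈ X.facets, X.weight σ ≠ 0 ∧ x ∈ σ}

/-- Balanced weighted complexes, that is, tropical cycles. The sum is a rational vector, so lying
in the real span of `N_τ` is the same as lying in its rational span. -/
def IsBalanced (X : WeightedComplex Λ) : Prop :=
  ∀ τ ∈ X.cells, dim τ = X.d - 1 →
    (∑ᶠ σ ∈ {σ | σ ∈ X.facets ∧ τ ⊆ σ}, (X.weight σ : ℝ) • normalVector Λ τ σ) ∈
      Submodule.span ℝ (latticeOf Λ τ : Set V)

/-- The multiplicity of `γ` in the common refinement `X ∧ Z`; it is `0` if `γ` is not a facet of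
that refinement. For a facet `γ` the sum has exactly one term. -/
noncomputable def refinedWeight (X : WeightedComplex Λ) (Z : PolyComplex Λ) (γ : Set V) : ℚ :=
  ∑ᶠ σ ∈ {σ | σ ∈ X.facets ∧ γ.Nonempty ∧ dim γ = X.d ∧ ∃ τ ∈ Z.cells, γ = σ ∩ τ}, X.weight σ

/-- `X` and `Y` are the same cycle: they have a common refinement by a complete complex, with
multiplicities, where facets of multiplicity zero are ignored. -/
def SameCycle (X Y : WeightedComplex Λ) : Prop :=
  ∃ Z : PolyComplex Λ, Z.IsComplete ∧ ∀ γ, X.refinedWeight Z γ = Y.refinedWeight Z γ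

end WeightedComplex

/-! Common refinements and products of complexes. -/

lemma isFace_inter {F G P Q : Set V} (hF : IsFace F P) (hG : IsFace G Q)
    (h : (F ∩ G).Nonempty) : IsFace (F ∩ G) (P ∩ Q) := by
  obtain ⟨-, l, rfl⟩ := hF
  obtain ⟨-, m, rfl⟩ := hG
  refine ⟨h, l + m, ?_⟩
  obtain ⟨x, ⟨hxP, hx⟩, hxQ, hx'⟩ := h
  ext y
  constructor
  · rintro ⟨⟨hyP, hy⟩, hyQ, hy'⟩
    exact ⟨⟨hyP, hyQ⟩, fun z hz => add_le_add (hy z hz.1) (hy' z hz.2)⟩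
  · rintro ⟨⟨hyP, hyQ⟩, hy⟩
    have h0 := hy x ⟨hxP, hxQ⟩
    simp only [LinearMap.add_apply] at h0
    have h1 := hx y hyP
    have h2 := hx' y hyQ
    exact ⟨⟨hyP, fun z hz => by linarith [hx z hz]⟩, hyQ, fun z hz => by linarith [hx' z hz]⟩

/-- The part of a polyhedron where the inequalities tight at `x` are tight is a face. -/
lemma isFace_tight (s : Finset ((V →ₗ[ℝ] ℝ) × ℝ)) {x : V} (hx : ∀ p ∈ s, p.1 x ≤ p.2) :
    IsFace {y | (∀ p ∈ s, p.1 y ≤ p.2) ∧ ∀ p ∈ s, p.1 x = p.2 → p.1 y = p.2}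
      {y | ∀ p ∈ s, p.1 y ≤ p.2} := by
  classical
  refine ⟨⟨x, hx, fun p _ h => h⟩, ∑ p ∈ s with p.1 x = p.2, p.1, ?_⟩
  ext y
  simp only [Set.mem_ofPred_eq, LinearMap.sum_apply]
  refine and_congr_right fun hy => ⟨fun h z hz => ?_, fun h p hp hpx => ?_⟩
  · refine Finset.sum_le_sum fun p hp => ?_
    rw [Finset.mem_filter] at hp
    rw [h p hp.1 hp.2]
    exact hz p hp.1
  · have h1 := h x hx
    have h2 : ∀ p ∈ s.filter (fun p => p.1 x = p.2), p.1 y ≤ p.1 x := fun p hp => by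
      rw [Finset.mem_filter] at hp
      rw [hp.2]
      exact hy p hp.1
    have h3 := (Finset.sum_eq_sum_iff_of_le h2).1 (le_antisymm (Finset.sum_le_sum h2) h1)
    rw [h3 p (Finset.mem_filter.2 ⟨hp, hpx⟩), hpx]

/-- A face of a polyhedron is cut out by the inequalities tight at a suitable point of it. -/
lemma exists_tight_of_isFace (s : Finset ((V →ₗ[ℝ] ℝ) × ℝ)) {F : Set V}
    (hF : IsFace F {y | ∀ p ∈ s, p.1 y ≤ p.2}) :
    ∃ x ∈ F, F = {y | (∀ p ∈ s, p.1 y ≤ p.2) ∧ ∀ p ∈ s, p.1 x = p.2 → p.1 y = p.2} := by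
  classical
  obtain ⟨hne, l, hl⟩ := hF
  have hFP : ∀ y ∈ F, ∀ p ∈ s, p.1 y ≤ p.2 := fun y hy => by
    rw [hl] at hy
    exact hy.1
  have hmax : ∀ y ∈ F, ∀ z, (∀ p ∈ s, p.1 z ≤ p.2) → l z ≤ l y := fun y hy => by
    rw [hl] at hy
    exact hy.2
  let c : V → ℕ := fun y => (s.filter (fun p : (V →ₗ[ℝ] ℝ) × ℝ => p.1 y = p.2)).card
  obtain ⟨x, hx, hmin⟩ : ∃ x ∈ F, ∀ z ∈ F, ¬ c z < c x := by
    obtain ⟨_, ⟨x, hx, rfl⟩, h⟩ := (wellFounded_lt (α := ℕ)).has_min (c '' F) (hne.image _)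
    exact ⟨x, hx, fun z hz => h _ ⟨z, hz, rfl⟩⟩
  refine ⟨x, hx, ?_⟩
  ext y
  constructor
  · intro hy
    refine ⟨hFP y hy, fun p hp hpx => ?_⟩
    by_contra hpy
    have hlt : p.1 y < p.2 := lt_of_le_of_ne (hFP y hy p hp) hpy
    set z : V := (1 / 2 : ℝ) • x + (1 / 2 : ℝ) • y with hz
    have hzval : ∀ q : V →ₗ[ℝ] ℝ, q z = 1 / 2 * q x + 1 / 2 * q y := fun q => by simp [hz]
    have hzF : z ∈ F := by
      rw [hl]
      refine ⟨fun q hq => ?_, fun w hw => ?_⟩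
      · rw [hzval]
        linarith [hFP x hx q hq, hFP y hy q hq]
      · rw [hzval]
        linarith [hmax x hx w hw, hmax y hy w hw]
    refine hmin z hzF (Finset.card_lt_card ?_)
    refine Finset.ssubset_iff_of_subset ?_ |>.2 ⟨p, Finset.mem_filter.2 ⟨hp, hpx⟩, fun h => ?_⟩
    · intro q hq
      rw [Finset.mem_filter] at hq ⊢
      have h1 := hq.2
      rw [hzval] at h1
      exact ⟨hq.1, by linarith [hFP x hx q hq.1, hFP y hy q hq.1]⟩
    · have h1 := (Finset.mem_filter.1 h).2
      rw [hzval] at h1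
      linarith
  · rintro ⟨hyP, hy⟩
    have hev : ∀ p ∈ s, ∃ δ : ℝ, 0 < δ ∧ ∀ ε : ℝ, 0 < ε → ε ≤ δ →
        p.1 (x + ε • (x - y)) ≤ p.2 := by
      intro p hp
      by_cases hpx : p.1 x = p.2
      · refine ⟨1, one_pos, fun ε _ _ => ?_⟩
        simp [hpx, hy p hp hpx]
      · have hlt : 0 < p.2 - p.1 x := sub_pos.2 (lt_of_le_of_ne (hFP x hx p hp) hpx)
        have hden : 0 < |p.1 x - p.1 y| + 1 := by positivity
        refine ⟨(p.2 - p.1 x) / (|p.1 x - p.1 y| + 1), div_pos hlt hden, fun ε h0 h1 => ?_⟩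
        have h2 : ε * (|p.1 x - p.1 y| + 1) ≤ p.2 - p.1 x := (le_div_iff₀ hden).1 h1
        have h3 : ε * (p.1 x - p.1 y) ≤ ε * (|p.1 x - p.1 y| + 1) :=
          mul_le_mul_of_nonneg_left (by linarith [le_abs_self (p.1 x - p.1 y)]) h0.le
        simp only [map_add, map_smul, map_sub, smul_eq_mul]
        linarith
    have hall : ∃ δ : ℝ, 0 < δ ∧ ∀ p ∈ s, p.1 (x + δ • (x - y)) ≤ p.2 := by
      choose! δ hδ0 hδ using hev
      by_cases hs : s.Nonempty
      · refine ⟨s.inf' hs δ, (Finset.lt_inf'_iff hs).2 hδ0, fun p hp => ?_⟩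
        exact hδ p hp _ ((Finset.lt_inf'_iff hs).2 hδ0) (Finset.inf'_le δ hp)
      · rw [Finset.not_nonempty_iff_eq_empty] at hs
        exact ⟨1, one_pos, by simp [hs]⟩
    obtain ⟨δ, hδ0, hδ⟩ := hall
    have h1 := hmax x hx _ hδ
    simp only [map_add, map_smul, map_sub, smul_eq_mul] at h1
    have h2 : l x ≤ l y := by nlinarith
    rw [hl]
    exact ⟨hyP, fun z hz => (hmax x hx z hz).trans h2⟩

lemma exists_of_isFace_inter {Λ : AddSubgroup V} {P Q F : Set V}
    (hP : IsRationalPolyhedron Λ P) (hQ : IsRationalPolyhedron Λ Q) (hF : IsFace F (P ∩ Q)) :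
    ∃ F₁ F₂, IsFace F₁ P ∧ IsFace F₂ Q ∧ F = F₁ ∩ F₂ := by
  classical
  obtain ⟨s, -, rfl⟩ := hP
  obtain ⟨t, -, rfl⟩ := hQ
  have hst : {x : V | ∀ p ∈ s, p.1 x ≤ p.2} ∩ {x | ∀ p ∈ t, p.1 x ≤ p.2} =
      {x | ∀ p ∈ s ∪ t, p.1 x ≤ p.2} := by
    ext x
    simp only [Set.mem_inter_iff, Set.mem_ofPred_eq, Finset.mem_union, or_imp, forall_and]
  rw [hst] at hF
  obtain ⟨x, hx, hFx⟩ := exists_tight_of_isFace (s ∪ t) hF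
  have hx' : ∀ p ∈ s ∪ t, p.1 x ≤ p.2 := by
    rw [hFx] at hx
    exact hx.1
  refine ⟨_, _, isFace_tight s fun p hp => hx' p (Finset.mem_union_left t hp),
    isFace_tight t fun p hp => hx' p (Finset.mem_union_right s hp), ?_⟩
  rw [hFx]
  ext y
  simp only [Set.mem_inter_iff, Set.mem_ofPred_eq, Finset.mem_union, or_imp, forall_and]
  tauto

lemma IsRationalPolyhedron.inter {Λ : AddSubgroup V} {P Q : Set V}
    (hP : IsRationalPolyhedron Λ P) (hQ : IsRationalPolyhedron Λ Q) :
    IsRationalPolyhedron Λ (P ∩ Q) := by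
  classical
  obtain ⟨s, hs, rfl⟩ := hP
  obtain ⟨t, ht, rfl⟩ := hQ
  refine ⟨s ∪ t, fun p hp => (Finset.mem_union.1 hp).elim (hs p) (ht p), ?_⟩
  ext x
  simp only [Set.mem_inter_iff, Set.mem_ofPred_eq, Finset.mem_union, or_imp, forall_and]

/-- The common refinement `{σ ∩ τ}`. -/
def PolyComplex.inter {Λ : AddSubgroup V} (X Y : PolyComplex Λ) : PolyComplex Λ where
  cells := {γ | γ.Nonempty ∧ ∃ σ ∈ X.cells, ∃ τ ∈ Y.cells, γ = σ ∩ τ}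
  finite := by
    refine (X.finite.image2 (fun σ τ => σ ∩ τ) Y.finite).subset ?_
    rintro γ ⟨-, σ, hσ, τ, hτ, rfl⟩
    exact ⟨σ, hσ, τ, hτ, rfl⟩
  nonempty := fun _ h => h.1
  polyhedral := by
    rintro γ ⟨-, σ, hσ, τ, hτ, rfl⟩
    exact (X.polyhedral σ hσ).inter (Y.polyhedral τ hτ)
  face_mem := by
    rintro γ ⟨-, σ, hσ, τ, hτ, rfl⟩ F hF
    obtain ⟨F₁, F₂, h₁, h₂, rfl⟩ :=
      exists_of_isFace_inter (X.polyhedral σ hσ) (Y.polyhedral τ hτ) hF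
    exact ⟨hF.1, F₁, X.face_mem σ hσ F₁ h₁, F₂, Y.face_mem τ hτ F₂ h₂, rfl⟩
  inter_face := by
    rintro γ ⟨-, σ, hσ, τ, hτ, rfl⟩ γ' ⟨-, σ', hσ', τ', hτ', rfl⟩ h
    rw [Set.inter_inter_inter_comm] at h ⊢
    exact isFace_inter (X.inter_face σ hσ σ' hσ' h.left) (Y.inter_face τ hτ τ' hτ' h.right) h

end Polyhedra

section Product

variable {V W : Type*} [NormedAddCommGroup V] [NormedSpace ℝ V]
  [NormedAddCommGroup W] [NormedSpace ℝ W]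

lemma dim_prod [FiniteDimensional ℝ V] [FiniteDimensional ℝ W] {σ : Set V} {τ : Set W}
    (hσ : σ.Nonempty) (hτ : τ.Nonempty) : dim (σ ×ˢ τ) = dim σ + dim τ := by
  obtain ⟨x, hx⟩ := hσ
  obtain ⟨y, hy⟩ := hτ
  have h : vectorSpan ℝ (σ ×ˢ τ) = (vectorSpan ℝ σ).prod (vectorSpan ℝ τ) := by
    apply le_antisymm
    · refine Submodule.span_le.2 ?_
      rintro _ ⟨p, hp, q, hq, rfl⟩
      exact ⟨vsub_mem_vectorSpan ℝ hp.1 hq.1, vsub_mem_vectorSpan ℝ hp.2 hq.2⟩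
    · have h1 : vectorSpan ℝ σ ≤ (vectorSpan ℝ (σ ×ˢ τ)).comap (LinearMap.inl ℝ V W) := by
        refine Submodule.span_le.2 ?_
        rintro _ ⟨p, hp, q, hq, rfl⟩
        have := vsub_mem_vectorSpan ℝ (show (p, y) ∈ σ ×ˢ τ from ⟨hp, hy⟩)
          (show (q, y) ∈ σ ×ˢ τ from ⟨hq, hy⟩)
        simpa using this
      have h2 : vectorSpan ℝ τ ≤ (vectorSpan ℝ (σ ×ˢ τ)).comap (LinearMap.inr ℝ V W) := by
        refine Submodule.span_le.2 ?_
        rintro _ ⟨p, hp, q, hq, rfl⟩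
        have := vsub_mem_vectorSpan ℝ (show (x, p) ∈ σ ×ˢ τ from ⟨hx, hp⟩)
          (show (x, q) ∈ σ ×ˢ τ from ⟨hx, hq⟩)
        simpa using this
      rintro ⟨u, v⟩ ⟨hu, hv⟩
      have h3 : ((u, 0) : V × W) ∈ vectorSpan ℝ (σ ×ˢ τ) := h1 hu
      have h4 : ((0, v) : V × W) ∈ vectorSpan ℝ (σ ×ˢ τ) := h2 hv
      have := Submodule.add_mem _ h3 h4
      simpa using this
  let e : ((vectorSpan ℝ σ).prod (vectorSpan ℝ τ)) ≃ₗ[ℝ] vectorSpan ℝ σ × vectorSpan ℝ τ :=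
    { toFun := fun z => (⟨z.1.1, z.2.1⟩, ⟨z.1.2, z.2.2⟩)
      invFun := fun z => ⟨(z.1.1, z.2.1), z.1.2, z.2.2⟩
      map_add' := fun _ _ => rfl
      map_smul' := fun _ _ => rfl
      left_inv := fun _ => rfl
      right_inv := fun _ => rfl }
  unfold dim
  rw [h, e.finrank_eq, Module.finrank_prod]
  push_cast
  rfl

lemma IsFace.prod {F P : Set V} {G Q : Set W} (hF : IsFace F P) (hG : IsFace G Q) :
    IsFace (F ×ˢ G) (P ×ˢ Q) := by
  obtain ⟨⟨x, hx⟩, l, rfl⟩ := hF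
  obtain ⟨⟨y, hy⟩, m, rfl⟩ := hG
  refine ⟨⟨(x, y), hx, hy⟩, l.coprod m, ?_⟩
  ext ⟨a, b⟩
  constructor
  · rintro ⟨⟨ha, ha'⟩, hb, hb'⟩
    exact ⟨⟨ha, hb⟩, fun z hz => add_le_add (ha' _ hz.1) (hb' _ hz.2)⟩
  · rintro ⟨⟨ha, hb⟩, h⟩
    refine ⟨⟨ha, fun z hz => ?_⟩, hb, fun z hz => ?_⟩
    · have := h (z, b) ⟨hz, hb⟩
      simpa using this
    · have := h (a, z) ⟨ha, hz⟩
      simpa using this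

lemma exists_of_isFace_prod {P : Set V} {Q : Set W} {F : Set (V × W)} (hF : IsFace F (P ×ˢ Q)) :
    ∃ F₁ F₂, IsFace F₁ P ∧ IsFace F₂ Q ∧ F = F₁ ×ˢ F₂ := by
  obtain ⟨⟨⟨x, y⟩, hxy⟩, l, hl⟩ := hF
  have hval : ∀ a b, l (a, b) = l (a, 0) + l (0, b) := fun a b => by
    rw [← map_add, Prod.mk_add_mk, add_zero, zero_add]
  have key : ∀ a b, (a, b) ∈ F ↔ (a ∈ P ∧ ∀ z ∈ P, l (z, 0) ≤ l (a, 0)) ∧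
      (b ∈ Q ∧ ∀ z ∈ Q, l (0, z) ≤ l (0, b)) := by
    intro a b
    rw [hl]
    constructor
    · rintro ⟨⟨ha, hb⟩, h⟩
      refine ⟨⟨ha, fun z hz => ?_⟩, hb, fun z hz => ?_⟩
      · have := h (z, b) ⟨hz, hb⟩
        rw [hval z b, hval a b] at this
        linarith
      · have := h (a, z) ⟨ha, hz⟩
        rw [hval a z, hval a b] at this
        linarith
    · rintro ⟨⟨ha, ha'⟩, hb, hb'⟩
      refine ⟨⟨ha, hb⟩, ?_⟩
      rintro ⟨c, e⟩ hz
      rw [hval a b, hval c e]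
      exact add_le_add (ha' _ hz.1) (hb' _ hz.2)
  have h0 := (key x y).1 hxy
  refine ⟨{a | a ∈ P ∧ ∀ z ∈ P, l (z, 0) ≤ l (a, 0)}, {b | b ∈ Q ∧ ∀ z ∈ Q, l (0, z) ≤ l (0, b)},
    ⟨⟨x, h0.1⟩, l.comp (LinearMap.inl ℝ V W), rfl⟩,
    ⟨⟨y, h0.2⟩, l.comp (LinearMap.inr ℝ V W), rfl⟩, ?_⟩
  ext ⟨a, b⟩
  exact key a b

lemma IsRationalPolyhedron.prod {Λ : AddSubgroup V} {Λ' : AddSubgroup W} {P : Set V} {Q : Set W}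
    (hP : IsRationalPolyhedron Λ P) (hQ : IsRationalPolyhedron Λ' Q) :
    IsRationalPolyhedron (Λ.prod Λ') (P ×ˢ Q) := by
  classical
  obtain ⟨s, hs, rfl⟩ := hP
  obtain ⟨t, ht, rfl⟩ := hQ
  refine ⟨s.image (fun p => (p.1.comp (LinearMap.fst ℝ V W), p.2)) ∪
    t.image (fun p => (p.1.comp (LinearMap.snd ℝ V W), p.2)), ?_, ?_⟩
  · intro p hp u hu
    rcases Finset.mem_union.1 hp with h | h
    · obtain ⟨q, hq, rfl⟩ := Finset.mem_image.1 h
      exact hs q hq u.1 hu.1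
    · obtain ⟨q, hq, rfl⟩ := Finset.mem_image.1 h
      exact ht q hq u.2 hu.2
  · ext ⟨a, b⟩
    simp only [Set.mem_prod, Set.mem_ofPred_eq, Finset.mem_union, or_imp, forall_and,
      Finset.forall_mem_image, LinearMap.comp_apply, LinearMap.fst_apply, LinearMap.snd_apply]

/-- The product of weighted complexes; the weight of `σ × τ` is the product of the weights. -/
noncomputable def WeightedComplex.prod [FiniteDimensional ℝ V] [FiniteDimensional ℝ W]
    {Λ : AddSubgroup V} {Λ' : AddSubgroup W} (X : WeightedComplex Λ) (Y : WeightedComplex Λ') :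
    WeightedComplex (Λ.prod Λ') where
  cells := {γ | ∃ σ ∈ X.cells, ∃ τ ∈ Y.cells, γ = σ ×ˢ τ}
  finite := by
    refine (X.finite.image2 (fun σ τ => σ ×ˢ τ) Y.finite).subset ?_
    rintro γ ⟨σ, hσ, τ, hτ, rfl⟩
    exact ⟨σ, hσ, τ, hτ, rfl⟩
  nonempty := by
    rintro γ ⟨σ, hσ, τ, hτ, rfl⟩
    exact (X.nonempty σ hσ).prod (Y.nonempty τ hτ)
  polyhedral := by
    rintro γ ⟨σ, hσ, τ, hτ, rfl⟩
    exact (X.polyhedral σ hσ).prod (Y.polyhedral τ hτ)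
  face_mem := by
    rintro γ ⟨σ, hσ, τ, hτ, rfl⟩ F hF
    obtain ⟨F₁, F₂, h₁, h₂, rfl⟩ := exists_of_isFace_prod hF
    exact ⟨F₁, X.face_mem σ hσ F₁ h₁, F₂, Y.face_mem τ hτ F₂ h₂, rfl⟩
  inter_face := by
    rintro γ ⟨σ, hσ, τ, hτ, rfl⟩ γ' ⟨σ', hσ', τ', hτ', rfl⟩ h
    rw [Set.prod_inter_prod] at h ⊢
    exact (X.inter_face σ hσ σ' hσ' h.fst).prod (Y.inter_face τ hτ τ' hτ' h.snd)
  d := X.d + Y.d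
  pure := by
    rintro γ ⟨σ, hσ, τ, hτ, rfl⟩
    obtain ⟨σ', hσ', h₁, h₂⟩ := X.pure σ hσ
    obtain ⟨τ', hτ', h₃, h₄⟩ := Y.pure τ hτ
    exact ⟨σ' ×ˢ τ', ⟨σ', hσ', τ', hτ', rfl⟩, Set.prod_mono h₁ h₃,
      by rw [dim_prod (X.nonempty σ' hσ') (Y.nonempty τ' hτ'), h₂, h₄]⟩
  weight := fun γ => X.weight (Prod.fst '' γ) * Y.weight (Prod.snd '' γ)

end Product

section Stable

variable {V : Type*} [NormedAddCommGroup V] [NormedSpace ℝ V] {Λ : AddSubgroup V}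

/-- The support of the link of `X` at `ω`. -/
def WeightedComplex.linkSupport (X : WeightedComplex Λ) (ω : V) : Set V :=
  {u | ∃ σ ∈ X.facets, X.weight σ ≠ 0 ∧ ω ∈ σ ∧ u ∈ link ω σ}

/-- The points `ω` such that the Minkowski sum `link_ω X - link_ω Y` is the whole space. -/
def stableSupport (X Y : WeightedComplex Λ) : Set V :=
  {ω | X.linkSupport ω - Y.linkSupport ω = Set.univ}

/-- The multiplicity of `link_γ X - link_γ Y` at `v`, for generic `v`. -/
noncomputable def minkowskiMult (X Y : WeightedComplex Λ) (γ : Set V) (v : V) : ℚ :=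
  ∑ᶠ p ∈ {p : Set V × Set V | p.1 ∈ X.facets ∧ p.2 ∈ Y.facets ∧ γ ⊆ p.1 ∧ γ ⊆ p.2 ∧
      v ∈ linkAlong γ p.1 - linkAlong γ p.2},
    X.weight p.1 * Y.weight p.2 * ((latticeOf Λ p.1 ⊔ latticeOf Λ p.2).relIndex Λ : ℚ)

/-- `f` takes the value `m` on a dense open set. -/
def IsGenericValue (f : V → ℚ) (m : ℚ) : Prop :=
  ∃ U : Set V, IsOpen U ∧ Dense U ∧ ∀ v ∈ U, f v = m

noncomputable def genericValue (f : V → ℚ) : ℚ := Classical.epsilon (IsGenericValue f)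

/-- The stable intersection `X · Y`: the subcomplex of the common refinement of `X` and `Y` whose
facets are the cells `γ` of codimension `codim X + codim Y` on which `link X - link Y` is the whole
space; the multiplicity of `γ` is the generic multiplicity of `link_γ X - link_γ Y`. -/
noncomputable def stableIntersection (X Y : WeightedComplex Λ) : WeightedComplex Λ where
  cells := {γ | γ ∈ (X.toPolyComplex.inter Y.toPolyComplex).cells ∧
    ∃ γ' ∈ (X.toPolyComplex.inter Y.toPolyComplex).cells, γ ⊆ γ' ∧
      dim γ' = X.d + Y.d - Module.finrank ℝ V ∧ γ' ⊆ stableSupport X Y}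
  finite := (PolyComplex.finite _).subset fun _ h => h.1
  nonempty := fun γ h => PolyComplex.nonempty _ γ h.1
  polyhedral := fun γ h => PolyComplex.polyhedral _ γ h.1
  face_mem := by
    rintro γ ⟨hγ, γ', hγ', hsub, h⟩ F hF
    refine ⟨PolyComplex.face_mem _ γ hγ F hF, γ', hγ', ?_, h⟩
    obtain ⟨-, l, rfl⟩ := hF
    exact fun x hx => hsub hx.1
  inter_face := fun γ h γ' h' => PolyComplex.inter_face _ γ h.1 γ' h'.1
  d := X.d + Y.d - Module.finrank ℝ V
  pure := by
    rintro γ ⟨hγ, γ', hγ', hsub, hdim, h⟩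
    exact ⟨γ', ⟨hγ', γ', hγ', subset_rfl, hdim, h⟩, hsub, hdim⟩
  weight := fun γ => genericValue (minkowskiMult X Y γ)

end Stable

section AllermannRau

variable {V W : Type*} [NormedAddCommGroup V] [NormedSpace ℝ V]
  [NormedAddCommGroup W] [NormedSpace ℝ W]

/-- On `σ` the function `φ` is integral affine with linear part `l` (which is determined on the
linear space parallel to `σ`). -/
def IsLinearPart (Λ : AddSubgroup V) (φ : V → ℝ) (σ : Set V) (l : V →ₗ[ℝ] ℝ) : Prop :=
  (∃ c : ℝ, ∀ x ∈ σ, φ x = l x + c) ∧ ∀ u ∈ latticeOf Λ σ, ∃ z : ℤ, l u = z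

/-- `D` represents the intersection product with the cycle `X` of the Cartier divisor given by the
rational function `φ`: for some representative `X'` of `X` such that `φ` is integral affine on
its cells, `D` is represented by the codimension one skeleton of `X'`, with weight
`∑ φ_σ (ω(σ) v_{σ/τ}) - φ_τ (∑ ω(σ) v_{σ/τ})` on `τ`, the sums being over the facets `σ ⊃ τ`. -/
def IsDivisor {Λ : AddSubgroup V} (φ : V → ℝ) (X D : WeightedComplex Λ) : Prop :=
  ∃ X' D' : WeightedComplex Λ, ∃ l : Set V → V →ₗ[ℝ] ℝ,
    X'.IsBalanced ∧ X'.SameCycle X ∧ D'.SameCycle D ∧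
    (∀ σ ∈ X'.cells, IsLinearPart Λ φ σ (l σ)) ∧
    D'.d = X'.d - 1 ∧
    D'.cells = {ρ | ρ ∈ X'.cells ∧ ∃ τ ∈ X'.cells, ρ ⊆ τ ∧ dim τ = X'.d - 1} ∧
    ∀ τ ∈ D'.facets, (D'.weight τ : ℝ) =
      (∑ᶠ σ ∈ {σ | σ ∈ X'.facets ∧ τ ⊆ σ}, l σ ((X'.weight σ : ℝ) • normalVector Λ τ σ)) -
        l τ (∑ᶠ σ ∈ {σ | σ ∈ X'.facets ∧ τ ⊆ σ}, (X'.weight σ : ℝ) • normalVector Λ τ σ)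

/-- `P` represents the push-forward of the cycle `X` along the linear map `f`. -/
def IsPushforward {Λ : AddSubgroup V} {Λ' : AddSubgroup W} (f : V →ₗ[ℝ] W)
    (X : WeightedComplex Λ) (P : WeightedComplex Λ') : Prop :=
  ∃ (X' : WeightedComplex Λ) (P' : WeightedComplex Λ'),
    X'.IsBalanced ∧ X'.SameCycle X ∧ P'.SameCycle P ∧
    P'.d = X'.d ∧
    P'.cells = {ρ | ∃ σ ∈ X'.cells, (∃ σ' ∈ X'.facets, σ ⊆ σ' ∧ Set.InjOn f σ') ∧ ρ = f '' σ} ∧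
    ∀ ρ ∈ P'.facets, P'.weight ρ = ∑ᶠ σ ∈ {σ | σ ∈ X'.facets ∧ f '' σ = ρ},
      X'.weight σ *
        (((latticeOf Λ σ).map f.toAddMonoidHom).relIndex (latticeOf Λ' ρ) : ℚ)

/-- The lattice generated by a basis. -/
def latticeSpan {n : ℕ} (b : Module.Basis (Fin n) ℝ V) : AddSubgroup V :=
  AddSubgroup.closure (Set.range b)

/-- `P` represents the Allermann--Rau product
`π_* (max(x₁, y₁) ⋯ max(xₙ, yₙ) · (X × Y))`, where `xᵢ, yᵢ` are the coordinates on the two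
factors and `π` is the first projection. -/
def IsAllermannRauProduct [FiniteDimensional ℝ V] {n : ℕ} (b : Module.Basis (Fin n) ℝ V)
    (X Y P : WeightedComplex (latticeSpan b)) : Prop :=
  ∃ D : Fin (n + 1) → WeightedComplex ((latticeSpan b).prod (latticeSpan b)),
    D 0 = X.prod Y ∧
    (∀ i : Fin n, IsDivisor (fun p : V × V => max (b.repr p.1 i) (b.repr p.2 i))
      (D i.castSucc) (D i.succ)) ∧
    IsPushforward (LinearMap.fst ℝ V V) (D (Fin.last n)) P

end AllermannRau

end TropInt

/-! Two cycles are compared through numbers that determine a cycle. For a weighted complex `Z`, a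
linear map `Q` to `ℝ^ι` that is integral on the lattice, and a point `ω`, the local degree over `w`
counts the facets of dimension `|ι|` whose link at `ω` has an image containing `w`, each with its
weight times the index of `Q(N_σ)` in `ℤ^ι`.

Three facts make these numbers useful. If `Z` is balanced, the degree is the same over all generic
`w` (`WeightedComplex.IsBalanced.localDegree_eq`): generic values are joined by a segment avoiding
images of codimension two, and the jump across the image of a codimension one cell is a multiple of
a functional, vanishing on that image, evaluated at the `Q`-image of the balancing sum. Conversely,
constancy for all `Q` and `ω` forces balancing (`WeightedComplex.isBalanced_of_localDegree`).
Finally, when `Q` gives coordinates along a cell `γ` of a fine enough complete complex, the degree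
at a relative interior point of `γ` is the multiplicity of `γ` times a nonzero index, so equal
degrees mean equal cycles (`WeightedComplex.sameCycle_of_localDegree`). Since generic degrees depend
only on the cycle, invariance of balancing and transitivity of `SameCycle` follow as well.

For a divisor, put `z = a - c` and let `z ω = 0`. The generic degree of `max(a, c) · Z` under `Q` is
that of `Z` under `(z, Q)` (`IsDivisorSkeleton.isGenericValue`). Indeed, over `(t, w)` with small `t
> 0` the facets met are those next to a codimension one cell `τ` in `{z = 0}` met over `w`, with
normal vector `v` such that `z v > 0`; each has index `z v` times that of `τ`, and the sum
reproduces the weight of the divisor. Iterating, and because projecting from the diagonal changes no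
degree, the degree of the Allermann–Rau product at `ω` under `Q` is that of `X × Y` at `(ω, ω)`
under `(u, v) ↦ (u - v, Q u)`, the map `doubleMap`.

On the other side, the index of the image of `N_σ × N_τ` under `doubleMap` is `[N : N_σ + N_τ] ·
[ℤ^ι : Q(N_σ ∩ N_τ)]` (`mapIndex_doubleMap`). At a relative interior point of a cell of the expected
dimension the same degree is therefore the generic multiplicity of the difference of the links times
the index of that cell. A nonzero degree also makes the differences of links cover the space, so the
cell belongs to the stable intersection (`localDegree_stableIntersection`). Both cycles thus have
the same degrees.

For the converse implication one product is constructed (`exists_isDivisorChain`,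
`exists_isPushforward`); every representative of its cycle is then admissible. With nonnegative
weights, at a point of the stable support some pair of facets of positive weight is transversal; its
term in the degree cannot be cancelled, so the point lies in the support of the product. -/

open scoped Pointwise

namespace TropInt

/-! ### Polyhedra: tight inequalities and relative interiors -/

section Polyhedron

variable {V : Type*} [NormedAddCommGroup V] [NormedSpace ℝ V]

/-- Linear functionals with integral values on `Λ`. -/
def IsIntegral (Λ : AddSubgroup V) (l : V →ₗ[ℝ] ℝ) : Prop := ∀ u ∈ Λ, ∃ z : ℤ, l u = z

variable {Λ : AddSubgroup V} {P F : Set V} {ω u : V}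

lemma IsRationalPolyhedron.convex (hP : IsRationalPolyhedron Λ P) : Convex ℝ P := by
  obtain ⟨s, -, rfl⟩ := hP
  intro x hx y hy a b ha hb hab p hp
  have h1 := mul_le_mul_of_nonneg_left (hx p hp) ha
  have h2 := mul_le_mul_of_nonneg_left (hy p hp) hb
  have h3 : a * p.2 + b * p.2 = p.2 := by rw [← add_mul, hab, one_mul]
  simp only [map_add, map_smul, smul_eq_mul]
  linarith

lemma IsRationalPolyhedron.isClosed [FiniteDimensional ℝ V] (hP : IsRationalPolyhedron Λ P) :
    IsClosed P := by
  obtain ⟨s, -, rfl⟩ := hP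
  have : {x : V | ∀ p ∈ s, p.1 x ≤ p.2} = ⋂ p ∈ s, {x | p.1 x ≤ p.2} := by ext; simp
  rw [this]
  exact isClosed_biInter fun p _ =>
    isClosed_le (LinearMap.continuous_of_finiteDimensional p.1) continuous_const

/-- For finitely many affine inequalities: those strict at `ω` stay valid near `ω`. -/
lemma exists_pos_forall_of_tight (s : Finset ((V →ₗ[ℝ] ℝ) × ℝ)) (hω : ∀ p ∈ s, p.1 ω ≤ p.2)
    (hu : ∀ p ∈ s, p.1 ω = p.2 → p.1 u ≤ 0) :
    ∃ δ : ℝ, 0 < δ ∧ ∀ ε : ℝ, 0 ≤ ε → ε < δ → ∀ p ∈ s, p.1 (ω + ε • u) ≤ p.2 := by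
  classical
  induction s using Finset.induction_on with
  | empty => exact ⟨1, one_pos, by simp⟩
  | insert p s hps ih =>
    obtain ⟨δ, hδ, h⟩ := ih (fun q hq => hω q (Finset.mem_insert_of_mem hq))
      (fun q hq => hu q (Finset.mem_insert_of_mem hq))
    have hp : ∃ δ' : ℝ, 0 < δ' ∧ ∀ ε : ℝ, 0 ≤ ε → ε < δ' → p.1 (ω + ε • u) ≤ p.2 := by
      have h0 := hω p (Finset.mem_insert_self _ _)
      rcases h0.lt_or_eq with hlt | heq
      · refine ⟨(p.2 - p.1 ω) / (|p.1 u| + 1), div_pos (by linarith) (by positivity),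
          fun ε h0 h1 => ?_⟩
        rw [lt_div_iff₀ (by positivity)] at h1
        have h2 : ε * p.1 u ≤ ε * |p.1 u| := mul_le_mul_of_nonneg_left (le_abs_self _) h0
        simp only [map_add, map_smul, smul_eq_mul]
        linarith
      · refine ⟨1, one_pos, fun ε h1 _ => ?_⟩
        have h2 := mul_nonpos_of_nonneg_of_nonpos h1 (hu p (Finset.mem_insert_self _ _) heq)
        simp only [map_add, map_smul, smul_eq_mul]
        linarith
    obtain ⟨δ', hδ', h'⟩ := hp
    refine ⟨min δ δ', lt_min hδ hδ', fun ε h0 h1 q hq => ?_⟩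
    rcases Finset.mem_insert.1 hq with rfl | hq
    · exact h' ε h0 (h1.trans_le (min_le_right _ _))
    · exact h ε h0 (h1.trans_le (min_le_left _ _)) q hq

/-- Inequalities strict at `ω` survive small moves, so only the tight ones constrain the link. -/
lemma mem_link_polyhedron {s : Finset ((V →ₗ[ℝ] ℝ) × ℝ)} (hω : ∀ p ∈ s, p.1 ω ≤ p.2) :
    u ∈ link ω {x | ∀ p ∈ s, p.1 x ≤ p.2} ↔ ∀ p ∈ s, p.1 ω = p.2 → p.1 u ≤ 0 := by
  constructor
  · rintro ⟨δ, hδ, h⟩ p hp he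
    have h1 := h (δ / 2) (by linarith) (by linarith) p hp
    simp only [map_add, map_smul, smul_eq_mul, he] at h1
    by_contra hcon
    have := mul_pos (half_pos hδ) (not_le.1 hcon)
    linarith
  · intro h
    obtain ⟨δ, hδ, h'⟩ := exists_pos_forall_of_tight s hω h
    exact ⟨δ, hδ, fun ε h0 h1 => h' ε h0.le h1⟩

lemma mem_relint_polyhedron [FiniteDimensional ℝ V] {s : Finset ((V →ₗ[ℝ] ℝ) × ℝ)} :
    ω ∈ intrinsicInterior ℝ {x | ∀ p ∈ s, p.1 x ≤ p.2} ↔ (∀ p ∈ s, p.1 ω ≤ p.2) ∧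
      ∀ p ∈ s, p.1 ω = p.2 → ∀ y, (∀ q ∈ s, q.1 y ≤ q.2) → p.1 y = p.2 := by
  set P : Set V := {x | ∀ p ∈ s, p.1 x ≤ p.2} with hP
  constructor
  · intro h
    have hω : ω ∈ P := intrinsicInterior_subset h
    refine ⟨hω, fun p hp he y hy => ?_⟩
    by_contra hne
    have hlt : p.1 y < p.2 := lt_of_le_of_ne (hy p hp) hne
    obtain ⟨x, hx, rfl⟩ := mem_intrinsicInterior.1 h
    have hy' : y ∈ affineSpan ℝ P := subset_affineSpan ℝ P hy
    -- Moving from `ω` slightly away from `y` stays in the affine span, hence in `P`, but pushes `p`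
    -- above the value at which it is tight.
    let f : ℝ → affineSpan ℝ P := fun t => ⟨AffineMap.lineMap (x : V) y t,
      AffineMap.lineMap_mem t x.2 hy'⟩
    have hf : Continuous f := by
      refine Continuous.subtype_mk ?_ _
      exact AffineMap.lineMap_continuous
    have hf0 : f 0 = x := by ext; simp [f]
    have hnhds : f ⁻¹' ((↑) ⁻¹' P) ∈ nhds (0 : ℝ) :=
      hf.continuousAt.preimage_mem_nhds (by rw [hf0]; exact mem_interior_iff_mem_nhds.1 hx)
    obtain ⟨ε, hε, hball⟩ := Metric.mem_nhds_iff.1 hnhds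
    have h1 : f (-(ε / 2)) ∈ ((↑) ⁻¹' P : Set (affineSpan ℝ P)) :=
      hball (by rw [Metric.mem_ball, Real.dist_eq, sub_zero, abs_neg, abs_of_pos (by linarith)]
                linarith)
    have h2 := h1 p hp
    simp only [f, AffineMap.lineMap_apply, vsub_eq_sub, vadd_eq_add, map_add, map_smul, map_sub,
      smul_eq_mul, he] at h2
    nlinarith
  · rintro ⟨hω, h⟩
    have hωP : ω ∈ P := hω
    rw [mem_intrinsicInterior]
    refine ⟨⟨ω, subset_affineSpan ℝ P hωP⟩, ?_, rfl⟩
    rw [mem_interior_iff_mem_nhds]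
    have hev : ∀ᶠ x : affineSpan ℝ P in nhds ⟨ω, subset_affineSpan ℝ P hωP⟩,
        ∀ p ∈ s, p.1 x ≤ p.2 := by
      rw [Filter.eventually_all_finset]
      intro p hp
      have hc : Continuous fun x : affineSpan ℝ P => p.1 (x : V) :=
        (LinearMap.continuous_of_finiteDimensional p.1).comp continuous_subtype_val
      rcases (hω p hp).lt_or_eq with hlt | he
      · exact ((hc.continuousAt.eventually_lt continuousAt_const hlt)).mono fun x hx => hx.le
      · refine Filter.Eventually.of_forall fun x => le_of_eq ?_
        have : affineSpan ℝ P ≤ AffineSubspace.comap p.1.toAffineMap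
            (AffineSubspace.mk' p.2 ⊥) := by
          rw [affineSpan_le]
          intro y hy
          simp [AffineSubspace.mem_mk', h p hp he y hy]
        have := this x.2
        simpa [AffineSubspace.mem_mk', sub_eq_zero] using this
    exact hev

lemma relint_nonempty [FiniteDimensional ℝ V] (hP : IsRationalPolyhedron Λ P)
    (hne : P.Nonempty) : (intrinsicInterior ℝ P).Nonempty :=
  hne.intrinsicInterior hP.convex

/-! ### Links as cones, and how they vary with the base point -/

section Link

variable (hP : IsRationalPolyhedron Λ P)
include hP

lemma mem_of_mem_link [FiniteDimensional ℝ V] (hu : u ∈ link ω P) : ω ∈ P := by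
  obtain ⟨δ, hδ, h⟩ := hu
  refine hP.isClosed.mem_of_tendsto (f := fun t : ℝ => ω + t • u) (b := nhdsWithin 0 (Set.Ioi 0))
    ?_ ?_
  · have : Filter.Tendsto (fun t : ℝ => ω + t • u) (nhds 0) (nhds (ω + (0 : ℝ) • u)) :=
      Continuous.tendsto (by fun_prop) 0
    rw [zero_smul, add_zero] at this
    exact this.mono_left nhdsWithin_le_nhds
  · filter_upwards [Ioo_mem_nhdsGT hδ] with t ht using h t ht.1 ht.2

lemma link_closed [FiniteDimensional ℝ V] : IsClosed (link ω P) := by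
  by_cases hω : ω ∈ P
  swap
  · have : link ω P = ∅ := Set.eq_empty_iff_forall_notMem.2 fun u hu => hω (mem_of_mem_link hP hu)
    rw [this]
    exact isClosed_empty
  obtain ⟨s, -, rfl⟩ := hP
  have : link ω {x : V | ∀ p ∈ s, p.1 x ≤ p.2} =
      ⋂ p ∈ s, {u | p.1 ω = p.2 → p.1 u ≤ 0} := by
    ext u
    rw [mem_link_polyhedron hω]
    simp
  rw [this]
  refine isClosed_biInter fun p _ => ?_
  by_cases h : p.1 ω = p.2
  · simp only [h, true_imp_iff]
    exact isClosed_le (LinearMap.continuous_of_finiteDimensional p.1) continuous_const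
  · simp [h]

omit hP in
lemma zero_mem_link (hω : ω ∈ P) : (0 : V) ∈ link ω P := ⟨1, one_pos, fun _ _ _ => by simpa using hω⟩

lemma link_add {v : V} (hω : ω ∈ P) (hu : u ∈ link ω P) (hv : v ∈ link ω P) :
    u + v ∈ link ω P := by
  obtain ⟨s, -, rfl⟩ := hP
  rw [mem_link_polyhedron hω] at hu hv ⊢
  intro p hp he
  rw [map_add]
  linarith [hu p hp he, hv p hp he]

lemma link_smul {c : ℝ} (hω : ω ∈ P) (hc : 0 ≤ c) (hu : u ∈ link ω P) : c • u ∈ link ω P := by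
  obtain ⟨s, -, rfl⟩ := hP
  rw [mem_link_polyhedron hω] at hu ⊢
  intro p hp he
  rw [map_smul, smul_eq_mul]
  exact mul_nonpos_of_nonneg_of_nonpos hc (hu p hp he)

lemma sub_mem_link {y : V} (hω : ω ∈ P) (hy : y ∈ P) : y - ω ∈ link ω P := by
  obtain ⟨s, -, rfl⟩ := hP
  rw [mem_link_polyhedron hω]
  intro p hp he
  rw [map_sub, he]
  linarith [hy p hp]

omit hP in
lemma link_mono {P' : Set V} (h : P ⊆ P') : link ω P ⊆ link ω P' :=
  fun _ ⟨δ, hδ, h'⟩ => ⟨δ, hδ, fun ε h0 h1 => h (h' ε h0 h1)⟩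

omit hP in
lemma link_inter {P' : Set V} : link ω (P ∩ P') = link ω P ∩ link ω P' := by
  refine Set.Subset.antisymm
    (fun u hu => ⟨link_mono Set.inter_subset_left hu, link_mono Set.inter_subset_right hu⟩) ?_
  rintro u ⟨⟨δ, hδ, h⟩, δ', hδ', h'⟩
  exact ⟨min δ δ', lt_min hδ hδ', fun ε h0 h1 => ⟨h ε h0 (h1.trans_le (min_le_left _ _)),
    h' ε h0 (h1.trans_le (min_le_right _ _))⟩⟩

omit hP in
lemma mem_vectorSpan_of_mem_link (hu : u ∈ link ω P) : u ∈ vectorSpan ℝ P := by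
  obtain ⟨δ, hδ, h⟩ := hu
  have h1 := h (δ / 2) (by linarith) (by linarith)
  have h2 := h (δ / 4) (by linarith) (by linarith)
  have h3 := vsub_mem_vectorSpan ℝ h1 h2
  have h4 : u = (4 / δ) • ((ω + (δ / 2) • u) -ᵥ (ω + (δ / 4) • u)) := by
    rw [vsub_eq_sub, add_sub_add_left_eq_sub, ← sub_smul, smul_smul]
    have : 4 / δ * (δ / 2 - δ / 4) = 1 := by field_simp; norm_num
    rw [this, one_smul]
  rw [h4]
  exact Submodule.smul_mem _ _ h3

lemma link_of_relint [FiniteDimensional ℝ V] (hω : ω ∈ intrinsicInterior ℝ P) :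
    link ω P = vectorSpan ℝ P := by
  refine Set.Subset.antisymm (fun u => mem_vectorSpan_of_mem_link) ?_
  obtain ⟨s, -, rfl⟩ := hP
  rw [mem_relint_polyhedron] at hω
  intro u hu
  rw [mem_link_polyhedron hω.1]
  intro p hp he
  have : vectorSpan ℝ {x : V | ∀ p ∈ s, p.1 x ≤ p.2} ≤ LinearMap.ker p.1 := by
    refine Submodule.span_le.2 ?_
    rintro _ ⟨x, hx, y, hy, rfl⟩
    simp [hω.2 p hp he x hx, hω.2 p hp he y hy]
  exact (LinearMap.mem_ker.1 (this hu)).le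

/-- The parallel space at a relative interior point is cut out by the tight inequalities. -/
lemma exists_functionals_vectorSpan [FiniteDimensional ℝ V] (hne : P.Nonempty) :
    ∃ s : Finset (V →ₗ[ℝ] ℝ), (∀ p ∈ s, IsIntegral Λ p) ∧
      ∀ u, u ∈ vectorSpan ℝ P ↔ ∀ p ∈ s, p u = 0 := by
  classical
  obtain ⟨ω, hω⟩ := relint_nonempty hP hne
  have hlink := link_of_relint hP hω
  obtain ⟨s, hs, rfl⟩ := hP
  rw [mem_relint_polyhedron] at hω
  refine ⟨(s.filter fun p => p.1 ω = p.2).image Prod.fst, ?_, fun u => ?_⟩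
  · intro p hp
    obtain ⟨q, hq, rfl⟩ := Finset.mem_image.1 hp
    exact hs q (Finset.mem_filter.1 hq).1
  · simp only [Finset.forall_mem_image, Finset.mem_filter]
    constructor
    · intro hu p hp
      have h1 : u ∈ link ω {x : V | ∀ p ∈ s, p.1 x ≤ p.2} := hlink ▸ hu
      have h2 : -u ∈ link ω {x : V | ∀ p ∈ s, p.1 x ≤ p.2} := by
        rw [hlink]; exact Submodule.neg_mem _ hu
      rw [mem_link_polyhedron hω.1] at h1 h2
      have h3 := h1 p hp.1 hp.2
      have h4 := h2 p hp.1 hp.2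
      rw [map_neg] at h4
      linarith
    · intro h
      have : u ∈ link ω {x : V | ∀ p ∈ s, p.1 x ≤ p.2} := by
        rw [mem_link_polyhedron hω.1]
        exact fun p hp he => (h ⟨hp, he⟩).le
      exact mem_vectorSpan_of_mem_link this

/-- Near a point `u` of the link at `ω`, the link agrees with the link at `ω + δ u`. -/
lemma exists_pos_link_eventually_eq [FiniteDimensional ℝ V] (hu : u ∈ link ω P) :
    ∃ δ : ℝ, 0 < δ ∧ ∀ ε : ℝ, 0 < ε → ε < δ → ∀ᶠ u' in nhds u,
      (u' ∈ link ω P ↔ u' - u ∈ link (ω + ε • u) P) := by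
  have hωP := mem_of_mem_link hP hu
  obtain ⟨s, -, rfl⟩ := hP
  have hω : ∀ p ∈ s, p.1 ω ≤ p.2 := hωP
  obtain ⟨δ, hδ, h⟩ := hu
  refine ⟨δ, hδ, fun ε h0 h1 => ?_⟩
  have hωε := h ε h0 h1
  -- The segment continues beyond `ω + ε • u`, to parameter `(ε + δ) / 2`, so a functional tight at
  -- parameter `ε` cannot increase along `u`; nor can it decrease, since it respects its bound at
  -- `ω`.
  have htight : ∀ p ∈ s, p.1 (ω + ε • u) = p.2 ↔ p.1 ω = p.2 ∧ p.1 u = 0 := by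
    intro p hp
    have h2 := h ((ε + δ) / 2) (by linarith) (by linarith) p hp
    have h3 := hω p hp
    simp only [map_add, map_smul, smul_eq_mul] at h2 ⊢
    constructor
    · intro he
      have : p.1 u = 0 := by
        have h4 : (δ - ε) / 2 * p.1 u ≤ 0 := by nlinarith
        have h5 : p.1 u ≤ 0 := by
          by_contra hc
          have := mul_pos (show 0 < (δ - ε) / 2 by linarith) (not_le.1 hc)
          linarith
        have h6 : 0 ≤ ε * p.1 u := by linarith
        have h7 : 0 ≤ p.1 u := by
          by_contra hc
          have := mul_neg_of_pos_of_neg h0 (not_le.1 hc)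
          linarith
        linarith
      rw [this] at he
      exact ⟨by linarith, this⟩
    · rintro ⟨ha, hb⟩
      rw [ha, hb, mul_zero, add_zero]
  have hev : ∀ᶠ u' in nhds u, ∀ p ∈ s, p.1 u < 0 → p.1 u' < 0 := by
    rw [Filter.eventually_all_finset]
    intro p _
    by_cases hlt : p.1 u < 0
    · simp only [hlt, true_imp_iff]
      exact (LinearMap.continuous_of_finiteDimensional p.1).continuousAt.eventually_lt
        continuousAt_const hlt
    · simp [hlt]
  filter_upwards [hev] with u' hu'
  rw [mem_link_polyhedron hω, mem_link_polyhedron hωε]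
  have hul : ∀ p ∈ s, p.1 ω = p.2 → p.1 u ≤ 0 := by
    intro p hp he
    have h2 := hωε p hp
    simp only [map_add, map_smul, smul_eq_mul, he] at h2
    by_contra hc
    have := mul_pos h0 (not_le.1 hc)
    linarith
  constructor
  · intro hl p hp he
    obtain ⟨h2, h3⟩ := (htight p hp).1 he
    rw [map_sub, h3, sub_zero]
    exact hl p hp h2
  · intro hl p hp he
    rcases (hul p hp he).lt_or_eq with hlt | h3
    · exact (hu' p hp hlt).le
    · have := hl p hp ((htight p hp).2 ⟨he, h3⟩)
      rwa [map_sub, h3, sub_zero] at this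

/-- The segment from `ω'` to `ω` can be prolonged beyond `ω` inside `γ`. So an inequality of `P`
tight at `ω` is tight at `ω'` too, and passing to `ω` only drops constraints. -/
lemma link_subset_of_relint [FiniteDimensional ℝ V] {γ : Set V} {ω' : V}
    (hγ : IsRationalPolyhedron Λ γ) (h : γ ⊆ P) (hω : ω ∈ intrinsicInterior ℝ γ)
    (hω' : ω' ∈ γ) : link ω' P ⊆ link ω P := by
  obtain ⟨s, -, rfl⟩ := hP
  have hωγ := intrinsicInterior_subset hω
  intro u hu
  rw [mem_link_polyhedron (h hω')] at hu
  rw [mem_link_polyhedron (h hωγ)]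
  intro p hp he
  refine hu p hp ?_
  have h1 : ω - ω' ∈ link ω γ := by
    rw [link_of_relint hγ hω]
    exact vsub_mem_vectorSpan ℝ hωγ hω'
  obtain ⟨δ, hδ, h2⟩ := h1
  have h3 := h (h2 (δ / 2) (by linarith) (by linarith)) p hp
  have h4 := h hω' p hp
  simp only [map_add, map_smul, map_sub, smul_eq_mul] at h3
  nlinarith

lemma link_eq_of_relint [FiniteDimensional ℝ V] {γ : Set V} {ω' : V}
    (hγ : IsRationalPolyhedron Λ γ) (h : γ ⊆ P) (hω : ω ∈ intrinsicInterior ℝ γ)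
    (hω' : ω' ∈ intrinsicInterior ℝ γ) : link ω P = link ω' P :=
  Set.Subset.antisymm (link_subset_of_relint hP hγ h hω' (intrinsicInterior_subset hω))
    (link_subset_of_relint hP hγ h hω (intrinsicInterior_subset hω'))

lemma linkAlong_eq [FiniteDimensional ℝ V] {γ : Set V} (hγ : IsRationalPolyhedron Λ γ)
    (h : γ ⊆ P) (hω : ω ∈ intrinsicInterior ℝ γ) : linkAlong γ P = link ω P := by
  ext u
  constructor
  · rintro ⟨ω', hω', hu⟩
    rwa [link_eq_of_relint hP hγ h hω hω']
  · exact fun hu => ⟨ω, hω, hu⟩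

end Link

/-! ### Faces: extremeness, dimension, supporting hyperplanes -/

section Face

lemma IsFace.subset (h : IsFace F P) : F ⊆ P := by
  obtain ⟨-, l, rfl⟩ := h
  exact fun x hx => hx.1

/-- Faces are extreme. -/
lemma IsFace.mem_of_add_smul_mem (h : IsFace F P) {x v : V} {s t : ℝ} (hs : 0 < s) (ht : 0 < t)
    (hx : x ∈ F) (h1 : x + s • v ∈ P) (h2 : x - t • v ∈ P) : x + s • v ∈ F := by
  obtain ⟨-, l, rfl⟩ := h
  refine ⟨h1, fun y hy => ?_⟩
  have h3 := hx.2 _ h2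
  have h4 := hx.2 _ hy
  simp only [map_add, map_sub, map_smul, smul_eq_mul] at h3 ⊢
  have : 0 ≤ l v := by
    by_contra hc
    have := mul_neg_of_pos_of_neg ht (not_le.1 hc)
    linarith
  have := mul_nonneg hs.le this
  linarith

lemma exists_face_relint [FiniteDimensional ℝ V] (hP : IsRationalPolyhedron Λ P) (hω : ω ∈ P) :
    ∃ F, IsFace F P ∧ ω ∈ intrinsicInterior ℝ F := by
  classical
  obtain ⟨s, -, rfl⟩ := hP
  refine ⟨_, isFace_tight s hω, ?_⟩
  have : {y : V | (∀ p ∈ s, p.1 y ≤ p.2) ∧ ∀ p ∈ s, p.1 ω = p.2 → p.1 y = p.2} =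
      {y | ∀ p ∈ s ∪ ((s.filter fun p => p.1 ω = p.2).image fun p => (-p.1, -p.2)),
        p.1 y ≤ p.2} := by
    ext y
    simp only [Set.mem_ofPred_eq, Finset.mem_union, or_imp, forall_and, Finset.forall_mem_image,
      Finset.mem_filter, LinearMap.neg_apply, neg_le_neg_iff]
    refine and_congr_right fun hy => ⟨fun h p hp => (h p hp.1 hp.2).ge, fun h p hp he =>
      le_antisymm (hy p hp) (h ⟨hp, he⟩)⟩
  rw [this, mem_relint_polyhedron]
  refine ⟨fun p hp => ?_, fun p hp he y hy => ?_⟩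
  · have h2 : ω ∈ {y : V | (∀ p ∈ s, p.1 y ≤ p.2) ∧ ∀ p ∈ s, p.1 ω = p.2 → p.1 y = p.2} :=
      ⟨hω, fun p _ h => h⟩
    rw [this] at h2
    exact h2 p hp
  · have hy' : y ∈ {y : V | (∀ p ∈ s, p.1 y ≤ p.2) ∧ ∀ p ∈ s, p.1 ω = p.2 → p.1 y = p.2} := by
      rw [this]; exact hy
    rcases Finset.mem_union.1 hp with hp | hp
    · exact hy'.2 p hp he
    · obtain ⟨q, hq, rfl⟩ := Finset.mem_image.1 hp
      rw [Finset.mem_filter] at hq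
      simp [hy'.2 q hq.1 hq.2]

/-- Every segment of `P` ending at a relative interior point can be prolonged past it within `P`, so
extremeness puts all of `P` into the face. -/
lemma IsFace.eq_of_relint [FiniteDimensional ℝ V] (hP : IsRationalPolyhedron Λ P)
    (h : IsFace F P) (hω : ω ∈ intrinsicInterior ℝ P) (hωF : ω ∈ F) : F = P := by
  refine Set.Subset.antisymm h.subset fun y hy => ?_
  have h1 : ω - y ∈ link ω P := by
    rw [link_of_relint hP hω]
    exact vsub_mem_vectorSpan ℝ (intrinsicInterior_subset hω) hy
  obtain ⟨δ, hδ, h2⟩ := h1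
  have h3 := h2 (δ / 2) (by linarith) (by linarith)
  have h4 : ω + (1 : ℝ) • (y - ω) ∈ F := by
    refine h.mem_of_add_smul_mem (s := 1) (t := δ / 2) one_pos (by linarith) hωF (by simpa) ?_
    rwa [sub_eq_add_neg, ← smul_neg, neg_sub]
  simpa using h4

lemma IsFace.vectorSpan_lt (h : IsFace F P) (hne : F ≠ P) :
    vectorSpan ℝ F < vectorSpan ℝ P := by
  refine lt_of_le_of_ne (vectorSpan_mono ℝ h.subset) fun heq => hne ?_
  obtain ⟨⟨x, hx⟩, l, rfl⟩ := h
  refine Set.Subset.antisymm (fun x hx => hx.1) fun y hy => ?_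
  have hker : vectorSpan ℝ {x | x ∈ P ∧ ∀ y ∈ P, l y ≤ l x} ≤ LinearMap.ker l := by
    refine Submodule.span_le.2 ?_
    rintro _ ⟨a, ha, b, hb, rfl⟩
    simp only [vsub_eq_sub, SetLike.mem_coe, LinearMap.mem_ker, map_sub]
    linarith [ha.2 b hb.1, hb.2 a ha.1]
  have hmem : y - x ∈ vectorSpan ℝ P := vsub_mem_vectorSpan ℝ hy hx.1
  rw [← heq] at hmem
  have h0 : l y = l x := sub_eq_zero.1 ((map_sub l y x).symm.trans (LinearMap.mem_ker.1 (hker hmem)))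
  exact ⟨hy, fun z hz => (hx.2 z hz).trans h0.ge⟩

lemma IsFace.dim_lt [FiniteDimensional ℝ V] (h : IsFace F P) (hne : F ≠ P) : dim F < dim P := by
  unfold dim
  exact_mod_cast Submodule.finrank_lt_finrank_of_lt (h.vectorSpan_lt hne)

/-- A proper face lies on an integral supporting hyperplane. -/
lemma IsFace.exists_supporting [FiniteDimensional ℝ V] (hP : IsRationalPolyhedron Λ P)
    (h : IsFace F P) (hne : F ≠ P) : ∃ p : V →ₗ[ℝ] ℝ, IsIntegral Λ p ∧
      (∀ u ∈ vectorSpan ℝ F, p u = 0) ∧ (∀ ω ∈ F, ∀ y ∈ P, p (y - ω) ≤ 0) ∧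
      ∃ y ∈ P, ∀ ω ∈ F, p (y - ω) < 0 := by
  classical
  have hP' := hP
  obtain ⟨s, hs, rfl⟩ := hP
  obtain ⟨ω, hω, hF⟩ := exists_tight_of_isFace s h
  have hωP : ∀ p ∈ s, p.1 ω ≤ p.2 := h.subset hω
  have hnot : ω ∉ intrinsicInterior ℝ {x : V | ∀ p ∈ s, p.1 x ≤ p.2} :=
    fun hri => hne (h.eq_of_relint hP' hri hω)
  rw [mem_relint_polyhedron] at hnot
  push Not at hnot
  obtain ⟨p, hp, he, y, hy, hyne⟩ := hnot hωP
  have hpF : ∀ x ∈ F, p.1 x = p.2 := fun x hx => by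
    rw [hF] at hx
    exact hx.2 p hp he
  refine ⟨p.1, hs p hp, ?_, fun x hx z hz => ?_, y, hy, fun x hx => ?_⟩
  · intro u hu
    have : vectorSpan ℝ F ≤ LinearMap.ker p.1 := by
      refine Submodule.span_le.2 ?_
      rintro _ ⟨a, ha, b, hb, rfl⟩
      simp [hpF a ha, hpF b hb]
    exact this hu
  · rw [map_sub, hpF x hx]
    linarith [hz p hp]
  · rw [map_sub, hpF x hx]
    have := lt_of_le_of_ne (hy p hp) hyne
    linarith

end Face

/-! ### The cell of a complex carrying a point or a germ of a ray -/

section Complex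

variable (C : PolyComplex Λ) {κ σ : Set V}

lemma PolyComplex.isFace_of_subset (hκ : κ ∈ C.cells) (hσ : σ ∈ C.cells) (h : κ ⊆ σ) :
    IsFace κ σ := by
  have := C.inter_face σ hσ κ hκ (by rw [Set.inter_eq_right.2 h]; exact C.nonempty κ hκ)
  rwa [Set.inter_eq_right.2 h] at this

variable [FiniteDimensional ℝ V]

lemma PolyComplex.subset_of_relint (hκ : κ ∈ C.cells) (hσ : σ ∈ C.cells)
    (hω : ω ∈ intrinsicInterior ℝ κ) (h : ω ∈ σ) : κ ⊆ σ := by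
  have hωκ := intrinsicInterior_subset hω
  have := (C.inter_face κ hκ σ hσ ⟨ω, hωκ, h⟩).eq_of_relint (C.polyhedral κ hκ) hω ⟨hωκ, h⟩
  exact Set.inter_eq_left.1 this

lemma PolyComplex.exists_relint (hσ : σ ∈ C.cells) (h : ω ∈ σ) :
    ∃ κ ∈ C.cells, κ ⊆ σ ∧ ω ∈ intrinsicInterior ℝ κ := by
  obtain ⟨F, hF, hω⟩ := exists_face_relint (C.polyhedral σ hσ) h
  exact ⟨F, C.face_mem σ hσ F hF, hF.subset, hω⟩

lemma PolyComplex.eq_of_dim_le (hκ : κ ∈ C.cells) (hσ : σ ∈ C.cells) (h : κ ⊆ σ)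
    (hd : dim σ ≤ dim κ) : κ = σ := by
  by_contra hne
  exact absurd ((C.isFace_of_subset hκ hσ h).dim_lt hne) (not_lt.2 hd)

/-- The germ of the ray from `ω` in a direction of the link lies in the relative interior of a
cell. -/
lemma PolyComplex.exists_carrier (hσ : σ ∈ C.cells) (hu : u ∈ link ω σ) :
    ∃ κ ∈ C.cells, κ ⊆ σ ∧ ω ∈ κ ∧ u ∈ link ω κ ∧
      ∃ δ : ℝ, 0 < δ ∧ ∀ ε : ℝ, 0 < ε → ε < δ → ω + ε • u ∈ intrinsicInterior ℝ κ := by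
  obtain ⟨δ, hδ, h⟩ := hu
  -- By extremeness a face containing one point of the open segment contains all of it; the points
  -- at `a / 2` and `(δ + a) / 2` serve as the far ends needed on either side of `a`.
  have key : ∀ κ, IsFace κ σ → ∀ a, 0 < a → a < δ → ω + a • u ∈ κ →
      ∀ ε, 0 < ε → ε < δ → ω + ε • u ∈ κ := by
    intro κ hκ a ha0 ha1 ha ε h0 h1
    rcases lt_trichotomy a ε with hlt | rfl | hlt
    · have := hκ.mem_of_add_smul_mem (v := u) (s := ε - a) (t := a / 2) (by linarith) (by linarith)
        ha (by rw [add_assoc, ← add_smul, add_sub_cancel]; exact h ε h0 h1)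
        (by rw [add_sub_assoc, ← sub_smul]; exact h _ (by linarith) (by linarith))
      rwa [add_assoc, ← add_smul, add_sub_cancel] at this
    · exact ha
    · have := hκ.mem_of_add_smul_mem (v := -u) (s := a - ε) (t := (δ - a) / 2) (by linarith)
        (by linarith) ha
        (by rw [smul_neg, add_assoc, ← sub_eq_add_neg, ← sub_smul, sub_sub_cancel]
            exact h ε h0 h1)
        (by rw [smul_neg, sub_neg_eq_add, add_assoc, ← add_smul]
            exact h _ (by linarith) (by linarith))
      rwa [smul_neg, add_assoc, ← sub_eq_add_neg, ← sub_smul, sub_sub_cancel] at this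
  obtain ⟨κ, hκ, hκσ, hri⟩ := C.exists_relint hσ (h (δ / 2) (by linarith) (by linarith))
  have hall := key κ (C.isFace_of_subset hκ hσ hκσ) (δ / 2) (by linarith) (by linarith)
    (intrinsicInterior_subset hri)
  have hlink : u ∈ link ω κ := ⟨δ, hδ, hall⟩
  refine ⟨κ, hκ, hκσ, mem_of_mem_link (C.polyhedral κ hκ) hlink, hlink, δ, hδ,
    fun ε h0 h1 => ?_⟩
  obtain ⟨κ', hκ', hsub, hri'⟩ := C.exists_relint hκ (hall ε h0 h1)
  have hmem := key κ' (C.isFace_of_subset hκ' hσ (hsub.trans hκσ)) ε h0 h1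
    (intrinsicInterior_subset hri') (δ / 2) (by linarith) (by linarith)
  have : κ = κ' := Set.Subset.antisymm (C.subset_of_relint hκ hκ' hri hmem) hsub
  rwa [this]

end Complex

end Polyhedron

/-! ### Lattice points of rational subspaces -/

section Lattice

variable {V : Type*} [NormedAddCommGroup V] [NormedSpace ℝ V]

/-- `Λ` spans the space and the integral functionals separate points. -/
class IsLattice (Λ : AddSubgroup V) : Prop where
  span_eq_top : Submodule.span ℝ (Λ : Set V) = ⊤
  eq_zero_of_forall : ∀ u : V, (∀ l : V →ₗ[ℝ] ℝ, IsIntegral Λ l → l u = 0) → u = 0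

variable {Λ : AddSubgroup V}

/-- For a lattice vector `u₀` of `E` with `p u₀ ≠ 0`, the map `x ↦ p(u₀) x - p(x) u₀` takes lattice
vectors of `E` to lattice vectors of `E ∩ ker p`, because `p` is integral, and it is multiplication
by `p u₀` on `E ∩ ker p`. -/
lemma span_inf_ker {E : Submodule ℝ V}
    (hE : Submodule.span ℝ ((Λ ⊓ E.toAddSubgroup : AddSubgroup V) : Set V) = E)
    {p : V →ₗ[ℝ] ℝ} (hp : IsIntegral Λ p) :
    Submodule.span ℝ ((Λ ⊓ (E ⊓ LinearMap.ker p).toAddSubgroup : AddSubgroup V) : Set V) =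
      E ⊓ LinearMap.ker p := by
  refine le_antisymm (Submodule.span_le.2 fun u hu => hu.2) ?_
  by_cases h0 : ∀ u ∈ Λ ⊓ E.toAddSubgroup, p u = 0
  · rintro x ⟨hx, -⟩
    rw [← hE] at hx
    refine Submodule.span_mono ?_ hx
    exact fun u hu => ⟨hu.1, hu.2, h0 u hu⟩
  push Not at h0
  obtain ⟨u₀, hu₀, hne⟩ := h0
  obtain ⟨k₀, hk₀⟩ := hp u₀ hu₀.1
  have key : ∀ x ∈ E, p u₀ • x - p x • u₀ ∈
      Submodule.span ℝ ((Λ ⊓ (E ⊓ LinearMap.ker p).toAddSubgroup : AddSubgroup V) : Set V) := by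
    intro x hx
    rw [← hE] at hx
    induction hx using Submodule.span_induction with
    | mem u hu =>
      obtain ⟨k, hk⟩ := hp u hu.1
      refine Submodule.subset_span ⟨show _ ∈ Λ from ?_, show _ ∈ E from ?_, ?_⟩
      · rw [hk, hk₀, Int.cast_smul_eq_zsmul, Int.cast_smul_eq_zsmul]
        exact Λ.sub_mem (Λ.zsmul_mem hu.1 _) (Λ.zsmul_mem hu₀.1 _)
      · exact Submodule.sub_mem _ (Submodule.smul_mem _ _ hu.2) (Submodule.smul_mem _ _ hu₀.2)
      · simp [mul_comm]
    | zero => simp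
    | add x y _ _ hx hy =>
      have : p u₀ • (x + y) - p (x + y) • u₀ = (p u₀ • x - p x • u₀) + (p u₀ • y - p y • u₀) := by
        rw [map_add, smul_add, add_smul]; abel
      rw [this]
      exact add_mem hx hy
    | smul c x _ hx =>
      have : p u₀ • (c • x) - p (c • x) • u₀ = c • (p u₀ • x - p x • u₀) := by
        rw [map_smul, smul_sub, smul_comm, smul_assoc]
      rw [this]
      exact Submodule.smul_mem _ _ hx
  rintro x ⟨hx, hpx⟩
  have h1 := key x hx
  rw [LinearMap.mem_ker.1 hpx, zero_smul, sub_zero] at h1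
  have h2 := Submodule.smul_mem _ (p u₀)⁻¹ h1
  rwa [smul_smul, inv_mul_cancel₀ hne, one_smul] at h2

/-- A subspace cut out by integral functionals is spanned by its lattice vectors. -/
lemma span_inf_of_functionals (hΛ : Submodule.span ℝ (Λ : Set V) = ⊤)
    (s : Finset (V →ₗ[ℝ] ℝ)) (hs : ∀ p ∈ s, IsIntegral Λ p) (E : Submodule ℝ V)
    (hE : ∀ u, u ∈ E ↔ ∀ p ∈ s, p u = 0) :
    Submodule.span ℝ ((Λ ⊓ E.toAddSubgroup : AddSubgroup V) : Set V) = E := by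
  classical
  induction s using Finset.induction_on generalizing E with
  | empty =>
    have : E = ⊤ := by ext; simp [hE]
    subst this
    simpa using hΛ
  | insert p s hps ih =>
    have h1 := ih (fun q hq => hs q (Finset.mem_insert_of_mem hq)) (⨅ q ∈ s, LinearMap.ker q)
      (fun u => by simp)
    have h2 := span_inf_ker h1 (hs p (Finset.mem_insert_self _ _))
    have : E = (⨅ q ∈ s, LinearMap.ker q) ⊓ LinearMap.ker p := by
      ext u
      simp [hE, and_comm]
    rw [this]
    exact h2

lemma span_latticeOf [FiniteDimensional ℝ V] [IsLattice Λ] {P : Set V}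
    (hP : IsRationalPolyhedron Λ P) (hne : P.Nonempty) :
    Submodule.span ℝ (latticeOf Λ P : Set V) = vectorSpan ℝ P := by
  obtain ⟨s, hs, h⟩ := exists_functionals_vectorSpan hP hne
  exact span_inf_of_functionals IsLattice.span_eq_top s hs _ h

lemma latticeOf_mono {P Q : Set V} (h : P ⊆ Q) : latticeOf Λ P ≤ latticeOf Λ Q :=
  inf_le_inf_left _ fun _ hx => vectorSpan_mono ℝ h hx

lemma latticeOf_le {P : Set V} : latticeOf Λ P ≤ Λ := inf_le_left

/-- The values of `p` on `N` form a subgroup of `ℤ`, hence a cyclic one. The generator is chosen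
negative because a cell lies on the side `p ≤ 0` of its supporting hyperplanes. -/
lemma IsIntegral.exists_generator {p : V →ₗ[ℝ] ℝ} (hp : IsIntegral Λ p) (N : AddSubgroup V)
    (hN : N ≤ Λ) (hne : ∃ u ∈ N, p u ≠ 0) :
    ∃ v ∈ N, p v < 0 ∧ ∀ u ∈ N, ∃ k : ℤ, p u = k * p v := by
  let H : AddSubgroup ℤ :=
    { carrier := {z | ∃ u ∈ N, p u = z}
      zero_mem' := ⟨0, zero_mem _, by simp⟩
      add_mem' := by
        rintro a b ⟨u, hu, hu'⟩ ⟨w, hw, hw'⟩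
        exact ⟨u + w, add_mem hu hw, by rw [map_add, hu', hw']; push_cast; rfl⟩
      neg_mem' := by
        rintro a ⟨u, hu, hu'⟩
        exact ⟨-u, neg_mem hu, by rw [map_neg, hu']; push_cast; rfl⟩ }
  obtain ⟨g, hg⟩ := Int.subgroup_cyclic H
  have hgH : g ∈ H := by rw [hg]; exact AddSubgroup.subset_closure rfl
  have hdiv : ∀ u ∈ N, ∃ k : ℤ, p u = k * g := by
    intro u hu
    obtain ⟨z, hz⟩ := hp u (hN hu)
    have : z ∈ H := ⟨u, hu, hz⟩
    rw [hg, AddSubgroup.mem_closure_singleton] at this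
    obtain ⟨k, hk⟩ := this
    refine ⟨k, ?_⟩
    rw [hz, ← hk]
    push_cast [smul_eq_mul]
    rfl
  obtain ⟨u₀, hu₀, hu₀'⟩ := hne
  obtain ⟨w, hw, hwg⟩ := hgH
  have hg0 : (g : ℝ) ≠ 0 := by
    intro h0
    obtain ⟨k, hk⟩ := hdiv u₀ hu₀
    rw [h0, mul_zero] at hk
    exact hu₀' hk
  rcases lt_or_gt_of_ne hg0 with h | h
  · exact ⟨w, hw, by rwa [hwg], fun u hu => by rw [hwg]; exact hdiv u hu⟩
  · refine ⟨-w, neg_mem hw, by rw [map_neg, hwg]; linarith, fun u hu => ?_⟩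
    obtain ⟨k, hk⟩ := hdiv u hu
    exact ⟨-k, by rw [map_neg, hwg, hk]; push_cast; ring⟩

end Lattice

/-! ### Primitive normal vectors of a cell along a facet -/

section Normal

variable {V : Type*} [NormedAddCommGroup V] [NormedSpace ℝ V] {Λ : AddSubgroup V} {σ τ : Set V} {ω : V}

lemma IsNormalVector.mem {v : V} (hv : IsNormalVector Λ τ σ v) : v ∈ latticeOf Λ σ := by
  rw [← hv.2]
  exact (le_sup_right : AddSubgroup.zmultiples v ≤ _) (AddSubgroup.mem_zmultiples v)

lemma IsNormalVector.exists_eq {v : V} (hv : IsNormalVector Λ τ σ v) {u : V}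
    (hu : u ∈ latticeOf Λ σ) : ∃ k : ℤ, u - k • v ∈ latticeOf Λ τ := by
  rw [← hv.2, AddSubgroup.mem_sup] at hu
  obtain ⟨t, ht, _, ⟨k, rfl⟩, rfl⟩ := hu
  exact ⟨k, by simpa using ht⟩

variable [FiniteDimensional ℝ V]

lemma vectorSpan_eq_inf_ker (hd : dim σ = dim τ + 1) (hsub : τ ⊆ σ) {p : V →ₗ[ℝ] ℝ}
    (hp : ∀ u ∈ vectorSpan ℝ τ, p u = 0) (hne : ∃ u ∈ vectorSpan ℝ σ, p u ≠ 0) :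
    vectorSpan ℝ τ = vectorSpan ℝ σ ⊓ LinearMap.ker p := by
  refine Submodule.eq_of_le_of_finrank_le
    (le_inf (vectorSpan_mono ℝ hsub) fun u hu => hp u hu) ?_
  have hlt : vectorSpan ℝ σ ⊓ LinearMap.ker p < vectorSpan ℝ σ := by
    refine lt_of_le_of_ne inf_le_left fun h => ?_
    obtain ⟨u, hu, hu'⟩ := hne
    rw [← h] at hu
    exact hu' hu.2
  have h1 := Submodule.finrank_lt_finrank_of_lt hlt
  unfold dim at hd
  omega

/-- Structure of a polyhedron along a facet: there is an integral functional describing it. -/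
lemma exists_functional_of_isFace (hσ : IsRationalPolyhedron Λ σ)
    (hτ : IsRationalPolyhedron Λ τ)
    (h : IsFace τ σ) (hd : dim σ = dim τ + 1) : ∃ p : V →ₗ[ℝ] ℝ, IsIntegral Λ p ∧
      vectorSpan ℝ τ = vectorSpan ℝ σ ⊓ LinearMap.ker p ∧ (∃ u ∈ vectorSpan ℝ σ, p u ≠ 0) ∧
      ∀ ω ∈ intrinsicInterior ℝ τ, ∀ u, u ∈ link ω σ ↔ u ∈ vectorSpan ℝ σ ∧ p u ≤ 0 := by
  have hne : τ ≠ σ := by rintro rfl; omega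
  obtain ⟨p, hp, hp0, hple, y, hy, hplt⟩ := h.exists_supporting hσ hne
  obtain ⟨x, hx⟩ := h.1
  have hex : ∃ u ∈ vectorSpan ℝ σ, p u ≠ 0 :=
    ⟨y - x, vsub_mem_vectorSpan ℝ hy (h.subset hx), (hplt x hx).ne⟩
  have heq := vectorSpan_eq_inf_ker hd h.subset hp0 hex
  refine ⟨p, hp, heq, hex, fun ω hω u => ⟨fun hu => ⟨mem_vectorSpan_of_mem_link hu, ?_⟩, ?_⟩⟩
  · obtain ⟨δ, hδ, hu⟩ := hu
    have h1 := hple ω (intrinsicInterior_subset hω) _ (hu (δ / 2) (by linarith) (by linarith))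
    rw [add_sub_cancel_left, map_smul, smul_eq_mul] at h1
    nlinarith
  · rintro ⟨hu, hpu⟩
    have hωτ := intrinsicInterior_subset hω
    have hωσ := h.subset hωτ
    have hlt := hplt ω hωτ
    set s := p u / p (y - ω) with hs
    have hs0 : 0 ≤ s := div_nonneg_of_nonpos hpu hlt.le
    have ht : u - s • (y - ω) ∈ link ω τ := by
      rw [link_of_relint hτ hω, heq]
      refine ⟨sub_mem hu (Submodule.smul_mem _ _ (vsub_mem_vectorSpan ℝ hy hωσ)), ?_⟩
      rw [SetLike.mem_coe, LinearMap.mem_ker, map_sub, map_smul, smul_eq_mul, hs, div_mul_cancel₀ _ hlt.ne, sub_self]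
    have h2 := link_add hσ hωσ (link_mono h.subset ht)
      (link_smul hσ hωσ hs0 (sub_mem_link hσ hωσ hy))
    simpa using h2

variable [IsLattice Λ] (hσ : IsRationalPolyhedron Λ σ) (hτ : IsRationalPolyhedron Λ τ)
  (h : IsFace τ σ) (hd : dim σ = dim τ + 1)
include hσ hτ h hd

/-- A lattice vector of `N_σ` whose value under the functional of the facet generates all values
will do: subtracting a multiple of it brings any vector of `N_σ` into the kernel, that is, into
`N_τ`. -/
lemma exists_isNormalVector : ∃ v, IsNormalVector Λ τ σ v := by
  obtain ⟨p, hp, heq, hex, hlink⟩ := exists_functional_of_isFace hσ hτ h hd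
  have hspan := span_latticeOf hσ (h.1.mono h.subset)
  have hex' : ∃ u ∈ latticeOf Λ σ, p u ≠ 0 := by
    by_contra hcon
    push Not at hcon
    obtain ⟨u, hu, hne⟩ := hex
    rw [← hspan] at hu
    exact hne ((Submodule.span_le (p := LinearMap.ker p)).2 hcon hu)
  obtain ⟨v, hv, hlt, hgen⟩ := hp.exists_generator _ latticeOf_le hex'
  obtain ⟨ω, hω⟩ := relint_nonempty hτ h.1
  refine ⟨v, ⟨ω, hω, (hlink ω hω v).2 ⟨hv.2, hlt.le⟩⟩, le_antisymm ?_ ?_⟩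
  · refine sup_le (latticeOf_mono h.subset) ?_
    rw [AddSubgroup.zmultiples_le]
    exact hv
  · intro u hu
    obtain ⟨k, hk⟩ := hgen u hu
    have h1 : u - k • v ∈ latticeOf Λ τ := by
      have h2 : u - k • v ∈ latticeOf Λ σ := sub_mem hu (zsmul_mem hv k)
      refine ⟨h2.1, ?_⟩
      rw [heq]
      refine ⟨h2.2, ?_⟩
      rw [SetLike.mem_coe, LinearMap.mem_ker, map_sub, map_zsmul, hk, zsmul_eq_mul, sub_self]
    rw [AddSubgroup.mem_sup]
    exact ⟨_, h1, _, zsmul_mem (AddSubgroup.mem_zmultiples v) k, by abel⟩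

lemma isNormalVector_normalVector : IsNormalVector Λ τ σ (normalVector Λ τ σ) :=
  Classical.epsilon_spec (exists_isNormalVector hσ hτ h hd)

/-- A normal vector is the generator, on the correct side, modulo the facet. -/
lemma IsNormalVector.exists_functional {v : V} (hv : IsNormalVector Λ τ σ v) :
    ∃ p : V →ₗ[ℝ] ℝ, vectorSpan ℝ τ = vectorSpan ℝ σ ⊓ LinearMap.ker p ∧ p v < 0 ∧
      (∀ ω ∈ intrinsicInterior ℝ τ, ∀ u, u ∈ link ω σ ↔ u ∈ vectorSpan ℝ σ ∧ p u ≤ 0) := by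
  obtain ⟨p, hp, heq, hex, hlink⟩ := exists_functional_of_isFace hσ hτ h hd
  refine ⟨p, heq, ?_, hlink⟩
  obtain ⟨ω, hω, hvω⟩ := hv.1
  refine lt_of_le_of_ne ((hlink ω hω v).1 hvω).2 fun h0 => ?_
  obtain ⟨u, hu, hne⟩ := hex
  rw [← span_latticeOf hσ (h.1.mono h.subset)] at hu
  refine hne ((Submodule.span_le (p := LinearMap.ker p)).2 (fun w hw => ?_) hu)
  obtain ⟨k, hk⟩ := hv.exists_eq hw
  have h1 : w - k • v ∈ vectorSpan ℝ τ := hk.2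
  rw [heq] at h1
  have h2 := LinearMap.mem_ker.1 h1.2
  rw [map_sub, map_zsmul, h0, smul_zero, sub_zero] at h2
  exact h2

lemma IsNormalVector.notMem {v : V} (hv : IsNormalVector Λ τ σ v) : v ∉ vectorSpan ℝ τ := by
  obtain ⟨p, heq, hlt, -⟩ := hv.exists_functional hσ hτ h hd
  rw [heq]
  exact fun hmem => hlt.ne (LinearMap.mem_ker.1 hmem.2)

lemma IsNormalVector.exists_sub_smul_mem {v : V} (hv : IsNormalVector Λ τ σ v) {u : V}
    (hu : u ∈ vectorSpan ℝ σ) : ∃ s : ℝ, u - s • v ∈ vectorSpan ℝ τ := by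
  obtain ⟨p, heq, hlt, -⟩ := hv.exists_functional hσ hτ h hd
  refine ⟨p u / p v, ?_⟩
  rw [heq]
  refine ⟨sub_mem hu (Submodule.smul_mem _ _ hv.mem.2), ?_⟩
  rw [SetLike.mem_coe, LinearMap.mem_ker, map_sub, map_smul, smul_eq_mul,
    div_mul_cancel₀ _ hlt.ne, sub_self]

lemma IsNormalVector.mem_link_iff {v : V} (hv : IsNormalVector Λ τ σ v)
    (hω : ω ∈ intrinsicInterior ℝ τ) {u : V} :
    u ∈ link ω σ ↔ ∃ s : ℝ, 0 ≤ s ∧ u - s • v ∈ vectorSpan ℝ τ := by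
  obtain ⟨p, heq, hlt, hlink⟩ := hv.exists_functional hσ hτ h hd
  rw [hlink ω hω]
  constructor
  · rintro ⟨hu, hpu⟩
    obtain ⟨s, hs⟩ := hv.exists_sub_smul_mem hσ hτ h hd hu
    refine ⟨s, ?_, hs⟩
    rw [heq] at hs
    have h1 := LinearMap.mem_ker.1 hs.2
    rw [map_sub, map_smul, smul_eq_mul] at h1
    nlinarith
  · rintro ⟨s, hs0, hs⟩
    have h2 := vectorSpan_mono ℝ h.subset hs
    rw [heq] at hs
    have h1 := LinearMap.mem_ker.1 hs.2
    rw [map_sub, map_smul, smul_eq_mul] at h1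
    refine ⟨?_, by nlinarith⟩
    have := add_mem h2 (Submodule.smul_mem _ s hv.mem.2)
    simpa using this

/-- Modulo `N_τ` both vectors generate the same infinite cyclic group, so they agree up to sign, and
both point into `σ`. -/
lemma IsNormalVector.sub_mem {v v' : V} (hv : IsNormalVector Λ τ σ v)
    (hv' : IsNormalVector Λ τ σ v') : v - v' ∈ vectorSpan ℝ τ := by
  obtain ⟨p, heq, hlt, hlink⟩ := hv.exists_functional hσ hτ h hd
  have hz : ∀ {w}, w ∈ latticeOf Λ τ → p w = 0 := fun {w} hw => by
    have h1 : w ∈ vectorSpan ℝ τ := hw.2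
    rw [heq] at h1
    exact LinearMap.mem_ker.1 h1.2
  obtain ⟨k, hk⟩ := hv.exists_eq hv'.mem
  obtain ⟨k', hk'⟩ := hv'.exists_eq hv.mem
  have h1 := hz hk
  have h2 := hz hk'
  rw [map_sub, map_zsmul, zsmul_eq_mul] at h1 h2
  obtain ⟨ω, hω, hvω⟩ := hv'.1
  have h3 := ((hlink ω hω v').1 hvω).2
  have h4 : (k : ℝ) * k' = 1 := by
    have : (k * k' : ℝ) * p v = p v := by
      linear_combination -h2 - (k' : ℝ) * h1
    exact mul_right_cancel₀ hlt.ne (this.trans (one_mul _).symm)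
  have h5 : k * k' = 1 := by exact_mod_cast h4
  have hk0 : 0 ≤ k := by
    by_contra hc
    have : (k : ℝ) < 0 := by exact_mod_cast not_le.1 hc
    nlinarith
  have hk1 : k = 1 := by
    rcases Int.eq_one_or_neg_one_of_mul_eq_one h5 with h | h
    · exact h
    · omega
  rw [hk1, one_smul] at hk
  rw [← neg_sub]
  exact neg_mem hk.2

end Normal

/-! ### Lattice indices and integral functionals -/

section Index

/-- Insert the group `H + (K ∩ ker f)` between `H` and `K`: the upper step has the index of the
images, the lower one that of the kernels. -/
lemma relIndex_eq_map_mul_inf_ker {G G' : Type*} [AddCommGroup G] [AddCommGroup G'] (f : G →+ G')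
    {H K : AddSubgroup G} (h : H ≤ K) :
    H.relIndex K = (H.map f).relIndex (K.map f) * (H ⊓ f.ker).relIndex (K ⊓ f.ker) := by
  have h1 : H ≤ H ⊔ (K ⊓ f.ker) := le_sup_left
  have h2 : H ⊔ (K ⊓ f.ker) ≤ K := sup_le h inf_le_left
  have e1 : H.relIndex (H ⊔ (K ⊓ f.ker)) = (H ⊓ f.ker).relIndex (K ⊓ f.ker) := by
    rw [AddSubgroup.relIndex_sup_left, ← AddSubgroup.inf_relIndex_right, ← inf_assoc,
      inf_eq_left.2 h]
  have e2 : (H ⊔ (K ⊓ f.ker)).relIndex K = (H.map f).relIndex (K.map f) := by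
    rw [AddSubgroup.relIndex_map_map]
    have e3 : (H ⊔ f.ker) ⊓ K = H ⊔ (K ⊓ f.ker) := by
      rw [inf_comm K, sup_inf_assoc_of_le _ h]
    rw [← e3, AddSubgroup.inf_relIndex_right, sup_comm K, sup_comm H]
    rw [← AddSubgroup.relIndex_sup_right K (f.ker ⊔ H)]
    congr 1
    rw [sup_comm f.ker H, ← sup_assoc, sup_eq_left.2 h, sup_comm]
  rw [← AddSubgroup.relIndex_mul_relIndex _ _ _ h1 h2, e1, e2, mul_comm]

lemma relIndex_zmultiples_zsmul {G : Type*} [AddCommGroup G] [IsAddTorsionFree G] (g : G)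
    (hg : g ≠ 0) (k : ℤ) :
    (AddSubgroup.zmultiples (k • g)).relIndex (AddSubgroup.zmultiples g) = k.natAbs := by
  have h1 : AddSubgroup.zmultiples g = (⊤ : AddSubgroup ℤ).map (zmultiplesHom G g) := by
    ext x
    simp [AddSubgroup.mem_zmultiples_iff]
  have h2 : AddSubgroup.zmultiples (k • g) =
      (AddSubgroup.zmultiples k).map (zmultiplesHom G g) := by
    rw [AddMonoidHom.map_zmultiples]
    simp
  rw [h1, h2, AddSubgroup.relIndex_map_map_of_injective, AddSubgroup.relIndex_top_right,
    Int.index_zmultiples]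
  intro a b hab
  simpa [hg] using hab

/-- The index of `H₀ + ℤ a`, where `f` vanishes on `H₀` and maps `K` onto `ℤ g`. -/
lemma relIndex_sup_zmultiples {G : Type*} [AddCommGroup G] (f : G →+ ℝ) {H₀ K : AddSubgroup G}
    (hH : H₀ ≤ K) (hf : ∀ u ∈ H₀, f u = 0) {g : ℝ} (hg : g ≠ 0)
    (hK : K.map f = AddSubgroup.zmultiples g) {a : G} (ha : a ∈ K) (ha0 : f a ≠ 0) :
    ((H₀ ⊔ AddSubgroup.zmultiples a).relIndex K : ℝ) =
      |f a| * (H₀.relIndex (K ⊓ f.ker) / |g|) := by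
  have hle : H₀ ⊔ AddSubgroup.zmultiples a ≤ K := sup_le hH (by
    rw [AddSubgroup.zmultiples_le]
    exact ha)
  have hker : (H₀ ⊔ AddSubgroup.zmultiples a) ⊓ f.ker = H₀ := by
    refine le_antisymm ?_ (le_inf le_sup_left hf)
    rintro x ⟨hx, hx0⟩
    obtain ⟨t, ht, _, ⟨k, rfl⟩, rfl⟩ := AddSubgroup.mem_sup.1 hx
    have hx1 : f (t + k • a) = 0 := hx0
    rw [map_add, hf t ht, zero_add, map_zsmul, smul_eq_zero] at hx1
    rcases hx1 with rfl | h
    · simpa using ht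
    · exact absurd h ha0
  have hmap : (H₀ ⊔ AddSubgroup.zmultiples a).map f = AddSubgroup.zmultiples (f a) := by
    rw [AddSubgroup.map_sup, AddMonoidHom.map_zmultiples]
    refine sup_eq_right.2 ?_
    rintro _ ⟨u, hu, rfl⟩
    rw [hf u hu]
    exact zero_mem _
  have hfa : f a ∈ AddSubgroup.zmultiples g := hK ▸ AddSubgroup.mem_map_of_mem f ha
  obtain ⟨k, hk⟩ := hfa
  simp only at hk
  rw [relIndex_eq_map_mul_inf_ker f hle, hker, hmap, hK, ← hk, relIndex_zmultiples_zsmul g hg,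
    Nat.cast_mul, Nat.cast_natAbs, zsmul_eq_mul, abs_mul]
  field_simp
  simp [mul_comm]

/-- The standard lattice. -/
def intLattice (ι : Type*) : AddSubgroup (ι → ℝ) where
  carrier := {w | ∀ i, ∃ z : ℤ, w i = z}
  zero_mem' := fun _ => ⟨0, by simp⟩
  add_mem' := by
    intro a b ha hb i
    obtain ⟨x, hx⟩ := ha i
    obtain ⟨y, hy⟩ := hb i
    exact ⟨x + y, by simp [hx, hy]⟩
  neg_mem' := by
    intro a ha i
    obtain ⟨x, hx⟩ := ha i
    exact ⟨-x, by simp [hx]⟩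

/-- The index depends on `a` only through `|ψ a|`; the factor is `[K ∩ ker ψ : H₀]` divided by a
generator of `ψ(K)`. Hence one constant serves all facets along a common wall. If `ψ` vanishes on
`K` the claim is void and the constant is arbitrary. -/
lemma IsIntegral.exists_index_factor {V : Type*} [NormedAddCommGroup V] [NormedSpace ℝ V]
    {K H₀ : AddSubgroup V} {ψ : V →ₗ[ℝ] ℝ} (hψ : IsIntegral K ψ) (hH : H₀ ≤ K)
    (hf : ∀ u ∈ H₀, ψ u = 0) : ∃ c : ℝ, ∀ a ∈ K, ψ a ≠ 0 →
      ((H₀ ⊔ AddSubgroup.zmultiples a).relIndex K : ℝ) = |ψ a| * c := by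
  by_cases hex : ∃ u ∈ K, ψ u ≠ 0
  · obtain ⟨v, hv, hlt, hgen⟩ := hψ.exists_generator K le_rfl hex
    have hK : K.map ψ.toAddMonoidHom = AddSubgroup.zmultiples (ψ v) := by
      refine le_antisymm ?_ ?_
      · rintro _ ⟨u, hu, rfl⟩
        obtain ⟨k, hk⟩ := hgen u hu
        exact ⟨k, by simp [hk]⟩
      · rw [AddSubgroup.zmultiples_le]
        exact ⟨v, hv, rfl⟩
    exact ⟨_, fun a ha ha0 => relIndex_sup_zmultiples ψ.toAddMonoidHom hH hf hlt.ne hK ha ha0⟩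
  · push Not at hex
    exact ⟨0, fun a ha ha0 => absurd (hex a ha) ha0⟩

/-- The coordinate `none` maps the standard lattice onto `ℤ`, with kernel the standard lattice of
the other coordinates, so it splits off the index as a factor. -/
lemma relIndex_intLattice_option {ι : Type*} {H : AddSubgroup (Option ι → ℝ)}
    (hH : H ≤ intLattice (Option ι)) (hH0 : ∀ u ∈ H, u none = 0) {a : Option ι → ℝ}
    (ha : a ∈ intLattice (Option ι)) (ha0 : a none ≠ 0) :
    ((H ⊔ AddSubgroup.zmultiples a).relIndex (intLattice (Option ι)) : ℝ) =
      |a none| * (H.map (LinearMap.funLeft ℝ ℝ (some : ι → Option ι)).toAddMonoidHom).relIndex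
        (intLattice ι) := by
  classical
  let f : (Option ι → ℝ) →+ ℝ := (LinearMap.proj (R := ℝ) (φ := fun _ => ℝ) none).toAddMonoidHom
  have hK : (intLattice (Option ι)).map f = AddSubgroup.zmultiples (1 : ℝ) := by
    refine le_antisymm ?_ ?_
    · rintro _ ⟨u, hu, rfl⟩
      obtain ⟨k, hk⟩ := hu none
      exact ⟨k, by simp [f, hk]⟩
    · rw [AddSubgroup.zmultiples_le]
      exact ⟨fun _ => 1, fun _ => ⟨1, by simp⟩, rfl⟩
  rw [relIndex_sup_zmultiples f hH hH0 one_ne_zero hK ha ha0]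
  simp only [abs_one, div_one]
  congr 2
  let j : (ι → ℝ) →+ (Option ι → ℝ) :=
    { toFun := fun w o => o.elim 0 w
      map_zero' := by ext o; cases o <;> rfl
      map_add' := fun x y => by ext o; cases o <;> simp }
  have hj : Function.Injective j := fun x y hxy => funext fun i => congr_fun hxy (some i)
  have hjr : ∀ u : Option ι → ℝ, u none = 0 → j (fun i => u (some i)) = u := fun u hu => by
    ext o; cases o
    · exact hu.symm
    · rfl
  rw [← AddSubgroup.relIndex_map_map_of_injective _ (intLattice ι) hj]
  congr 1
  · ext u
    constructor
    · exact fun hu => ⟨_, ⟨u, hu, rfl⟩, hjr u (hH0 u hu)⟩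
    · rintro ⟨_, ⟨u, hu, rfl⟩, rfl⟩
      exact (hjr u (hH0 u hu)).symm ▸ hu
  · ext u
    constructor
    · rintro ⟨hu, hu0⟩
      exact ⟨_, fun i => hu (some i), hjr u hu0⟩
    · rintro ⟨w, hw, rfl⟩
      refine ⟨fun o => ?_, rfl⟩
      cases o
      · exact ⟨0, by simp [j]⟩
      · exact hw _

/-- A sublattice of full rank has finite index. -/
lemma relIndex_intLattice_ne_zero {ι : Type*} [Fintype ι] {H : AddSubgroup (ι → ℝ)}
    (hH : H ≤ intLattice ι) (hspan : Submodule.span ℝ (H : Set (ι → ℝ)) = ⊤) :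
    H.relIndex (intLattice ι) ≠ 0 := by
  classical
  have hL : intLattice ι = (Submodule.span ℤ (Set.range (Pi.basisFun ℝ ι))).toAddSubgroup := by
    ext w
    rw [Submodule.mem_toAddSubgroup, Module.Basis.mem_span_iff_repr_mem]
    simp only [Pi.basisFun_repr]
    exact forall_congr' fun i => ⟨fun ⟨z, hz⟩ => ⟨z, by simp [hz]⟩, fun ⟨z, hz⟩ => ⟨z, by
      simpa using hz.symm⟩⟩
  set L₂ := Submodule.span ℤ (Set.range (Pi.basisFun ℝ ι)) with hL₂
  let L₁ : Submodule ℤ (ι → ℝ) := AddSubgroup.toIntSubmodule H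
  have hle : L₁ ≤ L₂ := fun x hx => by
    have : x ∈ intLattice ι := hH hx
    rwa [hL] at this
  have hdis : DiscreteTopology L₂ := inferInstance
  have : DiscreteTopology L₁ :=
    DiscreteTopology.of_subset (s := (L₂ : Set (ι → ℝ))) hdis hle
  have : IsZLattice ℝ L₁ := ⟨hspan⟩
  -- The index is a quotient of covolumes, which do not vanish; an infinite index would read `0`
  -- here.
  have h := ZLattice.covolume_div_covolume_eq_relIndex L₁ L₂ hle
  intro h0
  rw [← hL] at h
  have h2 : (L₁.toAddSubgroup.relIndex (intLattice ι) : ℝ) = 0 := by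
    have : L₁.toAddSubgroup = H := rfl
    rw [this, h0, Nat.cast_zero]
  rw [h2] at h
  exact div_ne_zero (ZLattice.covolume_ne_zero L₁ _) (ZLattice.covolume_ne_zero L₂ _) h

/-- A proper subspace spanned by integral vectors lies in the kernel of an integral functional. -/
lemma exists_integral_functional {ι : Type*} [Fintype ι] {H : AddSubgroup (ι → ℝ)}
    (hH : H ≤ intLattice ι) (hne : Submodule.span ℝ (H : Set (ι → ℝ)) ≠ ⊤) :
    ∃ ψ : (ι → ℝ) →ₗ[ℝ] ℝ, IsIntegral (intLattice ι) ψ ∧ ψ ≠ 0 ∧ ∀ u ∈ H, ψ u = 0 := by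
  classical
  obtain ⟨t, htH, hspan⟩ : ∃ t : Finset (ι → ℝ), (t : Set (ι → ℝ)) ⊆ H ∧
      Submodule.span ℝ (t : Set (ι → ℝ)) = Submodule.span ℝ (H : Set (ι → ℝ)) :=
    Submodule.fg_span_iff_fg_span_finset_subset _ |>.1 (IsNoetherian.noetherian _) |>.imp
      fun t ht => ⟨ht.1, ht.2.symm⟩
  let dot : (ι → ℝ) → ((ι → ℝ) →ₗ[ℝ] ℝ) := fun h =>
    ∑ i, h i • LinearMap.proj (R := ℝ) (φ := fun _ => ℝ) i
  have hdot : ∀ h c, dot h c = ∑ i, h i * c i := fun h c => by simp [dot]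
  have hcomm : ∀ h c, dot h c = dot c h := fun h c => by simp [hdot, mul_comm]
  have hint : ∀ h ∈ intLattice ι, IsIntegral (intLattice ι) (dot h) := by
    intro h hh c hc
    choose x hx using hh
    choose y hy using hc
    exact ⟨∑ i, x i * y i, by rw [hdot]; push_cast; simp [hx, hy]⟩
  -- The orthogonal complement of `H` is cut out by integral functionals, hence spanned by integral
  -- vectors. It is nonzero because some functional vanishes on `H`, so it contains a nonzero
  -- integral vector, whose dot product is the required `ψ`.
  let E : Submodule ℝ (ι → ℝ) := ⨅ h ∈ t, LinearMap.ker (dot h)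
  have hE : ∀ c, c ∈ E ↔ ∀ p ∈ t.image dot, p c = 0 := fun c => by simp [E]
  have hΛ : Submodule.span ℝ (intLattice ι : Set (ι → ℝ)) = ⊤ := by
    rw [eq_top_iff, ← (Pi.basisFun ℝ ι).span_eq]
    refine Submodule.span_mono ?_
    rintro _ ⟨i, rfl⟩ j
    by_cases h : j = i
    · subst h; exact ⟨1, by simp⟩
    · exact ⟨0, by simp [h]⟩
  have hsp := span_inf_of_functionals hΛ (t.image dot) (by
    intro p hp
    obtain ⟨h, hh, rfl⟩ := Finset.mem_image.1 hp
    exact hint h (hH (htH hh))) E hE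
  obtain ⟨f, hf0, hf⟩ := Submodule.exists_le_ker_of_lt_top _ (lt_top_iff_ne_top.2 hne)
  obtain ⟨c, hc⟩ : ∃ c, f = dot c := ⟨fun i => f (Pi.single i 1), by
    refine (Pi.basisFun ℝ ι).ext fun i => ?_
    simp [hdot, Pi.single_apply]⟩
  have hcE : c ∈ E := by
    rw [hE]
    simp only [Finset.forall_mem_image]
    intro h hh
    rw [hcomm, ← hc]
    exact hf (Submodule.subset_span (htH hh))
  by_contra hcon
  push Not at hcon
  have hall : ∀ c' ∈ intLattice ι ⊓ E.toAddSubgroup, c' = 0 := by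
    intro c' hc'
    by_contra h0
    have hne0 : dot c' ≠ 0 := by
      intro h1
      have h2 : ∑ i, c' i * c' i = 0 := by rw [← hdot, h1]; rfl
      rw [Finset.sum_eq_zero_iff_of_nonneg fun i _ => mul_self_nonneg _] at h2
      exact h0 (funext fun i => by simpa using h2 i (Finset.mem_univ i))
    obtain ⟨u, hu, hu0⟩ := hcon (dot c') (hint c' hc'.1) hne0
    have h3 : Submodule.span ℝ (t : Set (ι → ℝ)) ≤ LinearMap.ker (dot c') := by
      refine Submodule.span_le.2 fun h hh => ?_
      rw [SetLike.mem_coe, LinearMap.mem_ker, hcomm]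
      exact (hE c').1 hc'.2 _ (Finset.mem_image_of_mem _ hh)
    rw [hspan] at h3
    exact hu0 (h3 (Submodule.subset_span hu))
  have hE0 : E = ⊥ := by
    rw [← hsp, Submodule.span_eq_bot]
    exact fun c' hc' => hall c' hc'
  rw [hE0, Submodule.mem_bot] at hcE
  refine hf0 ?_
  rw [hc, hcE]
  ext; simp [dot]

end Index

/-! ### Avoiding finitely many proper subspaces -/

section Generic

/-- A finite union of proper subspaces has dense open complement. -/
lemma isOpen_dense_compl_submodules {E : Type*} [NormedAddCommGroup E] [NormedSpace ℝ E]
    [FiniteDimensional ℝ E] (S : Set (Submodule ℝ E)) (hS : S.Finite) (hne : ∀ F ∈ S, F ≠ ⊤) :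
    IsOpen {w : E | ∀ F ∈ S, w ∉ F} ∧ Dense {w : E | ∀ F ∈ S, w ∉ F} := by
  have heq : {w : E | ∀ F ∈ S, w ∉ F} = ⋂ F ∈ S, (F : Set E)ᶜ := by ext; simp
  rw [heq]
  have ho : ∀ F : Submodule ℝ E, IsOpen ((F : Set E)ᶜ) := fun F =>
    F.closed_of_finiteDimensional.isOpen_compl
  refine ⟨hS.isOpen_biInter fun F _ => ho F,
    dense_biInter_of_isOpen (fun F _ => ho F) hS.countable fun F hF => ?_⟩
  rw [← interior_eq_empty_iff_dense_compl]
  by_contra hcon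
  exact hne F hF (F.eq_top_of_nonempty_interior' (Set.nonempty_iff_ne_empty.2 hcon))

end Generic

/-! ### Local degrees of integral maps -/

section Degree

variable {V : Type*} [NormedAddCommGroup V] [NormedSpace ℝ V]
  {Λ : AddSubgroup V} {ι : Type*}

/-- `Q` maps the lattice `Λ` to the standard lattice. -/
def IsIntegralMap (Λ : AddSubgroup V) (Q : V →ₗ[ℝ] (ι → ℝ)) : Prop :=
  ∀ u ∈ Λ, Q u ∈ intLattice ι

/-- The index of the image of `N_σ` in the standard lattice. -/
noncomputable def mapIndex (Λ : AddSubgroup V) (Q : V →ₗ[ℝ] (ι → ℝ)) (σ : Set V) : ℕ :=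
  ((latticeOf Λ σ).map Q.toAddMonoidHom).relIndex (intLattice ι)

/-- The local degree at `ω` of the map `Q` on `Z`, counted over the value `w`. -/
noncomputable def WeightedComplex.localDegree [Fintype ι] (Z : WeightedComplex Λ)
    (Q : V →ₗ[ℝ] (ι → ℝ)) (ω : V) (w : ι → ℝ) : ℚ :=
  ∑ᶠ σ ∈ {σ | σ ∈ Z.facets ∧ dim σ = Fintype.card ι ∧ w ∈ Q '' link ω σ},
    Z.weight σ * mapIndex Λ Q σ

/-- `w` is in no proper subspace spanned by the image of a cell. -/
def PolyComplex.IsGenericFor (C : PolyComplex Λ) (Q : V →ₗ[ℝ] (ι → ℝ)) (w : ι → ℝ) : Prop :=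
  ∀ κ ∈ C.cells, (vectorSpan ℝ κ).map Q ≠ ⊤ → w ∉ (vectorSpan ℝ κ).map Q

/-- `τ` is a cell whose image is a wall through `w₀` in the local picture at `ω`. -/
def PolyComplex.IsWall [Fintype ι] (C : PolyComplex Λ) (Q : V →ₗ[ℝ] (ι → ℝ)) (ω : V) (w₀ : ι → ℝ)
    (τ : Set V) : Prop :=
  τ ∈ C.cells ∧ dim τ + 1 = Fintype.card ι ∧ w₀ ∈ Q '' link ω τ

lemma PolyComplex.isOpen_dense_isGenericFor [Fintype ι] (C : PolyComplex Λ)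
    (Q : V →ₗ[ℝ] (ι → ℝ)) :
    IsOpen {w | C.IsGenericFor Q w} ∧ Dense {w | C.IsGenericFor Q w} := by
  have h := isOpen_dense_compl_submodules
    ((fun κ => (vectorSpan ℝ κ).map Q) '' C.cells ∩ {F | F ≠ ⊤})
    ((C.finite.image _).subset Set.inter_subset_left) fun F hF => hF.2
  have : {w : ι → ℝ | ∀ F ∈ (fun κ => (vectorSpan ℝ κ).map Q) '' C.cells ∩ {F | F ≠ ⊤}, w ∉ F} =
      {w | C.IsGenericFor Q w} := by
    ext w
    simp only [Set.mem_ofPred_eq, PolyComplex.IsGenericFor, Set.mem_inter_iff, and_imp,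
      Set.forall_mem_image]
  rwa [this] at h

lemma map_latticeOf_le {Q : V →ₗ[ℝ] (ι → ℝ)} (hQ : IsIntegralMap Λ Q) (σ : Set V) :
    (latticeOf Λ σ).map Q.toAddMonoidHom ≤ intLattice ι := by
  rintro _ ⟨u, hu, rfl⟩
  exact hQ u hu.1

lemma IsNormalVector.map_latticeOf {τ σ : Set V} {v : V} (hv : IsNormalVector Λ τ σ v)
    (Q : V →ₗ[ℝ] (ι → ℝ)) : (latticeOf Λ σ).map Q.toAddMonoidHom =
      (latticeOf Λ τ).map Q.toAddMonoidHom ⊔ AddSubgroup.zmultiples (Q v) := by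
  rw [← hv.2, AddSubgroup.map_sup, AddMonoidHom.map_zmultiples]
  rfl

variable [FiniteDimensional ℝ V] [Fintype ι]

omit [Fintype ι] in
lemma span_map_latticeOf [IsLattice Λ] {σ : Set V} (hσ : IsRationalPolyhedron Λ σ)
    (hne : σ.Nonempty) (Q : V →ₗ[ℝ] (ι → ℝ)) :
    Submodule.span ℝ ((latticeOf Λ σ).map Q.toAddMonoidHom : Set (ι → ℝ)) =
      (vectorSpan ℝ σ).map Q := by
  rw [← span_latticeOf hσ hne, Submodule.map_span]
  rfl

lemma mapIndex_ne_zero [IsLattice Λ] {σ : Set V} (hσ : IsRationalPolyhedron Λ σ)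
    (hne : σ.Nonempty) {Q : V →ₗ[ℝ] (ι → ℝ)} (hQ : IsIntegralMap Λ Q)
    (htop : (vectorSpan ℝ σ).map Q = ⊤) : mapIndex Λ Q σ ≠ 0 :=
  relIndex_intLattice_ne_zero (map_latticeOf_le hQ σ) (by rw [span_map_latticeOf hσ hne, htop])

/-- On a cell mapped onto the target of the same dimension, the map has a linear inverse. -/
lemma exists_section {σ : Set V} (hd : dim σ = Fintype.card ι) {Q : V →ₗ[ℝ] (ι → ℝ)}
    (htop : (vectorSpan ℝ σ).map Q = ⊤) : ∃ g : (ι → ℝ) →ₗ[ℝ] V,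
      (∀ w, g w ∈ vectorSpan ℝ σ) ∧ (∀ w, Q (g w) = w) ∧ ∀ u ∈ vectorSpan ℝ σ, g (Q u) = u := by
  have hfin : Module.finrank ℝ (vectorSpan ℝ σ) = Module.finrank ℝ (ι → ℝ) := by
    unfold dim at hd
    rw [Module.finrank_fintype_fun_eq_card]
    exact_mod_cast hd
  have hsurj : Function.Surjective (Q.domRestrict (vectorSpan ℝ σ)) := by
    intro w
    have : w ∈ (vectorSpan ℝ σ).map Q := by rw [htop]; trivial
    obtain ⟨u, hu, rfl⟩ := this
    exact ⟨⟨u, hu⟩, rfl⟩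
  have hinj := (LinearMap.injective_iff_surjective_of_finrank_eq_finrank hfin).2 hsurj
  let e := LinearEquiv.ofBijective _ ⟨hinj, hsurj⟩
  refine ⟨(vectorSpan ℝ σ).subtype ∘ₗ e.symm.toLinearMap, fun w => (e.symm w).2, fun w => ?_,
    fun u hu => ?_⟩
  · exact e.apply_symm_apply w
  · exact congr_arg Subtype.val (e.symm_apply_apply ⟨u, hu⟩)

/-- Here `a` is the value of the wall functional at the image of the normal vector and `b` its value
at `w`; the facet is met when both are on the same side. The right-hand form isolates the dependence
on `b` in a term linear in `a`, which balancing will cancel. -/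
lemma wall_arith {m a b c : ℝ} (ha : a ≠ 0) (hb : b ≠ 0) :
    (if 0 < b * a then m * (|a| * c) else 0) =
      m * (c * (max a 0 - if b < 0 then a else 0)) := by
  rcases lt_or_gt_of_ne ha with ha | ha <;> rcases lt_or_gt_of_ne hb with hb | hb
  · rw [if_pos (mul_pos_of_neg_of_neg hb ha), if_pos hb, abs_of_neg ha, max_eq_right ha.le]
    ring
  · rw [if_neg (mul_neg_of_pos_of_neg hb ha).not_gt, if_neg hb.not_gt, max_eq_right ha.le]
    ring
  · rw [if_neg (mul_neg_of_neg_of_pos hb ha).not_gt, if_pos hb, max_eq_left ha.le]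
    ring
  · rw [if_pos (mul_pos hb ha), if_neg hb.not_gt, abs_of_pos ha, max_eq_left ha.le]
    ring

/-! ### One facet near a value outside images of codimension two -/

section Local

variable [IsLattice Λ] (C : PolyComplex Λ) {Q : V →ₗ[ℝ] (ι → ℝ)} {ω : V} {w₀ : ι → ℝ}
  {σ : Set V} (hσ : σ ∈ C.cells) (hd : dim σ = Fintype.card ι)
  (hw : ∀ κ ∈ C.cells, ω ∈ κ → w₀ ∈ (vectorSpan ℝ κ).map Q →
    Fintype.card ι ≤ Module.finrank ℝ ((vectorSpan ℝ κ).map Q) + 1)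
include hσ hd hw

omit [IsLattice Λ] in
/-- Over `w₀` a facet mapped onto the target is met in its interior, or in a single wall. -/
lemma PolyComplex.exists_wall_or_relint {p : V} (hp : p ∈ link ω σ) (hpw : Q p = w₀) :
    (∃ δ : ℝ, 0 < δ ∧ ∀ ε : ℝ, 0 < ε → ε < δ → ω + ε • p ∈ intrinsicInterior ℝ σ) ∨
    ∃ τ, C.IsWall Q ω w₀ τ ∧ τ ⊆ σ ∧ p ∈ link ω τ ∧ ∃ δ : ℝ, 0 < δ ∧ ∀ ε : ℝ, 0 < ε → ε < δ →
      ω + ε • p ∈ intrinsicInterior ℝ τ := by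
  obtain ⟨κ, hκ, hsub, hωκ, hpκ, hδ⟩ := C.exists_carrier hσ hp
  by_cases hκσ : κ = σ
  · subst hκσ
    exact Or.inl hδ
  · refine Or.inr ⟨κ, ⟨hκ, ?_, p, hpκ, hpw⟩, hsub, hpκ, hδ⟩
    have h1 := hw κ hκ hωκ ⟨p, mem_vectorSpan_of_mem_link hpκ, hpw⟩
    have h2 := Submodule.finrank_map_le Q (vectorSpan ℝ κ)
    have h3 := (C.isFace_of_subset hκ hσ hsub).dim_lt hκσ
    unfold dim at *
    omega

variable (ψ : Set V → (ι → ℝ) →ₗ[ℝ] ℝ) (c : Set V → ℝ)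
  (hψ : ∀ τ, C.IsWall Q ω w₀ τ → LinearMap.ker (ψ τ) = (vectorSpan ℝ τ).map Q)
  (hc : ∀ τ, C.IsWall Q ω w₀ τ → ∀ σ ∈ C.cells, τ ⊆ σ → dim σ = Fintype.card ι →
    ψ τ (Q (normalVector Λ τ σ)) ≠ 0 →
      (mapIndex Λ Q σ : ℝ) = |ψ τ (Q (normalVector Λ τ σ))| * c τ)
include hψ hc

open Classical in
/-- The contribution of one facet to the local degree near `w₀`. -/
lemma PolyComplex.facet_contribution (m : ℝ) : ∀ᶠ w in nhds w₀, C.IsGenericFor Q w →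
    (if w ∈ Q '' link ω σ then m * mapIndex Λ Q σ else 0) =
      (if (vectorSpan ℝ σ).map Q = ⊤ ∧ w₀ ∈ Q '' link ω σ ∧
        ∀ τ, C.IsWall Q ω w₀ τ → ¬ τ ⊆ σ then m * mapIndex Λ Q σ else 0) +
      ∑ τ ∈ C.finite.toFinset with C.IsWall Q ω w₀ τ ∧ τ ⊆ σ,
        m * (c τ * (max (ψ τ (Q (normalVector Λ τ σ))) 0 -
          if ψ τ w < 0 then ψ τ (Q (normalVector Λ τ σ)) else 0)) := by
  have hσP := C.polyhedral σ hσ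
  have hnorm : ∀ τ, C.IsWall Q ω w₀ τ → τ ⊆ σ → IsNormalVector Λ τ σ (normalVector Λ τ σ) :=
    fun τ hτ hsub => isNormalVector_normalVector hσP (C.polyhedral τ hτ.1)
      (C.isFace_of_subset hτ.1 hσ hsub) (by have := hτ.2.1; omega)
  by_cases htop : (vectorSpan ℝ σ).map Q = ⊤
  swap
  · refine Filter.Eventually.of_forall fun w hgen => ?_
    rw [if_neg, if_neg fun h => htop h.1, zero_add, Finset.sum_eq_zero]
    · intro τ hτ
      obtain ⟨-, hτw, hsub⟩ := Finset.mem_filter.1 hτ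
      -- Otherwise the image of `σ` would be strictly larger than that of the wall, which has
      -- codimension at most one by `hw`, and so would be the whole target.
      have h0 : ψ τ (Q (normalVector Λ τ σ)) = 0 := by
        by_contra hne
        refine htop (Submodule.eq_top_of_finrank_eq (le_antisymm (Submodule.finrank_le _) ?_))
        have hlt : (vectorSpan ℝ τ).map Q < (vectorSpan ℝ σ).map Q := by
          refine lt_of_le_of_ne (Submodule.map_mono (vectorSpan_mono ℝ hsub)) fun heq => hne ?_
          have : Q (normalVector Λ τ σ) ∈ (vectorSpan ℝ σ).map Q :=
            ⟨_, (hnorm τ hτw hsub).mem.2, rfl⟩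
          rw [← heq, ← hψ τ hτw] at this
          exact this
        have h1 := Submodule.finrank_lt_finrank_of_lt hlt
        obtain ⟨p, hp, hpw⟩ := hτw.2.2
        have h2 := hw τ hτw.1 (mem_of_mem_link (C.polyhedral τ hτw.1) hp)
          ⟨p, mem_vectorSpan_of_mem_link hp, hpw⟩
        rw [Module.finrank_fintype_fun_eq_card]
        omega
      simp [h0]
    · rintro ⟨p, hp, rfl⟩
      exact hgen σ hσ htop ⟨p, mem_vectorSpan_of_mem_link hp, rfl⟩
  -- With `g` the inverse of `Q` on the span of `σ`, being met over `w` becomes a condition on the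
  -- point `g w`, which moves continuously with `w`.
  obtain ⟨g, hgσ, hQg, hgQ⟩ := exists_section hd htop
  have hgc : Continuous g := LinearMap.continuous_of_finiteDimensional g
  have himg : ∀ τ, τ ⊆ σ → ∀ w, w ∈ Q '' link ω τ ↔ g w ∈ link ω τ := by
    intro τ hτ w
    constructor
    · rintro ⟨p, hp, rfl⟩
      rwa [hgQ p (vectorSpan_mono ℝ hτ (mem_vectorSpan_of_mem_link hp))]
    · exact fun h => ⟨_, h, hQg w⟩
  by_cases hlink : g w₀ ∈ link ω σ
  swap
  · have hev : ∀ᶠ w in nhds w₀, g w ∉ link ω σ :=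
      hgc.continuousAt.eventually ((link_closed hσP).isOpen_compl.mem_nhds hlink)
    filter_upwards [hev] with w hw' _
    rw [if_neg (by rwa [himg σ subset_rfl]), if_neg, zero_add, Finset.sum_eq_zero]
    · intro τ hτ
      obtain ⟨-, hτw, hsub⟩ := Finset.mem_filter.1 hτ
      exact absurd (link_mono hsub ((himg τ hsub w₀).1 hτw.2.2)) hlink
    · rw [himg σ subset_rfl]
      exact fun h => hlink h.2.1
  have hωσ : ω ∈ σ := mem_of_mem_link hσP hlink
  -- If `g w₀` points into the interior of `σ`, the facet is also met over all nearby values and no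
  -- wall is involved. Otherwise exactly one wall `τ` of `σ` is involved, and `σ` looks like a
  -- half-space bounded by the span of `τ`.
  rcases C.exists_wall_or_relint hσ hd hw hlink (hQg w₀) with ⟨δ, hδ, hri⟩ |
    ⟨τ, hτ, hsub, hpτ, δ, hδ, hri⟩
  · have hno : ∀ τ, C.IsWall Q ω w₀ τ → ¬ τ ⊆ σ := by
      intro τ hτ hsub
      obtain ⟨δ', hδ', h'⟩ := (himg τ hsub w₀).1 hτ.2.2
      have h1 := C.subset_of_relint hσ hτ.1 (hri (min δ δ' / 2) (by positivity)
        (by linarith [min_le_left δ δ', lt_min hδ hδ'])) (h' (min δ δ' / 2) (by positivity)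
        (by linarith [min_le_right δ δ', lt_min hδ hδ']))
      have h2 := hτ.2.1
      rw [Set.Subset.antisymm hsub h1] at h2
      omega
    have hev : ∀ᶠ w in nhds w₀, g w ∈ link ω σ := by
      obtain ⟨δ', hδ', h'⟩ := exists_pos_link_eventually_eq hσP hlink
      have hε := h' (min δ δ' / 2) (by positivity)
        (by linarith [min_le_right δ δ', lt_min hδ hδ'])
      have hri' := hri (min δ δ' / 2) (by positivity)
        (by linarith [min_le_left δ δ', lt_min hδ hδ'])
      filter_upwards [hgc.continuousAt.eventually hε] with w hw'
      rw [hw', link_of_relint hσP hri']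
      exact sub_mem (hgσ _) (hgσ _)
    filter_upwards [hev] with w hw' _
    rw [if_pos (by rwa [himg σ subset_rfl]), if_pos ⟨htop, by rwa [himg σ subset_rfl], hno⟩,
      Finset.sum_eq_zero, add_zero]
    intro τ hτ
    obtain ⟨-, hτw, hsub⟩ := Finset.mem_filter.1 hτ
    exact absurd hsub (hno τ hτw)
  · have huniq : ∀ τ', C.IsWall Q ω w₀ τ' → τ' ⊆ σ → τ' = τ := by
      intro τ' hτ' hsub'
      obtain ⟨δ', hδ', h'⟩ := (himg τ' hsub' w₀).1 hτ'.2.2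
      have h1 := C.subset_of_relint hτ.1 hτ'.1 (hri (min δ δ' / 2) (by positivity)
        (by linarith [min_le_left δ δ', lt_min hδ hδ'])) (h' (min δ δ' / 2) (by positivity)
        (by linarith [min_le_right δ δ', lt_min hδ hδ']))
      exact (C.eq_of_dim_le hτ.1 hτ'.1 h1 (by have := hτ.2.1; have := hτ'.2.1; omega)).symm
    have hfilter : (C.finite.toFinset.filter fun τ' => C.IsWall Q ω w₀ τ' ∧ τ' ⊆ σ) = {τ} := by
      ext τ'
      simp only [Finset.mem_filter, Set.Finite.mem_toFinset, Finset.mem_singleton]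
      constructor
      · exact fun h => huniq τ' h.2.1 h.2.2
      · rintro rfl
        exact ⟨hτ.1, hτ, hsub⟩
    have hv := hnorm τ hτ hsub
    have hτP := C.polyhedral τ hτ.1
    have hface := C.isFace_of_subset hτ.1 hσ hsub
    have hdim : dim σ = dim τ + 1 := by have := hτ.2.1; omega
    set v := normalVector Λ τ σ with hvdef
    have hkτ : ∀ u ∈ vectorSpan ℝ τ, ψ τ (Q u) = 0 := fun u hu => by
      have : Q u ∈ (vectorSpan ℝ τ).map Q := ⟨u, hu, rfl⟩
      rwa [← hψ τ hτ] at this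
    have ha : ψ τ (Q v) ≠ 0 := by
      intro h0
      have h1 : Q v ∈ (vectorSpan ℝ τ).map Q := by
        rw [← hψ τ hτ]
        exact h0
      obtain ⟨t, ht, htv⟩ := h1
      have h2 := hgQ v hv.mem.2
      rw [← htv, hgQ t (vectorSpan_mono ℝ hsub ht)] at h2
      exact hv.notMem hσP hτP hface hdim (h2 ▸ ht)
    obtain ⟨δ', hδ', h'⟩ := exists_pos_link_eventually_eq hσP hlink
    have hε := h' (min δ δ' / 2) (by positivity) (by linarith [min_le_right δ δ', lt_min hδ hδ'])
    have hri' := hri (min δ δ' / 2) (by positivity)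
      (by linarith [min_le_left δ δ', lt_min hδ hδ'])
    filter_upwards [hgc.continuousAt.eventually hε] with w hw' hgen
    have hb : ψ τ w ≠ 0 := by
      intro h0
      refine hgen τ hτ.1 ?_ ?_
      · intro htop'
        have h1 := Submodule.finrank_map_le Q (vectorSpan ℝ τ)
        rw [htop', finrank_top, Module.finrank_fintype_fun_eq_card] at h1
        have := hτ.2.1
        unfold dim at this
        omega
      · rw [← hψ τ hτ]
        exact h0
    rw [if_neg (c := _ ∧ _) (fun h => h.2.2 τ hτ hsub), zero_add, hfilter, Finset.sum_singleton,
      ← wall_arith ha hb, ← hc τ hτ σ hσ hsub hd ha]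
    congr 1
    rw [himg σ subset_rfl, hw', hv.mem_link_iff hσP hτP hface hdim hri', eq_iff_iff]
    -- The coordinate `s` of `g w - g w₀` along the normal vector decides whether `σ` is met, and
    -- its sign can be read off from `ψ τ w`.
    have hkey : ∀ s : ℝ, g w - g w₀ - s • v ∈ vectorSpan ℝ τ → ψ τ w = s * ψ τ (Q v) := by
      intro s hs
      have h1 := hkτ _ hs
      have h2 := hkτ _ (mem_vectorSpan_of_mem_link hpτ)
      rw [map_sub, map_sub, map_sub, map_sub, map_smul, map_smul, h2, hQg, smul_eq_mul] at h1
      linarith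
    constructor
    · rintro ⟨s, hs0, hs⟩
      rw [hkey s hs] at hb ⊢
      have : 0 < s := lt_of_le_of_ne hs0 fun h => hb (by rw [← h, zero_mul])
      rw [mul_assoc]
      exact mul_pos this (mul_self_pos.2 ha)
    · intro hpos
      obtain ⟨s, hs⟩ := hv.exists_sub_smul_mem hσP hτP hface hdim (sub_mem (hgσ w) (hgσ w₀))
      refine ⟨s, ?_, hs⟩
      rw [hkey s hs, mul_assoc] at hpos
      exact (pos_of_mul_pos_left hpos (mul_self_nonneg _)).le

end Local

end Degree

/-! ### Balancing is equivalent to generic constancy of local degrees -/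

section Constancy

variable {V : Type*} [NormedAddCommGroup V] [NormedSpace ℝ V]
  {Λ : AddSubgroup V} {ι : Type*} [Fintype ι]

open Classical in
/-- The facets, as a finset. -/
noncomputable def WeightedComplex.facetFinset (Z : WeightedComplex Λ) : Finset (Set V) :=
  Z.finite.toFinset.filter fun σ => σ ∈ Z.facets

@[simp] lemma WeightedComplex.mem_facetFinset {Z : WeightedComplex Λ} {σ : Set V} :
    σ ∈ Z.facetFinset ↔ σ ∈ Z.facets := by
  simp only [WeightedComplex.facetFinset, Finset.mem_filter, Set.Finite.mem_toFinset]
  exact ⟨fun h => h.2, fun h => ⟨h.1, h⟩⟩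

open Classical in
lemma WeightedComplex.finsum_facets {M : Type*} [AddCommMonoid M] (Z : WeightedComplex Λ)
    (p : Set V → Prop) (f : Set V → M) :
    ∑ᶠ σ ∈ {σ | σ ∈ Z.facets ∧ p σ}, f σ = ∑ σ ∈ Z.facetFinset with p σ, f σ := by
  rw [← finsum_mem_coe_finset]
  congr 1
  ext σ
  simp

open Classical in
lemma WeightedComplex.localDegree_eq_sum (Z : WeightedComplex Λ) (hd : Z.d = Fintype.card ι)
    (Q : V →ₗ[ℝ] (ι → ℝ)) (ω : V) (w : ι → ℝ) : Z.localDegree Q ω w =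
      ∑ σ ∈ Z.facetFinset, if w ∈ Q '' link ω σ then Z.weight σ * mapIndex Λ Q σ else 0 := by
  rw [WeightedComplex.localDegree, Z.finsum_facets, ← Finset.sum_filter]
  congr 1
  ext σ
  simp only [Finset.mem_filter, mem_facetFinset]
  refine and_congr_right fun hσ => ?_
  simp [hσ.2, hd]

lemma WeightedComplex.localDegree_eq_zero (Z : WeightedComplex Λ) (hd : Z.d ≠ Fintype.card ι)
    (Q : V →ₗ[ℝ] (ι → ℝ)) (ω : V) (w : ι → ℝ) : Z.localDegree Q ω w = 0 := by
  have : {σ | σ ∈ Z.facets ∧ dim σ = Fintype.card ι ∧ w ∈ Q '' link ω σ} = ∅ := by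
    refine Set.eq_empty_iff_forall_notMem.2 ?_
    rintro σ ⟨hσ, h, -⟩
    exact hd (hσ.2 ▸ h)
  rw [WeightedComplex.localDegree, this, finsum_mem_empty]

variable [FiniteDimensional ℝ V] [IsLattice Λ]

open Classical in
lemma WeightedComplex.isBalanced_iff (Z : WeightedComplex Λ) : Z.IsBalanced ↔
    ∀ τ ∈ Z.cells, dim τ = Z.d - 1 → ∑ σ ∈ Z.facetFinset with τ ⊆ σ,
      (Z.weight σ : ℝ) • normalVector Λ τ σ ∈ vectorSpan ℝ τ := by
  refine forall_congr' fun τ => forall_congr' fun hτ => forall_congr' fun _ => ?_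
  rw [Z.finsum_facets, span_latticeOf (Z.polyhedral τ hτ) (Z.nonempty τ hτ)]

open Classical in
/-- The local degree near `w₀`. -/
lemma WeightedComplex.localDegree_eventually (Z : WeightedComplex Λ)
    (hd : Z.d = Fintype.card ι) {Q : V →ₗ[ℝ] (ι → ℝ)} {ω : V} {w₀ : ι → ℝ}
    (hw : ∀ κ ∈ Z.cells, ω ∈ κ → w₀ ∈ (vectorSpan ℝ κ).map Q →
      Fintype.card ι ≤ Module.finrank ℝ ((vectorSpan ℝ κ).map Q) + 1)
    (ψ : Set V → (ι → ℝ) →ₗ[ℝ] ℝ) (c : Set V → ℝ)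
    (hψ : ∀ τ, Z.IsWall Q ω w₀ τ → LinearMap.ker (ψ τ) = (vectorSpan ℝ τ).map Q)
    (hc : ∀ τ, Z.IsWall Q ω w₀ τ → ∀ σ ∈ Z.cells, τ ⊆ σ → dim σ = Fintype.card ι →
      ψ τ (Q (normalVector Λ τ σ)) ≠ 0 →
        (mapIndex Λ Q σ : ℝ) = |ψ τ (Q (normalVector Λ τ σ))| * c τ) :
    ∀ᶠ w in nhds w₀, Z.IsGenericFor Q w → (Z.localDegree Q ω w : ℝ) =
      (∑ σ ∈ Z.facetFinset, if (vectorSpan ℝ σ).map Q = ⊤ ∧ w₀ ∈ Q '' link ω σ ∧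
        ∀ τ, Z.IsWall Q ω w₀ τ → ¬ τ ⊆ σ then (Z.weight σ : ℝ) * mapIndex Λ Q σ else 0) +
      ∑ τ ∈ Z.finite.toFinset with Z.IsWall Q ω w₀ τ, ∑ σ ∈ Z.facetFinset with τ ⊆ σ,
        (Z.weight σ : ℝ) * (c τ * (max (ψ τ (Q (normalVector Λ τ σ))) 0 -
          if ψ τ w < 0 then ψ τ (Q (normalVector Λ τ σ)) else 0)) := by
  have hev := (Filter.eventually_all_finset Z.facetFinset).2 fun σ hσ =>
    Z.facet_contribution (mem_facetFinset.1 hσ).1 ((mem_facetFinset.1 hσ).2.trans hd) hw ψ c hψ hc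
      (Z.weight σ)
  filter_upwards [hev] with w hw' hgen
  rw [Z.localDegree_eq_sum hd, Rat.cast_sum]
  have hswap : ∑ τ ∈ Z.finite.toFinset with Z.IsWall Q ω w₀ τ, ∑ σ ∈ Z.facetFinset with τ ⊆ σ,
        (Z.weight σ : ℝ) * (c τ * (max (ψ τ (Q (normalVector Λ τ σ))) 0 -
          if ψ τ w < 0 then ψ τ (Q (normalVector Λ τ σ)) else 0)) =
      ∑ σ ∈ Z.facetFinset, ∑ τ ∈ Z.finite.toFinset with Z.IsWall Q ω w₀ τ ∧ τ ⊆ σ,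
        (Z.weight σ : ℝ) * (c τ * (max (ψ τ (Q (normalVector Λ τ σ))) 0 -
          if ψ τ w < 0 then ψ τ (Q (normalVector Λ τ σ)) else 0)) := by
    refine Finset.sum_comm' fun τ σ => ?_
    simp only [Finset.mem_filter]
    tauto
  rw [hswap, ← Finset.sum_add_distrib]
  refine Finset.sum_congr rfl fun σ hσ => ?_
  rw [← hw' σ hσ hgen]
  split_ifs <;> simp

/-- The image of `N_τ` spans a proper subspace, so a nonzero integral functional kills it; `hw`
makes this image a hyperplane, which is therefore the kernel. The index formula holds because `N_σ`
is `N_τ` plus one normal vector. -/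
lemma PolyComplex.exists_wall_data (C : PolyComplex Λ) {Q : V →ₗ[ℝ] (ι → ℝ)}
    (hQ : IsIntegralMap Λ Q) {ω : V} {w₀ : ι → ℝ} {τ : Set V} (hτ : C.IsWall Q ω w₀ τ)
    (hw : ∀ κ ∈ C.cells, ω ∈ κ → w₀ ∈ (vectorSpan ℝ κ).map Q →
      Fintype.card ι ≤ Module.finrank ℝ ((vectorSpan ℝ κ).map Q) + 1) :
    ∃ ψ : (ι → ℝ) →ₗ[ℝ] ℝ, ∃ c : ℝ, LinearMap.ker ψ = (vectorSpan ℝ τ).map Q ∧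
      ∀ σ ∈ C.cells, τ ⊆ σ → dim σ = Fintype.card ι → ψ (Q (normalVector Λ τ σ)) ≠ 0 →
        (mapIndex Λ Q σ : ℝ) = |ψ (Q (normalVector Λ τ σ))| * c := by
  have hτP := C.polyhedral τ hτ.1
  have hτd : Module.finrank ℝ (vectorSpan ℝ τ) + 1 = Fintype.card ι := by
    have := hτ.2.1
    unfold dim at this
    omega
  have hle := map_latticeOf_le hQ τ
  have hspan := span_map_latticeOf hτP (C.nonempty τ hτ.1) Q
  have hfin := Submodule.finrank_map_le Q (vectorSpan ℝ τ)
  obtain ⟨ψ, hψ, hψ0, hψH⟩ := exists_integral_functional hle (by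
    rw [hspan]
    intro htop
    rw [htop, finrank_top, Module.finrank_fintype_fun_eq_card] at hfin
    omega)
  obtain ⟨c, hc⟩ := hψ.exists_index_factor hle hψH
  refine ⟨ψ, c, ?_, fun σ hσ hsub hd hne => ?_⟩
  · obtain ⟨p, hp, hpw⟩ := hτ.2.2
    have h1 := hw τ hτ.1 (mem_of_mem_link hτP hp) ⟨p, mem_vectorSpan_of_mem_link hp, hpw⟩
    refine (Submodule.eq_of_le_of_finrank_le ?_ ?_).symm
    · rw [← hspan]
      exact Submodule.span_le.2 hψH
    · have h2 : LinearMap.ker ψ < ⊤ := lt_top_iff_ne_top.2 fun h => hψ0 (LinearMap.ker_eq_top.1 h)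
      have h3 := Submodule.finrank_lt h2.ne
      rw [Module.finrank_fintype_fun_eq_card] at h3
      omega
  · have hv := isNormalVector_normalVector (Λ := Λ) (C.polyhedral σ hσ) hτP
      (C.isFace_of_subset hτ.1 hσ hsub) (by have := hτ.2.1; omega)
    rw [mapIndex, hv.map_latticeOf Q]
    exact hc _ (hQ _ hv.mem.1) hne

/-- The local degree of a balanced complex is constant near a point outside codimension two. -/
lemma WeightedComplex.IsBalanced.localDegree_locally_constant {Z : WeightedComplex Λ}
    (hZ : Z.IsBalanced) (hd : Z.d = Fintype.card ι) {Q : V →ₗ[ℝ] (ι → ℝ)}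
    (hQ : IsIntegralMap Λ Q) {ω : V} {w₀ : ι → ℝ}
    (hw : ∀ κ ∈ Z.cells, ω ∈ κ → w₀ ∈ (vectorSpan ℝ κ).map Q →
      Fintype.card ι ≤ Module.finrank ℝ ((vectorSpan ℝ κ).map Q) + 1) :
    ∃ m : ℝ, ∀ᶠ w in nhds w₀, Z.IsGenericFor Q w → (Z.localDegree Q ω w : ℝ) = m := by
  classical
  have hex : ∀ τ, ∃ ψ : (ι → ℝ) →ₗ[ℝ] ℝ, ∃ c : ℝ, Z.IsWall Q ω w₀ τ →
      LinearMap.ker ψ = (vectorSpan ℝ τ).map Q ∧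
      ∀ σ ∈ Z.cells, τ ⊆ σ → dim σ = Fintype.card ι → ψ (Q (normalVector Λ τ σ)) ≠ 0 →
        (mapIndex Λ Q σ : ℝ) = |ψ (Q (normalVector Λ τ σ))| * c := by
    intro τ
    by_cases hτ : Z.IsWall Q ω w₀ τ
    · obtain ⟨ψ, c, h⟩ := Z.exists_wall_data hQ hτ hw
      exact ⟨ψ, c, fun _ => h⟩
    · exact ⟨0, 0, fun h => absurd h hτ⟩
  choose ψ c hψc using hex
  refine ⟨(∑ σ ∈ Z.facetFinset, if (vectorSpan ℝ σ).map Q = ⊤ ∧ w₀ ∈ Q '' link ω σ ∧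
        ∀ τ, Z.IsWall Q ω w₀ τ → ¬ τ ⊆ σ then (Z.weight σ : ℝ) * mapIndex Λ Q σ else 0) +
      ∑ τ ∈ Z.finite.toFinset with Z.IsWall Q ω w₀ τ, ∑ σ ∈ Z.facetFinset with τ ⊆ σ,
        (Z.weight σ : ℝ) * (c τ * max (ψ τ (Q (normalVector Λ τ σ))) 0),
    (Z.localDegree_eventually hd hw ψ c (fun τ hτ => (hψc τ hτ).1)
    fun τ hτ => (hψc τ hτ).2).mono fun w h hgen => (h hgen).trans ?_⟩
  congr 1
  refine Finset.sum_congr rfl fun τ hτ => ?_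
  obtain ⟨-, hτ⟩ := Finset.mem_filter.1 hτ
  have hb := Z.isBalanced_iff.1 hZ τ hτ.1 (by have := hτ.2.1; omega)
  -- The balancing sum is parallel to `τ`, so `ψ τ ∘ Q` kills it, and with it the only part of the
  -- wall term that depends on the side of `w`.
  have h0 : ∑ σ ∈ Z.facetFinset with τ ⊆ σ,
      (Z.weight σ : ℝ) * ψ τ (Q (normalVector Λ τ σ)) = 0 := by
    have h1 : Q (∑ σ ∈ Z.facetFinset with τ ⊆ σ, (Z.weight σ : ℝ) • normalVector Λ τ σ) ∈
        LinearMap.ker (ψ τ) := by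
      rw [(hψc τ hτ).1]
      exact ⟨_, hb, rfl⟩
    rw [LinearMap.mem_ker, map_sum, map_sum] at h1
    simpa using h1
  split_ifs
  · have h2 : ∀ σ, (Z.weight σ : ℝ) * (c τ * (max (ψ τ (Q (normalVector Λ τ σ))) 0 -
        ψ τ (Q (normalVector Λ τ σ)))) =
        (Z.weight σ : ℝ) * (c τ * max (ψ τ (Q (normalVector Λ τ σ))) 0) -
          c τ * ((Z.weight σ : ℝ) * ψ τ (Q (normalVector Λ τ σ))) := fun σ => by ring
    rw [Finset.sum_congr rfl fun σ _ => h2 σ, Finset.sum_sub_distrib, ← Finset.mul_sum, h0,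
      mul_zero, sub_zero]
  · simp only [sub_zero]

/-- The local degree of a balanced complex is constant over generic points. -/
theorem WeightedComplex.IsBalanced.localDegree_eq {Z : WeightedComplex Λ}
    (hZ : Z.IsBalanced) {Q : V →ₗ[ℝ] (ι → ℝ)} (hQ : IsIntegralMap Λ Q) (ω : V) {w₀ w₁ : ι → ℝ}
    (h₀ : Z.IsGenericFor Q w₀) (h₁ : Z.IsGenericFor Q w₁) :
    Z.localDegree Q ω w₀ = Z.localDegree Q ω w₁ := by
  by_cases hd : Z.d = Fintype.card ι
  swap
  · rw [Z.localDegree_eq_zero hd, Z.localDegree_eq_zero hd]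
  obtain ⟨hopen, hdense⟩ := Z.isOpen_dense_isGenericFor Q
  have hgen : ∀ w, Z.IsGenericFor Q w → ∀ κ ∈ Z.cells, ω ∈ κ → w ∈ (vectorSpan ℝ κ).map Q →
      Fintype.card ι ≤ Module.finrank ℝ ((vectorSpan ℝ κ).map Q) + 1 := by
    intro w hw κ hκ _ hmem
    have : (vectorSpan ℝ κ).map Q = ⊤ := by
      by_contra hne
      exact hw κ hκ hne hmem
    rw [this, finrank_top, Module.finrank_fintype_fun_eq_card]
    omega
  obtain ⟨m₁, hm₁⟩ := hZ.localDegree_locally_constant hd hQ (hgen w₁ h₁)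
  -- The span of `w₀` and an image of codimension at least two is still proper. If `w₂` avoids these
  -- spans, the segment from the generic point `w₀` to `w₂` misses all such images.
  let S : Set (Submodule ℝ (ι → ℝ)) := (fun κ => (vectorSpan ℝ κ).map Q ⊔
    Submodule.span ℝ {w₀}) '' {κ | κ ∈ Z.cells ∧
      Module.finrank ℝ ((vectorSpan ℝ κ).map Q) + 1 < Fintype.card ι}
  obtain ⟨hSo, hSd⟩ := isOpen_dense_compl_submodules S
    ((Z.finite.subset fun κ h => h.1).image _) (by
      rintro _ ⟨κ, ⟨hκ, hlt⟩, rfl⟩ htop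
      have h1 := Submodule.finrank_add_le_finrank_add_finrank ((vectorSpan ℝ κ).map Q)
        (Submodule.span ℝ {w₀})
      have h2 := finrank_span_le_card (R := ℝ) ({w₀} : Set (ι → ℝ))
      simp only at htop
      rw [htop, finrank_top, Module.finrank_fintype_fun_eq_card] at h1
      simp at h2
      omega)
  -- The segment to `w₁` itself may be in bad position, so `w₂` is chosen so close to `w₁` that the
  -- degrees over both agree.
  obtain ⟨N, hN, hNo, hw₁N⟩ := eventually_nhds_iff.1 hm₁
  obtain ⟨w₂, ⟨hw₂N, hw₂S⟩, h₂⟩ := (hdense.inter_of_isOpen_left hSd hopen).inter_open_nonempty N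
    hNo ⟨w₁, hw₁N⟩ |>.imp fun w h => (⟨⟨h.1, h.2.2⟩, h.2.1⟩ : (w ∈ N ∧ _) ∧ _)
  have hseg : ∀ t : unitInterval, ∀ κ ∈ Z.cells, ω ∈ κ →
      AffineMap.lineMap w₀ w₂ (t : ℝ) ∈ (vectorSpan ℝ κ).map Q →
      Fintype.card ι ≤ Module.finrank ℝ ((vectorSpan ℝ κ).map Q) + 1 := by
    intro t κ hκ hω hmem
    by_contra hlt
    push Not at hlt
    by_cases ht : (t : ℝ) = 0
    · rw [ht, AffineMap.lineMap_apply_zero] at hmem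
      exact absurd (hgen w₀ h₀ κ hκ hω hmem) (not_le.2 hlt)
    · refine hw₂S _ ⟨κ, ⟨hκ, hlt⟩, rfl⟩ ?_
      rw [AffineMap.lineMap_apply_module] at hmem
      have h1 : w₂ = (t : ℝ)⁻¹ • ((1 - (t : ℝ)) • w₀ + (t : ℝ) • w₂) +
          (-((t : ℝ)⁻¹ * (1 - t))) • w₀ := by
        rw [smul_add, smul_smul, smul_smul, inv_mul_cancel₀ ht, one_smul, neg_smul]
        abel
      rw [h1]
      exact add_mem (Submodule.smul_mem _ _ (Submodule.mem_sup_left hmem))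
        (Submodule.smul_mem _ _ (Submodule.mem_sup_right (Submodule.mem_span_singleton_self w₀)))
  choose m hm using fun t => hZ.localDegree_locally_constant hd hQ (hseg t)
  -- Local values at nearby parameters agree because their neighbourhoods share a generic point;
  -- connectedness of the interval then joins the two ends.
  have hlc : IsLocallyConstant m := by
    rw [IsLocallyConstant.iff_eventually_eq]
    intro t
    have hcont : Continuous fun s : unitInterval => AffineMap.lineMap w₀ w₂ (s : ℝ) :=
      AffineMap.lineMap_continuous.comp continuous_subtype_val
    filter_upwards [hcont.continuousAt.eventually (eventually_eventually_nhds.2 (hm t))] with s hs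
    obtain ⟨w, ⟨hw1, hw2⟩, hw3⟩ :=
      (hdense.inter_nhds_nonempty (Filter.inter_mem hs (hm s))).imp fun w h => And.symm h
    rw [← hw1 hw3, ← hw2 hw3]
  have h3 := hlc.apply_eq_of_preconnectedSpace 0 1
  have h4 := (hm 0).self_of_nhds
  have h5 := (hm 1).self_of_nhds
  simp only [Set.Icc.coe_zero, AffineMap.lineMap_apply_zero, Set.Icc.coe_one,
    AffineMap.lineMap_apply_one] at h4 h5
  have h6 := hN w₁ hw₁N h₁
  have h7 := hN w₂ hw₂N h₂
  have h8 : (Z.localDegree Q ω w₀ : ℝ) = Z.localDegree Q ω w₁ := by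
    rw [h4 h₀, h3, ← h5 h₂, h7, h6]
  exact_mod_cast h8

theorem WeightedComplex.IsBalanced.exists_isGenericValue {Z : WeightedComplex Λ}
    (hZ : Z.IsBalanced) {Q : V →ₗ[ℝ] (ι → ℝ)} (hQ : IsIntegralMap Λ Q) (ω : V) :
    ∃ m, IsGenericValue (Z.localDegree Q ω) m := by
  obtain ⟨hopen, hdense⟩ := Z.isOpen_dense_isGenericFor Q
  obtain ⟨w₀, hw₀⟩ := hdense.nonempty
  exact ⟨_, _, hopen, hdense, fun w hw => hZ.localDegree_eq hQ ω hw hw₀⟩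

/-- There are enough integral maps to coordinatize a given subspace. -/
lemma exists_integralMap (Λ : AddSubgroup V) [IsLattice Λ] (L : Submodule ℝ V) :
    ∃ Q : V →ₗ[ℝ] (Fin (Module.finrank ℝ L) → ℝ), IsIntegralMap Λ Q ∧ L.map Q = ⊤ := by
  let S : Set (Module.Dual ℝ L) := {f | ∃ l : V →ₗ[ℝ] ℝ, IsIntegral Λ l ∧ f = l.domRestrict L}
  -- If the restrictions of integral functionals did not span the dual of `L`, a nonzero vector of
  -- `L` would be killed by all of them, against separation of points.
  have hS : Submodule.span ℝ S = ⊤ := by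
    by_contra hne
    obtain ⟨F, hF0, hF⟩ := Submodule.exists_le_ker_of_lt_top _ (lt_top_iff_ne_top.2 hne)
    obtain ⟨x, rfl⟩ := (Module.evalEquiv ℝ L).surjective F
    refine hF0 ?_
    have : x = 0 := by
      refine Subtype.ext (IsLattice.eq_zero_of_forall (Λ := Λ) (x : V) fun l hl => ?_)
      exact hF (Submodule.subset_span ⟨l, hl, rfl⟩)
    rw [this, map_zero]
  have hfin : Module.finrank ℝ (Submodule.span ℝ S) = Module.finrank ℝ L := by
    rw [hS, finrank_top, Subspace.dual_finrank_eq]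
  obtain ⟨f, hf, hspan, -⟩ := Submodule.exists_fun_fin_finrank_span_eq ℝ S
  choose l hl hlf using hf
  refine ⟨LinearMap.pi fun i => l (Fin.cast hfin.symm i), fun u hu i => hl _ u hu, ?_⟩
  refine Submodule.eq_top_of_finrank_eq ?_
  rw [← LinearMap.range_domRestrict, LinearMap.finrank_range_of_inj,
    Module.finrank_fintype_fun_eq_card, Fintype.card_fin]
  rw [← LinearMap.ker_eq_bot, LinearMap.ker_eq_bot']
  intro x hx
  have hall : ∀ g : Module.Dual ℝ L, g x = 0 := by
    intro g
    have hg : g ∈ Submodule.span ℝ (Set.range f) := by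
      rw [hspan, hS]
      trivial
    refine (Submodule.span_le (p := LinearMap.ker (Module.Dual.eval ℝ L x))).2 ?_ hg
    rintro _ ⟨i, rfl⟩
    have h1 := congr_fun hx (Fin.cast hfin i)
    have h2 : l i x = 0 := h1
    show f i x = 0
    rw [hlf i]
    exact h2
  exact (Module.forall_dual_apply_eq_zero_iff ℝ x).1 hall

open Classical in
/-- A weighted complex whose local degrees are all generically constant is balanced. -/
theorem WeightedComplex.isBalanced_of_localDegree {Z : WeightedComplex Λ}
    (h : ∀ (r : ℕ) (Q : V →ₗ[ℝ] (Option (Fin r) → ℝ)), IsIntegralMap Λ Q → ∀ ω,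
      ∃ m, IsGenericValue (Z.localDegree Q ω) m) : Z.IsBalanced := by
  rw [Z.isBalanced_iff]
  intro ρ hρ hdρ
  have hρP := Z.polyhedral ρ hρ
  obtain ⟨ω, hω⟩ := relint_nonempty hρP (Z.nonempty ρ hρ)
  obtain ⟨s, hs, hspan⟩ := exists_functionals_vectorSpan hρP (Z.nonempty ρ hρ)
  rw [hspan]
  intro p hp
  have hp0 : ∀ u ∈ vectorSpan ℝ ρ, p u = 0 := fun u hu => (hspan u).1 hu p hp
  set L := vectorSpan ℝ ρ with hL
  obtain ⟨Q', hQ', hQ'top⟩ := exists_integralMap Λ L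
  -- `p` is one of the functionals cutting out the span of `ρ`, tested on the balancing sum, and
  -- `Q'` gives coordinates along `ρ`. The image of `ρ` is then the hyperplane where the coordinate
  -- `none` vanishes, the only wall seen from `ω` over `0`.
  let Q : V →ₗ[ℝ] (Option (Fin (Module.finrank ℝ L)) → ℝ) :=
    LinearMap.pi fun o => o.elim p fun i => LinearMap.proj i ∘ₗ Q'
  have hQ : IsIntegralMap Λ Q := by
    intro u hu o
    cases o with
    | none => exact hs p hp u hu
    | some i => exact hQ' u hu i
  have hr : LinearMap.funLeft ℝ ℝ some ∘ₗ Q = Q' := rfl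
  have hcard : (Fintype.card (Option (Fin (Module.finrank ℝ L)))) = Module.finrank ℝ L + 1 := by
    simp
  have hd : Z.d = Fintype.card (Option (Fin (Module.finrank ℝ L))) := by
    rw [hcard]
    unfold dim at hdρ
    push_cast
    linarith
  have hrank : Module.finrank ℝ L ≤ Module.finrank ℝ (L.map Q) := by
    have h1 : (L.map Q).map (LinearMap.funLeft ℝ ℝ some) = ⊤ := by
      rw [← Submodule.map_comp, hr, hQ'top]
    have h2 := Submodule.finrank_map_le
      (LinearMap.funLeft ℝ ℝ (some : Fin (Module.finrank ℝ L) → _)) (L.map Q)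
    rw [h1, finrank_top, Module.finrank_fintype_fun_eq_card, Fintype.card_fin] at h2
    exact h2
  have hwall : ∀ τ, Z.IsWall Q ω 0 τ ↔ τ = ρ := by
    intro τ
    constructor
    · rintro ⟨hτ, hτd, q, hq, -⟩
      have hsub := Z.subset_of_relint hρ hτ hω (mem_of_mem_link (Z.polyhedral τ hτ) hq)
      exact (Z.eq_of_dim_le hρ hτ hsub (by omega)).symm
    · rintro rfl
      exact ⟨hρ, by omega, 0, zero_mem_link (intrinsicInterior_subset hω), map_zero Q⟩
  let ψ : (Option (Fin (Module.finrank ℝ L)) → ℝ) →ₗ[ℝ] ℝ := LinearMap.proj none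
  have hψ : LinearMap.ker ψ = L.map Q := by
    refine (Submodule.eq_of_le_of_finrank_le ?_ ?_).symm
    · rintro _ ⟨u, hu, rfl⟩
      exact hp0 u hu
    · have h2 : LinearMap.ker ψ ≠ ⊤ := fun h => by
        have : ψ (fun _ => 1) = 0 := by
          rw [← LinearMap.mem_ker, h]
          trivial
        exact one_ne_zero this
      have h3 := Submodule.finrank_lt h2
      rw [Module.finrank_fintype_fun_eq_card, hcard] at h3
      omega
  have hidx : ∀ σ ∈ Z.cells, ρ ⊆ σ → dim σ = Fintype.card (Option (Fin (Module.finrank ℝ L))) →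
      ψ (Q (normalVector Λ ρ σ)) ≠ 0 →
        (mapIndex Λ Q σ : ℝ) = |ψ (Q (normalVector Λ ρ σ))| * mapIndex Λ Q' ρ := by
    intro σ hσ hsub hdσ hne
    have hv := isNormalVector_normalVector (Λ := Λ) (Z.polyhedral σ hσ) hρP
      (Z.isFace_of_subset hρ hσ hsub) (by omega)
    rw [mapIndex, hv.map_latticeOf Q, relIndex_intLattice_option (map_latticeOf_le hQ ρ) ?_
      (hQ _ hv.mem.1) hne, mapIndex, ← hr, AddSubgroup.map_map]
    · rfl
    · rintro _ ⟨u, hu, rfl⟩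
      exact hp0 u hu.2
  have hev := Z.localDegree_eventually hd (Q := Q) (ω := ω) (w₀ := 0) (fun κ hκ hωκ _ => by
      rw [hcard]
      have : Module.finrank ℝ (L.map Q) ≤ Module.finrank ℝ ((vectorSpan ℝ κ).map Q) :=
        Submodule.finrank_mono (Submodule.map_mono
          (vectorSpan_mono ℝ (Z.subset_of_relint hρ hκ hω hωκ)))
      omega) (fun _ => ψ) (fun _ => mapIndex Λ Q' ρ)
    (fun τ hτ => by rw [(hwall τ).1 hτ]; exact hψ)
    (fun τ hτ => by rw [(hwall τ).1 hτ]; exact hidx)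
  have hfilter : (Z.finite.toFinset.filter fun τ => Z.IsWall Q ω 0 τ) = {ρ} := by
    ext τ
    simp only [Finset.mem_filter, Set.Finite.mem_toFinset, Finset.mem_singleton, hwall]
    exact ⟨fun h => h.2, fun h => ⟨h ▸ hρ, h⟩⟩
  rw [hfilter] at hev
  simp only [Finset.sum_singleton] at hev
  obtain ⟨m, U, hUo, hUd, hU⟩ := h _ Q hQ ω
  obtain ⟨hopen, hdense⟩ := Z.isOpen_dense_isGenericFor Q
  have hpick : ∀ (R : (Option (Fin (Module.finrank ℝ L)) → ℝ) → Prop), (∀ᶠ w in nhds 0, R w) →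
      ∀ s : ℝ, s ≠ 0 → ∃ w, 0 < s * w none ∧ w ∈ U ∧ Z.IsGenericFor Q w ∧ R w := by
    intro R hR s hs
    obtain ⟨N, hN, hNo, h0N⟩ := eventually_nhds_iff.1 hR
    have hO : IsOpen (N ∩ {w | 0 < s * w none}) :=
      hNo.inter (isOpen_lt continuous_const (continuous_const.mul (continuous_apply _)))
    have hne : (N ∩ {w | 0 < s * w none}).Nonempty := by
      have ht : Filter.Tendsto (fun t : ℝ => fun _ : Option (Fin (Module.finrank ℝ L)) => t * s)
          (nhdsWithin 0 (Set.Ioi 0)) (nhds 0) := by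
        have : Continuous fun t : ℝ => fun _ : Option (Fin (Module.finrank ℝ L)) => t * s := by
          fun_prop
        have h1 := this.tendsto 0
        simp only [zero_mul] at h1
        exact h1.mono_left nhdsWithin_le_nhds
      obtain ⟨t, ht1, ht2⟩ := ((ht.eventually (hNo.mem_nhds h0N)).and self_mem_nhdsWithin).exists
      refine ⟨_, ht1, ?_⟩
      have h3 : 0 < t * (s * s) := mul_pos ht2 (mul_self_pos.2 hs)
      show 0 < s * (t * s)
      linarith
    obtain ⟨w, hw1, hw2⟩ := (hUd.inter_of_isOpen_left hdense hUo).inter_open_nonempty _ hO hne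
    exact ⟨w, hw1.2, hw2.1, hw2.2, hN w hw1.1⟩
  -- Points on the two sides of the hyperplane have the same degree; the difference of the two
  -- expressions is the index of `ρ` times `p` of the balancing sum.
  obtain ⟨w, hw1, hw2, hw3, hw4⟩ := hpick _ hev 1 one_ne_zero
  obtain ⟨w', hw1', hw2', hw3', hw4'⟩ := hpick _ hev (-1) (by norm_num)
  have e1 := hw4 hw3
  have e2 := hw4' hw3'
  rw [hU w hw2] at e1
  rw [hU w' hw2'] at e2
  have hwn : ¬ ψ w < 0 := by
    show ¬ w none < 0
    linarith
  have hwn' : ψ w' < 0 := by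
    show w' none < 0
    linarith
  simp only [if_neg hwn, if_pos hwn'] at e1 e2
  have e3 := add_left_cancel (e1.symm.trans e2)
  rw [← sub_eq_zero, ← Finset.sum_sub_distrib] at e3
  have hidx0 : (mapIndex Λ Q' ρ : ℝ) ≠ 0 := by
    exact_mod_cast mapIndex_ne_zero hρP (Z.nonempty ρ hρ) hQ' hQ'top
  refine (mul_eq_zero.1 ?_).resolve_left hidx0
  rw [← e3, map_sum, Finset.mul_sum]
  refine Finset.sum_congr rfl fun σ _ => ?_
  have : ψ (Q (normalVector Λ ρ σ)) = p (normalVector Λ ρ σ) := rfl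
  rw [map_smul, smul_eq_mul, this]
  ring

end Constancy

/-! ### Complete refinements from hyperplane arrangements -/

section Arrangement

variable {V : Type*} [NormedAddCommGroup V] [NormedSpace ℝ V] {Λ : AddSubgroup V}

/-- The closed cell containing `x` of an arrangement of affine hyperplanes. -/
def arrangementCell (A : Finset ((V →ₗ[ℝ] ℝ) × ℝ)) (x : V) : Set V :=
  {y | ∀ a ∈ A, (a.1 x ≤ a.2 → a.1 y ≤ a.2) ∧ (a.2 ≤ a.1 x → a.2 ≤ a.1 y)}

open Classical in
/-- The inequalities defining a cell of an arrangement. -/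
noncomputable def arrangementIneqs (A : Finset ((V →ₗ[ℝ] ℝ) × ℝ)) (x : V) :
    Finset ((V →ₗ[ℝ] ℝ) × ℝ) :=
  (A.filter fun a => a.1 x ≤ a.2) ∪ (A.filter fun a => a.2 ≤ a.1 x).image fun a => (-a.1, -a.2)

variable {A : Finset ((V →ₗ[ℝ] ℝ) × ℝ)} {x w : V}

lemma forall_arrangementIneqs {R : (V →ₗ[ℝ] ℝ) × ℝ → Prop} :
    (∀ p ∈ arrangementIneqs A x, R p) ↔
      ∀ a ∈ A, (a.1 x ≤ a.2 → R a) ∧ (a.2 ≤ a.1 x → R (-a.1, -a.2)) := by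
  classical
  simp only [arrangementIneqs, Finset.mem_union, or_imp, forall_and, Finset.forall_mem_image,
    Finset.mem_filter, and_imp]

lemma arrangementCell_eq (A : Finset ((V →ₗ[ℝ] ℝ) × ℝ)) (x : V) :
    arrangementCell A x = {y | ∀ p ∈ arrangementIneqs A x, p.1 y ≤ p.2} := by
  ext y
  simp only [Set.mem_ofPred_eq, forall_arrangementIneqs, arrangementCell, LinearMap.neg_apply,
    neg_le_neg_iff]

lemma mem_arrangementCell_self : x ∈ arrangementCell A x := fun _ _ => ⟨id, id⟩

/-- For `w` in the closed cell of `x`, the sign conditions at `w` are those at `x` with some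
inequalities turned into equalities, which describes a face. -/
lemma arrangementCell_eq_tight (hw : w ∈ arrangementCell A x) : arrangementCell A w =
    {y | (∀ p ∈ arrangementIneqs A x, p.1 y ≤ p.2) ∧
      ∀ p ∈ arrangementIneqs A x, p.1 w = p.2 → p.1 y = p.2} := by
  ext y
  simp only [Set.mem_ofPred_eq, forall_arrangementIneqs, LinearMap.neg_apply, neg_le_neg_iff,
    neg_inj]
  constructor
  · intro hy
    refine ⟨fun a ha => ⟨fun h => (hy a ha).1 ((hw a ha).1 h), fun h => (hy a ha).2 ((hw a ha).2 h)⟩,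
      fun a ha => ⟨fun _ h => le_antisymm ((hy a ha).1 h.le) ((hy a ha).2 h.ge),
        fun _ h => le_antisymm ((hy a ha).1 h.le) ((hy a ha).2 h.ge)⟩⟩
  · rintro ⟨h1, h2⟩ a ha
    constructor
    · intro h
      rcases le_total (a.1 x) a.2 with hx | hx
      · exact (h1 a ha).1 hx
      · exact ((h2 a ha).2 hx (le_antisymm h ((hw a ha).2 hx))).le
    · intro h
      rcases le_total (a.1 x) a.2 with hx | hx
      · exact ((h2 a ha).1 hx (le_antisymm ((hw a ha).1 hx) h)).ge
      · exact (h1 a ha).2 hx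

lemma isFace_arrangementCell (hw : w ∈ arrangementCell A x) :
    IsFace (arrangementCell A w) (arrangementCell A x) := by
  rw [arrangementCell_eq_tight hw, arrangementCell_eq A x]
  rw [arrangementCell_eq] at hw
  exact isFace_tight _ hw

lemma exists_eq_arrangementCell {F : Set V} (hF : IsFace F (arrangementCell A x)) :
    ∃ w, F = arrangementCell A w := by
  have hsub := hF.subset
  rw [arrangementCell_eq] at hF
  obtain ⟨w, hw, h⟩ := exists_tight_of_isFace _ hF
  exact ⟨w, by rw [arrangementCell_eq_tight (hsub hw), h]⟩

lemma isRationalPolyhedron_arrangementCell (hA : ∀ a ∈ A, IsIntegral Λ a.1) (x : V) :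
    IsRationalPolyhedron Λ (arrangementCell A x) := by
  refine ⟨arrangementIneqs A x, ?_, arrangementCell_eq A x⟩
  rw [forall_arrangementIneqs]
  refine fun a ha => ⟨fun _ => hA a ha, fun _ u hu => ?_⟩
  obtain ⟨z, hz⟩ := hA a ha u hu
  exact ⟨-z, by simp [hz]⟩

lemma finite_arrangementCell (A : Finset ((V →ₗ[ℝ] ℝ) × ℝ)) :
    (Set.range (arrangementCell A)).Finite := by
  classical
  refine ((A.powerset ×ˢ A.powerset).finite_toSet.image fun S =>
    {y : V | (∀ a ∈ S.1, a.1 y ≤ a.2) ∧ ∀ a ∈ S.2, a.2 ≤ a.1 y}).subset ?_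
  rintro _ ⟨x, rfl⟩
  refine ⟨(A.filter fun a => a.1 x ≤ a.2, A.filter fun a => a.2 ≤ a.1 x), ?_, ?_⟩
  · simp only [Finset.coe_product, Set.mem_prod, Finset.mem_coe, Finset.mem_powerset]
    exact ⟨Finset.filter_subset _ _, Finset.filter_subset _ _⟩
  · ext y
    simp only [Set.mem_ofPred_eq, Finset.mem_filter, and_imp, arrangementCell, forall_and]

variable [FiniteDimensional ℝ V]

/-- Equality at a relative interior point forces equality on the whole cell, so no hyperplane of the
arrangement cuts through a cell. This is what makes arrangements refine. -/
lemma le_of_relint_arrangementCell (hω : w ∈ intrinsicInterior ℝ (arrangementCell A x))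
    {a : (V →ₗ[ℝ] ℝ) × ℝ} (ha : a ∈ A) {y : V} (hy : y ∈ arrangementCell A x) :
    (a.1 w ≤ a.2 → a.1 y ≤ a.2) ∧ (a.2 ≤ a.1 w → a.2 ≤ a.1 y) := by
  have hmem := intrinsicInterior_subset hω
  rw [arrangementCell_eq, mem_relint_polyhedron] at hω
  have h2 := forall_arrangementIneqs.1 hω.2 a ha
  rw [arrangementCell_eq] at hy
  have h3 := forall_arrangementIneqs.1 hy a ha
  simp only [LinearMap.neg_apply, neg_le_neg_iff, neg_inj] at h2 h3
  constructor
  · intro h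
    rcases le_total (a.1 x) a.2 with hx | hx
    · exact h3.1 hx
    · exact (h2.2 hx (le_antisymm h ((hmem a ha).2 hx)) y hy).le
  · intro h
    rcases le_total (a.1 x) a.2 with hx | hx
    · exact (h2.1 hx (le_antisymm ((hmem a ha).1 hx) h) y hy).ge
    · exact h3.2 hx

-- The intersection is the cell of any of its relative interior points: the inequalities tight at
-- such a point are tight on the whole intersection.
open Classical in
lemma arrangementCell_inter {x' : V} (hne : (arrangementCell A x ∩ arrangementCell A x').Nonempty)
    (hA : ∀ a ∈ A, IsIntegral Λ a.1) : ∃ w ∈ arrangementCell A x,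
      arrangementCell A x ∩ arrangementCell A x' = arrangementCell A w := by
  have heq : arrangementCell A x ∩ arrangementCell A x' =
      {y | ∀ p ∈ arrangementIneqs A x ∪ arrangementIneqs A x', p.1 y ≤ p.2} := by
    ext y
    simp only [arrangementCell_eq, Set.mem_inter_iff, Set.mem_ofPred_eq, Finset.mem_union, or_imp,
      forall_and]
  obtain ⟨w, hw⟩ := relint_nonempty ((isRationalPolyhedron_arrangementCell hA x).inter
    (isRationalPolyhedron_arrangementCell hA x')) hne
  have hwm := intrinsicInterior_subset hw
  refine ⟨w, hwm.1, Set.Subset.antisymm (fun y hy a ha => ?_) ?_⟩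
  · rw [heq, mem_relint_polyhedron] at hw
    have h2 := hw.2
    simp only [Finset.mem_union, or_imp, forall_and] at h2
    have h3 := forall_arrangementIneqs.1 h2.1 a ha
    rw [heq] at hy
    have hy1 : y ∈ arrangementCell A x := by
      rw [arrangementCell_eq]
      exact fun p hp => hy p (Finset.mem_union_left _ hp)
    simp only [Set.mem_ofPred_eq, Finset.mem_union, or_imp, forall_and] at hy
    simp only [LinearMap.neg_apply, neg_inj] at h3
    constructor
    · intro h
      rcases le_total (a.1 x) a.2 with hx | hx
      · exact (hy1 a ha).1 hx
      · exact (h3.2 hx (le_antisymm h ((hwm.1 a ha).2 hx)) y hy).le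
    · intro h
      rcases le_total (a.1 x) a.2 with hx | hx
      · exact (h3.1 hx (le_antisymm ((hwm.1 a ha).1 hx) h) y hy).ge
      · exact (hy1 a ha).2 hx
  · exact Set.subset_inter (isFace_arrangementCell hwm.1).subset
      (isFace_arrangementCell hwm.2).subset

/-- The polyhedral complex of an arrangement of integral affine hyperplanes. -/
def arrangement (A : Finset ((V →ₗ[ℝ] ℝ) × ℝ)) (hA : ∀ a ∈ A, IsIntegral Λ a.1) :
    PolyComplex Λ where
  cells := Set.range (arrangementCell A)
  finite := finite_arrangementCell A
  nonempty := by
    rintro _ ⟨x, rfl⟩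
    exact ⟨x, mem_arrangementCell_self⟩
  polyhedral := by
    rintro _ ⟨x, rfl⟩
    exact isRationalPolyhedron_arrangementCell hA x
  face_mem := by
    rintro _ ⟨x, rfl⟩ F hF
    obtain ⟨w, rfl⟩ := exists_eq_arrangementCell hF
    exact ⟨w, rfl⟩
  inter_face := by
    rintro _ ⟨x, rfl⟩ _ ⟨x', rfl⟩ hne
    obtain ⟨w, hw, h⟩ := arrangementCell_inter hne hA
    rw [h]
    exact isFace_arrangementCell hw

/-- Cells of `Z` meeting `P` in a relative interior point are contained in `P`. -/
def PolyComplex.Refines (Z : PolyComplex Λ) (P : Set V) : Prop :=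
  ∀ ζ ∈ Z.cells, ∀ ω ∈ intrinsicInterior ℝ ζ, ω ∈ P → ζ ⊆ P

/-- Finitely many polyhedra are refined by a complete complex. -/
lemma exists_refining_complex (S : Set (Set V)) (hS : S.Finite)
    (hP : ∀ P ∈ S, IsRationalPolyhedron Λ P) :
    ∃ Z : PolyComplex Λ, Z.IsComplete ∧ ∀ P ∈ S, Z.Refines P := by
  classical
  choose! s hs hsP using hP
  have hA : ∀ a ∈ hS.toFinset.biUnion s, IsIntegral Λ a.1 := by
    intro a ha
    obtain ⟨P, hP, haP⟩ := Finset.mem_biUnion.1 ha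
    exact hs P (hS.mem_toFinset.1 hP) a haP
  refine ⟨arrangement _ hA, fun x => ⟨_, ⟨x, rfl⟩, mem_arrangementCell_self⟩, ?_⟩
  rintro P hP _ ⟨x, rfl⟩ ω hω hωP y hy
  rw [hsP P hP] at hωP ⊢
  exact fun p hp => (le_of_relint_arrangementCell hω
    (Finset.mem_biUnion.2 ⟨P, hS.mem_toFinset.2 hP, hp⟩) hy).1 (hωP p hp)

end Arrangement

/-! ### Degrees and supports depend only on the cycle -/

section Cycle

variable {V : Type*} [NormedAddCommGroup V] [NormedSpace ℝ V] [FiniteDimensional ℝ V]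
  {Λ : AddSubgroup V} {ι : Type*} [Fintype ι]

-- Finitely many cells cover the points `ω + t p` as `t → 0+`, so one of them is met for arbitrarily
-- small `t`; being convex, it contains an initial piece of the ray.
omit [FiniteDimensional ℝ V] in
lemma PolyComplex.IsComplete.exists_mem_link {C : PolyComplex Λ} (hC : C.IsComplete) (ω p : V) :
    ∃ ζ ∈ C.cells, p ∈ link ω ζ := by
  have hex : ∃ ζ ∈ C.cells, ∃ᶠ t : ℝ in nhdsWithin 0 (Set.Ioi 0), ω + t • p ∈ ζ := by
    by_contra hcon
    push Not at hcon
    have h1 : ∀ᶠ t : ℝ in nhdsWithin 0 (Set.Ioi 0), ∀ ζ ∈ C.finite.toFinset, ω + t • p ∉ ζ := by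
      rw [Filter.eventually_all_finset]
      exact fun ζ hζ => hcon ζ (C.finite.mem_toFinset.1 hζ)
    obtain ⟨t, ht⟩ := h1.exists
    obtain ⟨ζ, hζ, hmem⟩ := hC (ω + t • p)
    exact ht ζ (C.finite.mem_toFinset.2 hζ) hmem
  obtain ⟨ζ, hζ, hfr⟩ := hex
  obtain ⟨t₀, ht₀, ht₀'⟩ := (hfr.and_eventually self_mem_nhdsWithin).exists
  refine ⟨ζ, hζ, t₀, ht₀', fun ε h0 h1 => ?_⟩
  obtain ⟨t₁, ht₁, ht₁'⟩ := (hfr.and_eventually (Ioo_mem_nhdsGT h0)).exists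
  have hne : t₀ - t₁ ≠ 0 := by linarith [ht₁'.2]
  have hconv := (C.polyhedral ζ hζ).convex ht₁ ht₀
    (show 0 ≤ (t₀ - ε) / (t₀ - t₁) from div_nonneg (by linarith) (by linarith [ht₁'.2]))
    (show 0 ≤ (ε - t₁) / (t₀ - t₁) from div_nonneg (by linarith [ht₁'.2]) (by linarith [ht₁'.2]))
    (by field_simp; ring)
  convert hconv using 1
  rw [smul_add, smul_add, smul_smul, smul_smul, add_add_add_comm, ← add_smul, ← add_smul,
    ← add_div, div_mul_eq_mul_div, div_mul_eq_mul_div, ← add_div]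
  have e1 : (t₀ - ε + (ε - t₁)) / (t₀ - t₁) = 1 := by field_simp; ring
  have e2 : ((t₀ - ε) * t₁ + (ε - t₁) * t₀) / (t₀ - t₁) = ε := by field_simp; ring
  rw [e1, e2, one_smul]

omit [FiniteDimensional ℝ V] in
lemma PolyComplex.mem_inter_cells {X Z : PolyComplex Λ} {σ ζ : Set V} (hσ : σ ∈ X.cells)
    (hζ : ζ ∈ Z.cells) (h : (σ ∩ ζ).Nonempty) : σ ∩ ζ ∈ (X.inter Z).cells :=
  ⟨h, σ, hσ, ζ, hζ, rfl⟩

omit [FiniteDimensional ℝ V] in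
lemma dim_mono [FiniteDimensional ℝ V] {P Q : Set V} (h : P ⊆ Q) : dim P ≤ dim Q := by
  unfold dim
  exact_mod_cast Submodule.finrank_mono (vectorSpan_mono ℝ h)

lemma vectorSpan_eq_of_dim {P Q : Set V} (h : P ⊆ Q) (hd : dim P = dim Q) :
    vectorSpan ℝ P = vectorSpan ℝ Q :=
  Submodule.eq_of_le_of_finrank_eq (vectorSpan_mono ℝ h) (by unfold dim at hd; exact_mod_cast hd)

omit [Fintype ι] in
lemma mapIndex_eq_of_dim {P R : Set V} (h : P ⊆ R) (hd : dim P = dim R) (Q : V →ₗ[ℝ] (ι → ℝ)) :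
    mapIndex Λ Q P = mapIndex Λ Q R := by
  rw [mapIndex, mapIndex, latticeOf, latticeOf, vectorSpan_eq_of_dim h hd]

/-- A point of a polyhedron in general position with respect to finitely many subspaces. -/
lemma exists_generic_sub {P : Set V} (hP : IsRationalPolyhedron Λ P) (hne : P.Nonempty) (ω : V)
    (S : Set (Submodule ℝ V)) (hS : S.Finite) (hnot : ∀ F ∈ S, ¬ vectorSpan ℝ P ≤ F) :
    ∃ y ∈ P, ∀ F ∈ S, y - ω ∉ F := by
  obtain ⟨y, hy⟩ := relint_nonempty hP hne
  obtain ⟨e, he⟩ := (isOpen_dense_compl_submodules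
    ((fun F => F.comap (vectorSpan ℝ P).subtype) '' S) (hS.image _) (by
      rintro _ ⟨F, hF, rfl⟩ htop
      refine hnot F hF fun x hx => ?_
      have : (⟨x, hx⟩ : vectorSpan ℝ P) ∈ F.comap (vectorSpan ℝ P).subtype := by
        simp only at htop
        rw [htop]
        trivial
      exact this)).2.nonempty
  have heF : ∀ F ∈ S, (e : V) ∉ F := fun F hF h => he _ ⟨F, hF, rfl⟩ h
  have hlink : (e : V) ∈ link y P := by
    rw [link_of_relint hP hy]
    exact e.2
  obtain ⟨δ, hδ, h⟩ := hlink
  have hfin : (⋃ F ∈ S, {t : ℝ | y + t • (e : V) - ω ∈ F}).Finite := by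
    refine hS.biUnion fun F hF => Set.Subsingleton.finite fun t ht t' ht' => ?_
    by_contra hne'
    have h1 := F.sub_mem ht ht'
    have h2 : y + t • (e : V) - ω - (y + t' • (e : V) - ω) = (t - t') • (e : V) := by
      rw [sub_smul]; abel
    rw [h2] at h1
    exact heF F hF ((F.smul_mem_iff (sub_ne_zero.2 hne')).1 h1)
  obtain ⟨t, ht, ht'⟩ := (Set.Ioo_infinite hδ).exists_notMem_finite hfin
  refine ⟨_, h t ht.1 ht.2, fun F hF hmem => ht' ?_⟩
  exact Set.mem_biUnion hF hmem

/-- Every point of a facet lies in a full-dimensional cell of a refinement. -/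
lemma exists_mem_inter_full {X C : PolyComplex Λ} (hC : C.IsComplete) {σ : Set V}
    (hσ : σ ∈ X.cells) {ω : V} (hω : ω ∈ σ) :
    ∃ ζ ∈ C.cells, ω ∈ ζ ∧ dim (σ ∩ ζ) = dim σ := by
  -- A direction from `ω` into `σ` that avoids the spans of all refined cells of smaller dimension
  -- must be carried by a full-dimensional one.
  obtain ⟨y, hy, hyF⟩ := exists_generic_sub (X.polyhedral σ hσ) ⟨ω, hω⟩ ω
    ((fun κ => vectorSpan ℝ κ) '' {κ | κ ∈ (X.inter C).cells ∧ ¬ vectorSpan ℝ σ ≤ vectorSpan ℝ κ})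
    (((X.inter C).finite.subset fun κ h => h.1).image _) (by
      rintro _ ⟨κ, hκ, rfl⟩
      exact hκ.2)
  obtain ⟨ζ, hζ, hlink⟩ := hC.exists_mem_link ω (y - ω)
  have hωζ := mem_of_mem_link (C.polyhedral ζ hζ) hlink
  refine ⟨ζ, hζ, hωζ, ?_⟩
  have hle : vectorSpan ℝ σ ≤ vectorSpan ℝ (σ ∩ ζ) := by
    by_contra hnot
    refine hyF _ ⟨σ ∩ ζ, ⟨PolyComplex.mem_inter_cells hσ hζ ⟨ω, hω, hωζ⟩, hnot⟩, rfl⟩ ?_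
    refine mem_vectorSpan_of_mem_link (ω := ω) ?_
    rw [link_inter]
    exact ⟨sub_mem_link (X.polyhedral σ hσ) hω hy, hlink⟩
  refine le_antisymm (dim_mono Set.inter_subset_left) ?_
  unfold dim
  exact_mod_cast Submodule.finrank_mono hle

namespace WeightedComplex

omit [FiniteDimensional ℝ V] in
open Classical in
lemma refinedWeight_eq_sum (X : WeightedComplex Λ) (C : PolyComplex Λ) (γ : Set V) :
    X.refinedWeight C γ = ∑ σ ∈ X.facetFinset with
      (γ.Nonempty ∧ dim γ = X.d ∧ ∃ τ ∈ C.cells, γ = σ ∩ τ), X.weight σ := by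
  rw [refinedWeight, X.finsum_facets]
  congr!

/-- Facets of the refinement have the weight of the facet containing them. -/
lemma refinedWeight_inter (X : WeightedComplex Λ) {C : PolyComplex Λ} {σ ζ : Set V}
    (hσ : σ ∈ X.facets) (hζ : ζ ∈ C.cells) (hne : (σ ∩ ζ).Nonempty) (hd : dim (σ ∩ ζ) = X.d) :
    X.refinedWeight C (σ ∩ ζ) = X.weight σ := by
  classical
  rw [refinedWeight_eq_sum]
  refine (Finset.sum_eq_single_of_mem σ ?_ fun σ' hσ' hne' => absurd ?_ hne').trans rfl
  · simp only [Finset.mem_filter, mem_facetFinset]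
    exact ⟨hσ, hne, hd, ζ, hζ, rfl⟩
  · simp only [Finset.mem_filter, mem_facetFinset] at hσ'
    obtain ⟨hσ', -, -, τ, -, heq⟩ := hσ'
    have hsub : σ ∩ ζ ⊆ σ ∩ σ' := Set.subset_inter Set.inter_subset_left
      (heq ▸ Set.inter_subset_left)
    have hF := X.inter_face σ hσ.1 σ' hσ'.1 (hne.mono hsub)
    have hcell := X.face_mem σ hσ.1 _ hF
    have hle := hd ▸ dim_mono hsub
    have h1 := X.eq_of_dim_le hcell hσ.1 Set.inter_subset_left (by rw [hσ.2]; exact hle)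
    have h2 := X.eq_of_dim_le hcell hσ'.1 Set.inter_subset_right (by rw [hσ'.2]; exact hle)
    exact h2.symm.trans h1

omit [FiniteDimensional ℝ V] in
lemma exists_of_refinedWeight_ne_zero {X : WeightedComplex Λ} {C : PolyComplex Λ} {γ : Set V}
    (h : X.refinedWeight C γ ≠ 0) : ∃ σ ∈ X.facets, X.weight σ ≠ 0 ∧ γ.Nonempty ∧ dim γ = X.d ∧
      ∃ τ ∈ C.cells, γ = σ ∩ τ := by
  classical
  rw [refinedWeight_eq_sum] at h
  obtain ⟨σ, hσ, hne⟩ := Finset.exists_ne_zero_of_sum_ne_zero h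
  simp only [Finset.mem_filter, mem_facetFinset] at hσ
  exact ⟨σ, hσ.1, hne, hσ.2⟩

omit [FiniteDimensional ℝ V] in
lemma SameCycle.symm {X Y : WeightedComplex Λ} (h : X.SameCycle Y) : Y.SameCycle X := by
  obtain ⟨Z, hZ, h⟩ := h
  exact ⟨Z, hZ, fun γ => (h γ).symm⟩

lemma SameCycle.refl (X : WeightedComplex Λ) : X.SameCycle X := by
  obtain ⟨Z, hZ, -⟩ := exists_refining_complex (Λ := Λ) (∅ : Set (Set V)) Set.finite_empty
    (by simp)
  exact ⟨Z, hZ, fun _ => rfl⟩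

lemma SameCycle.support_subset {X Y : WeightedComplex Λ} (h : X.SameCycle Y) :
    X.support ⊆ Y.support := by
  rintro ω ⟨σ, hσ, hne, hω⟩
  obtain ⟨Z, hZ, h⟩ := h
  obtain ⟨ζ, hζ, hωζ, hd⟩ := exists_mem_inter_full hZ hσ.1 hω
  have h1 := X.refinedWeight_inter hσ hζ ⟨ω, hω, hωζ⟩ (hd.trans hσ.2)
  rw [h] at h1
  obtain ⟨σ', hσ', hne', -, -, τ, -, heq⟩ := exists_of_refinedWeight_ne_zero (h1 ▸ hne)
  have : ω ∈ σ' ∩ τ := heq ▸ ⟨hω, hωζ⟩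
  exact ⟨σ', hσ', hne', this.1⟩

lemma SameCycle.support_eq {X Y : WeightedComplex Λ} (h : X.SameCycle Y) :
    X.support = Y.support := h.support_subset.antisymm h.symm.support_subset

open Classical in
/-- The local degree computed on a refinement. -/
lemma localDegree_eq_refined (X : WeightedComplex Λ) {C : PolyComplex Λ} (hC : C.IsComplete)
    (Q : V →ₗ[ℝ] (ι → ℝ)) (ω : V) {w : ι → ℝ}
    (hw : (X.toPolyComplex.inter C).IsGenericFor Q w) (G : Finset (Set V))
    (hG : ∀ γ ∈ (X.toPolyComplex.inter C).cells, γ ∈ G) :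
    X.localDegree Q ω w = ∑ γ ∈ G with (w ∈ Q '' link ω γ ∧ dim γ = Fintype.card ι),
      X.refinedWeight C γ * mapIndex Λ Q γ := by
  by_cases hd : X.d = Fintype.card ι
  swap
  · rw [X.localDegree_eq_zero hd, Finset.sum_eq_zero]
    intro γ hγ
    have h0 : X.refinedWeight C γ = 0 := by
      by_contra hne
      obtain ⟨-, -, -, -, h, -⟩ := exists_of_refinedWeight_ne_zero hne
      exact hd (h.symm.trans (Finset.mem_filter.1 hγ).2.2)
    rw [h0, zero_mul]
  rw [X.localDegree_eq_sum hd]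
  have hsum : ∀ γ ∈ G.filter (fun γ => w ∈ Q '' link ω γ ∧ dim γ = Fintype.card ι),
      X.refinedWeight C γ * mapIndex Λ Q γ = ∑ σ ∈ X.facetFinset with
        (γ.Nonempty ∧ dim γ = X.d ∧ ∃ τ ∈ C.cells, γ = σ ∩ τ),
        X.weight σ * mapIndex Λ Q σ := by
    intro γ _
    rw [refinedWeight_eq_sum, Finset.sum_mul]
    refine Finset.sum_congr rfl fun σ hσ => ?_
    simp only [Finset.mem_filter, mem_facetFinset] at hσ
    obtain ⟨hσ, -, hdγ, τ, -, heq⟩ := hσ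
    rw [mapIndex_eq_of_dim (heq ▸ Set.inter_subset_left) (hdγ.trans hσ.2.symm)]
  rw [Finset.sum_congr rfl hsum, Finset.sum_comm' (t' := X.facetFinset)
    (s' := fun σ => G.filter fun γ => (w ∈ Q '' link ω γ ∧ dim γ = Fintype.card ι) ∧
      (γ.Nonempty ∧ dim γ = X.d ∧ ∃ τ ∈ C.cells, γ = σ ∩ τ))]
  swap
  · intro γ σ
    simp only [Finset.mem_filter]
    tauto
  refine Finset.sum_congr rfl fun σ hσ => ?_
  rw [mem_facetFinset] at hσ
  split_ifs with hwσ
  · obtain ⟨p, hp, hpw⟩ := hwσ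
    have hωσ := mem_of_mem_link (X.polyhedral σ hσ.1) hp
    obtain ⟨ζ, hζ, hpζ⟩ := hC.exists_mem_link ω p
    have hωζ := mem_of_mem_link (C.polyhedral ζ hζ) hpζ
    have hcell := PolyComplex.mem_inter_cells hσ.1 hζ ⟨ω, hωσ, hωζ⟩
    -- As `w` is generic for the refinement, every refined cell whose link contains `p` maps onto
    -- the target and has full dimension. Hence `p` belongs to exactly one refined piece of `σ`, and
    -- `σ` is counted once.
    have htop : ∀ κ ∈ (X.toPolyComplex.inter C).cells, p ∈ link ω κ →
        (vectorSpan ℝ κ).map Q = ⊤ := fun κ hκ hpκ => by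
      by_contra hne
      exact hw κ hκ hne ⟨p, mem_vectorSpan_of_mem_link hpκ, hpw⟩
    have hfull : ∀ κ ∈ (X.toPolyComplex.inter C).cells, p ∈ link ω κ → X.d ≤ dim κ := by
      intro κ hκ hpκ
      have h1 := Submodule.finrank_map_le Q (vectorSpan ℝ κ)
      rw [htop κ hκ hpκ, finrank_top, Module.finrank_fintype_fun_eq_card] at h1
      rw [hd]
      unfold dim
      exact_mod_cast h1
    have hplink : p ∈ link ω (σ ∩ ζ) := by
      rw [link_inter]
      exact ⟨hp, hpζ⟩
    have hdim : dim (σ ∩ ζ) = X.d :=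
      le_antisymm ((dim_mono Set.inter_subset_left).trans hσ.2.le) (hfull _ hcell hplink)
    obtain ⟨g, -, -, hg⟩ := exists_section (hσ.2.trans hd) (Q := Q) (by
      refine top_le_iff.1 ?_
      rw [← htop _ hcell hplink]
      exact Submodule.map_mono (vectorSpan_mono ℝ Set.inter_subset_left))
    have hfilter : (G.filter fun γ => (w ∈ Q '' link ω γ ∧ dim γ = Fintype.card ι) ∧
        (γ.Nonempty ∧ dim γ = X.d ∧ ∃ τ ∈ C.cells, γ = σ ∩ τ)) = {σ ∩ ζ} := by
      ext γ
      simp only [Finset.mem_filter, Finset.mem_singleton]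
      constructor
      · rintro ⟨-, ⟨⟨p', hp', hpw'⟩, -⟩, hne, hdγ, τ, hτ, rfl⟩
        have hpp : p' = p := by
          have h1 := hg p' (mem_vectorSpan_of_mem_link (link_mono Set.inter_subset_left hp'))
          rw [hpw', ← hpw, hg p (mem_vectorSpan_of_mem_link hp)] at h1
          exact h1.symm
        subst hpp
        have hcell' := PolyComplex.mem_inter_cells hσ.1 hτ hne
        have hlk : p' ∈ link ω ((σ ∩ τ) ∩ (σ ∩ ζ)) := by
          rw [link_inter]
          exact ⟨hp', hplink⟩
        have hF := (X.toPolyComplex.inter C).inter_face _ hcell' _ hcell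
          ⟨ω, mem_of_mem_link ((X.toPolyComplex.inter C).polyhedral _ hcell') hp', hωσ, hωζ⟩
        have hFc := (X.toPolyComplex.inter C).face_mem _ hcell' _ hF
        have hFd := hfull _ hFc hlk
        have e1 := (X.toPolyComplex.inter C).eq_of_dim_le hFc hcell' Set.inter_subset_left
          (by rw [hdγ]; exact hFd)
        have e2 := (X.toPolyComplex.inter C).eq_of_dim_le hFc hcell Set.inter_subset_right
          (by rw [hdim]; exact hFd)
        exact e1.symm.trans e2
      · rintro rfl
        exact ⟨hG _ hcell, ⟨⟨p, hplink, hpw⟩, hdim.trans hd⟩, ⟨ω, hωσ, hωζ⟩, hdim, ζ, hζ, rfl⟩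
    rw [hfilter, Finset.sum_singleton]
  · refine (Finset.sum_eq_zero fun γ hγ => absurd ?_ hwσ).symm
    simp only [Finset.mem_filter] at hγ
    obtain ⟨-, ⟨⟨p, hp, hpw⟩, -⟩, -, -, τ, -, rfl⟩ := hγ
    exact ⟨p, link_mono Set.inter_subset_left hp, hpw⟩

/-- The same cycle has the same local degrees. -/
lemma SameCycle.localDegree_eq {X Y : WeightedComplex Λ} (h : X.SameCycle Y)
    (Q : V →ₗ[ℝ] (ι → ℝ)) (ω : V) : ∃ U : Set (ι → ℝ), IsOpen U ∧ Dense U ∧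
      ∀ w ∈ U, X.localDegree Q ω w = Y.localDegree Q ω w := by
  classical
  obtain ⟨Z, hZ, h⟩ := h
  obtain ⟨o1, d1⟩ := (X.toPolyComplex.inter Z).isOpen_dense_isGenericFor Q
  obtain ⟨o2, d2⟩ := (Y.toPolyComplex.inter Z).isOpen_dense_isGenericFor Q
  refine ⟨_, o1.inter o2, d1.inter_of_isOpen_left d2 o1, fun w hw => ?_⟩
  let G := (X.toPolyComplex.inter Z).finite.toFinset ∪ (Y.toPolyComplex.inter Z).finite.toFinset
  rw [X.localDegree_eq_refined hZ Q ω hw.1 G fun γ hγ => Finset.mem_union_left _ (by simpa),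
    Y.localDegree_eq_refined hZ Q ω hw.2 G fun γ hγ => Finset.mem_union_right _ (by simpa)]
  simp only [h]

end WeightedComplex

lemma IsGenericValue.congr {E : Type*} [NormedAddCommGroup E] [NormedSpace ℝ E] {f g : E → ℚ}
    {m : ℚ} (hf : IsGenericValue f m)
    (h : ∃ U : Set E, IsOpen U ∧ Dense U ∧ ∀ w ∈ U, f w = g w) : IsGenericValue g m := by
  obtain ⟨U, o, d, hU⟩ := hf
  obtain ⟨U', o', d', hU'⟩ := h
  exact ⟨U ∩ U', o.inter o', d.inter_of_isOpen_left d' o, fun w hw =>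
    (hU' w hw.2).symm.trans (hU w hw.1)⟩

lemma IsGenericValue.unique {E : Type*} [NormedAddCommGroup E] [NormedSpace ℝ E] {f : E → ℚ}
    {m m' : ℚ} (hf : IsGenericValue f m) (hf' : IsGenericValue f m') : m = m' := by
  obtain ⟨U, o, d, hU⟩ := hf
  obtain ⟨U', o', d', hU'⟩ := hf'
  obtain ⟨w, hw⟩ := (d.inter_of_isOpen_left d' o).nonempty
  exact (hU w hw.1).symm.trans (hU' w hw.2)

lemma WeightedComplex.SameCycle.isGenericValue {X Y : WeightedComplex Λ} (h : X.SameCycle Y)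
    {Q : V →ₗ[ℝ] (ι → ℝ)} {ω : V} {m : ℚ} (hX : IsGenericValue (X.localDegree Q ω) m) :
    IsGenericValue (Y.localDegree Q ω) m :=
  hX.congr (h.localDegree_eq Q ω)

end Cycle

/-! ### Local degrees determine the cycle -/

section Criterion

variable {V : Type*} [NormedAddCommGroup V] [NormedSpace ℝ V] [FiniteDimensional ℝ V]
  {Λ : AddSubgroup V} {ι : Type*} [Fintype ι]

namespace WeightedComplex

/-- At a relative interior point of a cell `γ` of a refinement, local degrees with respect to
coordinates on `γ` compute the multiplicity of `γ`. -/
lemma localDegree_of_relint (X : WeightedComplex Λ) {C : PolyComplex Λ}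
    (hC : ∀ σ ∈ X.cells, C.Refines σ) {γ : Set V} (hγ : γ ∈ C.cells) {ω : V}
    (hω : ω ∈ intrinsicInterior ℝ γ) {Q : V →ₗ[ℝ] (ι → ℝ)} (hd : dim γ = Fintype.card ι)
    (htop : (vectorSpan ℝ γ).map Q = ⊤) (w : ι → ℝ) :
    X.localDegree Q ω w = X.refinedWeight C γ * mapIndex Λ Q γ := by
  classical
  by_cases hX : X.d = Fintype.card ι
  swap
  · have h0 : X.refinedWeight C γ = 0 := by
      by_contra hne
      obtain ⟨-, -, -, -, h, -⟩ := exists_of_refinedWeight_ne_zero hne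
      exact hX (h.symm.trans hd)
    rw [X.localDegree_eq_zero hX, h0, zero_mul]
  rw [X.localDegree_eq_sum hX, refinedWeight_eq_sum, Finset.sum_mul, Finset.sum_filter]
  refine Finset.sum_congr rfl fun σ hσ => ?_
  rw [mem_facetFinset] at hσ
  have hiff : w ∈ Q '' link ω σ ↔ γ.Nonempty ∧ dim γ = X.d ∧ ∃ τ ∈ C.cells, γ = σ ∩ τ := by
    constructor
    · rintro ⟨p, hp, -⟩
      exact ⟨C.nonempty γ hγ, hd.trans hX.symm, γ, hγ, (Set.inter_eq_right.2
        (hC σ hσ.1 γ hγ ω hω (mem_of_mem_link (X.polyhedral σ hσ.1) hp))).symm⟩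
    · rintro ⟨-, -, τ, -, h⟩
      have hw : w ∈ (vectorSpan ℝ γ).map Q := htop ▸ Submodule.mem_top
      obtain ⟨p, hp, rfl⟩ := hw
      refine ⟨p, link_mono (h ▸ Set.inter_subset_left) ?_, rfl⟩
      rw [link_of_relint (C.polyhedral γ hγ) hω]
      exact hp
  by_cases h : w ∈ Q '' link ω σ
  · rw [if_pos h, if_pos (hiff.1 h)]
    obtain ⟨-, -, τ, -, h⟩ := hiff.1 h
    have hsub : γ ⊆ σ := by
      rw [h]
      exact Set.inter_subset_left
    rw [mapIndex_eq_of_dim hsub (by rw [hσ.2, hX, hd])]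
  · rw [if_neg h, if_neg (mt hiff.2 h)]

/-- When `C` refines the cells of `X`, an intersection `σ ∩ ζ` is itself a cell of `C`: it is the
cell carrying one of its own relative interior points. -/
lemma refinedWeight_eq_zero_of_notMem (X : WeightedComplex Λ) {C : PolyComplex Λ}
    (hC : ∀ σ ∈ X.cells, C.Refines σ) {γ : Set V} (hγ : γ ∉ C.cells) :
    X.refinedWeight C γ = 0 := by
  by_contra hne
  obtain ⟨σ, hσ, -, hne, -, ζ, hζ, rfl⟩ := exists_of_refinedWeight_ne_zero hne
  have hP := (X.polyhedral σ hσ.1).inter (C.polyhedral ζ hζ)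
  obtain ⟨ω, hω⟩ := relint_nonempty hP hne
  have hω' := intrinsicInterior_subset hω
  obtain ⟨κ, hκ, hκζ, hωκ⟩ := C.exists_relint hζ hω'.2
  have hsub : κ ⊆ σ ∩ ζ := Set.subset_inter (hC σ hσ.1 κ hκ ω hωκ hω'.1) hκζ
  refine hγ ((?_ : κ = σ ∩ ζ) ▸ hκ)
  refine hsub.antisymm fun y hy => ?_
  have hlink : y - ω ∈ link ω (σ ∩ ζ) := sub_mem_link hP hω' hy
  rw [link_of_relint hP hω] at hlink
  have hneg : ω - y ∈ link ω (σ ∩ ζ) := by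
    rw [link_of_relint hP hω, ← neg_sub]
    exact Submodule.neg_mem _ hlink
  obtain ⟨δ, hδ, h⟩ := hneg
  have h2 := h (δ / 2) (by positivity) (by linarith)
  have := (C.isFace_of_subset hκ hζ hκζ).mem_of_add_smul_mem (x := ω) (v := y - ω) one_pos
    (half_pos hδ) (intrinsicInterior_subset hωκ) (by simpa using hy.2)
    (by rw [sub_eq_add_neg, ← smul_neg, neg_sub]; exact h2.2)
  simpa using this

/-- Cycles with the same local degrees are the same. -/
lemma sameCycle_of_localDegree [IsLattice Λ] {X Y : WeightedComplex Λ} {C : PolyComplex Λ}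
    (hcomp : C.IsComplete) (hX : ∀ σ ∈ X.cells, C.Refines σ) (hY : ∀ σ ∈ Y.cells, C.Refines σ)
    (h : ∀ γ ∈ C.cells, ∀ ω ∈ intrinsicInterior ℝ γ, ∀ (r : ℕ) (Q : V →ₗ[ℝ] (Fin r → ℝ)),
      IsIntegralMap Λ Q → dim γ = r → (vectorSpan ℝ γ).map Q = ⊤ →
        ∃ w, X.localDegree Q ω w = Y.localDegree Q ω w) : X.SameCycle Y := by
  refine ⟨C, hcomp, fun γ => ?_⟩
  by_cases hγ : γ ∈ C.cells
  swap
  · rw [X.refinedWeight_eq_zero_of_notMem hX hγ,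
      Y.refinedWeight_eq_zero_of_notMem hY hγ]
  obtain ⟨ω, hω⟩ := relint_nonempty (C.polyhedral γ hγ) (C.nonempty γ hγ)
  obtain ⟨Q, hQ, htop⟩ := exists_integralMap Λ (vectorSpan ℝ γ)
  obtain ⟨w, hw⟩ := h γ hγ ω hω _ Q hQ rfl htop
  have hd : dim γ = Fintype.card (Fin (Module.finrank ℝ (vectorSpan ℝ γ))) := by
    simp [dim]
  rw [X.localDegree_of_relint hX hγ hω hd htop, Y.localDegree_of_relint hY hγ hω hd htop] at hw
  exact mul_right_cancel₀ (Nat.cast_ne_zero.2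
    (mapIndex_ne_zero (C.polyhedral γ hγ) (C.nonempty γ hγ) hQ htop)) hw

lemma exists_refining (X Y : WeightedComplex Λ) : ∃ C : PolyComplex Λ, C.IsComplete ∧
    (∀ σ ∈ X.cells, C.Refines σ) ∧ ∀ σ ∈ Y.cells, C.Refines σ := by
  obtain ⟨C, hC, h⟩ := exists_refining_complex (X.cells ∪ Y.cells) (X.finite.union Y.finite)
    (fun P hP => hP.elim (X.polyhedral P) (Y.polyhedral P))
  exact ⟨C, hC, fun σ hσ => h σ (Or.inl hσ), fun σ hσ => h σ (Or.inr hσ)⟩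

/-- Local degrees take the place of a refinement compatible with both given ones: those of `X`, `Y`
and of `Y`, `Z` agree on dense open sets, which intersect. -/
lemma SameCycle.trans [IsLattice Λ] {X Y Z : WeightedComplex Λ} (h₁ : X.SameCycle Y)
    (h₂ : Y.SameCycle Z) : X.SameCycle Z := by
  obtain ⟨C, hC, hX, hZ⟩ := X.exists_refining Z
  refine sameCycle_of_localDegree hC hX hZ fun γ _ ω _ r Q _ _ _ => ?_
  obtain ⟨U, hUo, hUd, hU⟩ := h₁.localDegree_eq Q ω
  obtain ⟨U', -, hUd', hU'⟩ := h₂.localDegree_eq Q ω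
  obtain ⟨w, hw⟩ := (hUd.inter_of_isOpen_left hUd' hUo).nonempty
  exact ⟨w, (hU w hw.1).trans (hU' w hw.2)⟩

/-- Balancing amounts to generic constancy of the local degrees, a property of the cycle alone. -/
lemma IsBalanced.of_sameCycle [IsLattice Λ] {X Y : WeightedComplex Λ} (hX : X.IsBalanced)
    (h : X.SameCycle Y) : Y.IsBalanced := by
  refine isBalanced_of_localDegree fun r Q hQ ω => ?_
  obtain ⟨m, hm⟩ := hX.exists_isGenericValue hQ ω
  exact ⟨m, h.isGenericValue hm⟩

/-- The weighted complex obtained by intersecting with a complete complex. -/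
noncomputable def refine (X : WeightedComplex Λ) (C : PolyComplex Λ) (hC : C.IsComplete) :
    WeightedComplex Λ where
  toPolyComplex := X.toPolyComplex.inter C
  d := X.d
  pure := by
    rintro γ ⟨hne, σ, hσ, τ, hτ, rfl⟩
    obtain ⟨σ', hσ', hsub, hd⟩ := X.pure σ hσ
    have hcell := PolyComplex.mem_inter_cells hσ hτ hne
    obtain ⟨ω, hω⟩ := relint_nonempty ((X.toPolyComplex.inter C).polyhedral _ hcell) hne
    obtain ⟨ζ, hζ, hωζ, hdim⟩ := exists_mem_inter_full hC hσ' (hsub (intrinsicInterior_subset hω).1)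
    have hcell' := PolyComplex.mem_inter_cells hσ' hζ
      ⟨ω, hsub (intrinsicInterior_subset hω).1, hωζ⟩
    exact ⟨σ' ∩ ζ, hcell', (X.toPolyComplex.inter C).subset_of_relint hcell hcell' hω
      ⟨hsub (intrinsicInterior_subset hω).1, hωζ⟩, hdim.trans hd⟩
  weight := X.refinedWeight C

/-- The same `C` serves as the common refinement, since intersecting with it a second time produces
no new facets. -/
lemma refine_sameCycle [IsLattice Λ] (X : WeightedComplex Λ) (C : PolyComplex Λ)
    (hC : C.IsComplete) : (X.refine C hC).SameCycle X := by
  classical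
  refine ⟨C, hC, fun γ => ?_⟩
  by_cases hγ : γ ∈ (X.refine C hC).facets
  · obtain ⟨⟨hne, σ, hσ, τ, hτ, rfl⟩, hd⟩ := hγ
    have h := (X.refine C hC).refinedWeight_inter (σ := σ ∩ τ) (ζ := τ)
      ⟨PolyComplex.mem_inter_cells hσ hτ hne, hd⟩ hτ (by rwa [Set.inter_assoc, Set.inter_self])
      (by rwa [Set.inter_assoc, Set.inter_self])
    rw [Set.inter_assoc, Set.inter_self] at h
    exact h
  · have h1 : X.refinedWeight C γ = 0 := by
      by_contra hne
      obtain ⟨σ, hσ, -, hne, hd, τ, hτ, rfl⟩ := exists_of_refinedWeight_ne_zero hne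
      exact hγ ⟨PolyComplex.mem_inter_cells hσ.1 hτ hne, hd⟩
    rw [h1]
    by_contra hne
    obtain ⟨κ, ⟨⟨-, σ, hσ, ζ, hζ, rfl⟩, hκ⟩, -, hne, hd, τ, hτ, rfl⟩ :=
      exists_of_refinedWeight_ne_zero hne
    refine hγ ?_
    have hsub : σ ∩ ζ ∩ τ ⊆ σ ∩ ζ ∩ (ζ ∩ τ) := fun x hx => ⟨hx.1, hx.1.2, hx.2⟩
    have hF : σ ∩ ζ ∩ τ ∈ (X.toPolyComplex.inter C).cells := by
      refine ⟨hne, σ, hσ, ζ ∩ τ, ?_, Set.inter_assoc _ _ _⟩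
      have hne' : (ζ ∩ τ).Nonempty := hne.mono fun x hx => ⟨hx.1.2, hx.2⟩
      exact C.face_mem ζ hζ _ (C.inter_face ζ hζ τ hτ hne')
    exact ⟨hF, hd⟩

end WeightedComplex

end Criterion

/-! ### Products of lattices and of balanced complexes -/

section Product

variable {V W : Type*} [NormedAddCommGroup V] [NormedSpace ℝ V] [FiniteDimensional ℝ V]
  [NormedAddCommGroup W] [NormedSpace ℝ W] [FiniteDimensional ℝ W]
  {Λ : AddSubgroup V} {Λ' : AddSubgroup W}

instance [IsLattice Λ] [IsLattice Λ'] : IsLattice (Λ.prod Λ') where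
  span_eq_top := by
    refine top_le_iff.1 fun p _ => ?_
    have h1 : (⊤ : Submodule ℝ V) ≤ (Submodule.span ℝ ((Λ.prod Λ' : AddSubgroup (V × W)) :
        Set (V × W))).comap (LinearMap.inl ℝ V W) := by
      rw [← IsLattice.span_eq_top (Λ := Λ)]
      exact Submodule.span_le.2 fun u hu => Submodule.subset_span ⟨hu, Λ'.zero_mem⟩
    have h2 : (⊤ : Submodule ℝ W) ≤ (Submodule.span ℝ ((Λ.prod Λ' : AddSubgroup (V × W)) :
        Set (V × W))).comap (LinearMap.inr ℝ V W) := by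
      rw [← IsLattice.span_eq_top (Λ := Λ')]
      exact Submodule.span_le.2 fun u hu => Submodule.subset_span ⟨Λ.zero_mem, hu⟩
    have h3 : ((p.1, 0) : V × W) ∈ Submodule.span ℝ ((Λ.prod Λ' : AddSubgroup (V × W)) :
        Set (V × W)) := h1 (show p.1 ∈ (⊤ : Submodule ℝ V) from trivial)
    have h4 : ((0, p.2) : V × W) ∈ Submodule.span ℝ ((Λ.prod Λ' : AddSubgroup (V × W)) :
        Set (V × W)) := h2 (show p.2 ∈ (⊤ : Submodule ℝ W) from trivial)
    have := Submodule.add_mem _ h3 h4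
    rwa [Prod.mk_add_mk, add_zero, zero_add] at this
  eq_zero_of_forall u hu := by
    refine Prod.ext ?_ ?_
    · exact IsLattice.eq_zero_of_forall (Λ := Λ) u.1 fun l hl =>
        hu (l.comp (LinearMap.fst ℝ V W)) fun v hv => hl v.1 hv.1
    · exact IsLattice.eq_zero_of_forall (Λ := Λ') u.2 fun l hl =>
        hu (l.comp (LinearMap.snd ℝ V W)) fun v hv => hl v.2 hv.2

omit [FiniteDimensional ℝ V] in
lemma isIntegral_coord {n : ℕ} (b : Module.Basis (Fin n) ℝ V) (i : Fin n) :
    IsIntegral (latticeSpan b) (b.coord i) := by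
  intro u hu
  induction hu using AddSubgroup.closure_induction with
  | mem x hx =>
    obtain ⟨j, rfl⟩ := hx
    refine ⟨if j = i then 1 else 0, ?_⟩
    rw [Module.Basis.coord_apply, Module.Basis.repr_self, Finsupp.single_apply]
    split_ifs <;> simp
  | zero => exact ⟨0, by simp⟩
  | add x y _ _ hx hy =>
    obtain ⟨a, ha⟩ := hx
    obtain ⟨c, hc⟩ := hy
    exact ⟨a + c, by rw [map_add, ha, hc]; push_cast; rfl⟩
  | neg x _ hx =>
    obtain ⟨a, ha⟩ := hx
    exact ⟨-a, by rw [map_neg, ha]; push_cast; rfl⟩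

instance {n : ℕ} (b : Module.Basis (Fin n) ℝ V) : IsLattice (latticeSpan b) where
  span_eq_top := top_le_iff.1 (b.span_eq ▸ Submodule.span_mono AddSubgroup.subset_closure)
  eq_zero_of_forall u hu := b.ext_elem_iff.2 fun i => by
    have := hu _ (isIntegral_coord b i)
    simpa using this

omit [FiniteDimensional ℝ V] [FiniteDimensional ℝ W] in
lemma vectorSpan_prod {σ : Set V} {τ : Set W} (hσ : σ.Nonempty) (hτ : τ.Nonempty) :
    vectorSpan ℝ (σ ×ˢ τ) = (vectorSpan ℝ σ).prod (vectorSpan ℝ τ) := by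
  obtain ⟨x, hx⟩ := hσ
  obtain ⟨y, hy⟩ := hτ
  apply le_antisymm
  · refine Submodule.span_le.2 ?_
    rintro _ ⟨p, hp, q, hq, rfl⟩
    exact ⟨vsub_mem_vectorSpan ℝ hp.1 hq.1, vsub_mem_vectorSpan ℝ hp.2 hq.2⟩
  · have h1 : vectorSpan ℝ σ ≤ (vectorSpan ℝ (σ ×ˢ τ)).comap (LinearMap.inl ℝ V W) := by
      refine Submodule.span_le.2 ?_
      rintro _ ⟨p, hp, q, hq, rfl⟩
      have := vsub_mem_vectorSpan ℝ (show (p, y) ∈ σ ×ˢ τ from ⟨hp, hy⟩)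
        (show (q, y) ∈ σ ×ˢ τ from ⟨hq, hy⟩)
      simpa using this
    have h2 : vectorSpan ℝ τ ≤ (vectorSpan ℝ (σ ×ˢ τ)).comap (LinearMap.inr ℝ V W) := by
      refine Submodule.span_le.2 ?_
      rintro _ ⟨p, hp, q, hq, rfl⟩
      have := vsub_mem_vectorSpan ℝ (show (x, p) ∈ σ ×ˢ τ from ⟨hx, hp⟩)
        (show (x, q) ∈ σ ×ˢ τ from ⟨hx, hq⟩)
      simpa using this
    rintro ⟨u, v⟩ ⟨hu, hv⟩
    have h3 : ((u, 0) : V × W) ∈ vectorSpan ℝ (σ ×ˢ τ) := h1 hu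
    have h4 : ((0, v) : V × W) ∈ vectorSpan ℝ (σ ×ˢ τ) := h2 hv
    have := Submodule.add_mem _ h3 h4
    simpa using this

omit [FiniteDimensional ℝ V] [FiniteDimensional ℝ W] in
lemma latticeOf_prod {σ : Set V} {τ : Set W} (hσ : σ.Nonempty) (hτ : τ.Nonempty) :
    latticeOf (Λ.prod Λ') (σ ×ˢ τ) = (latticeOf Λ σ).prod (latticeOf Λ' τ) := by
  ext u
  rw [latticeOf, vectorSpan_prod hσ hτ]
  exact ⟨fun h => ⟨⟨h.1.1, h.2.1⟩, h.1.2, h.2.2⟩, fun h => ⟨⟨h.1.1, h.2.1⟩, h.1.2, h.2.2⟩⟩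

omit [FiniteDimensional ℝ V] [FiniteDimensional ℝ W] in
lemma link_prod {σ : Set V} {τ : Set W} (ω : V × W) :
    link ω (σ ×ˢ τ) = link ω.1 σ ×ˢ link ω.2 τ := by
  ext u
  constructor
  · rintro ⟨δ, hδ, h⟩
    exact ⟨⟨δ, hδ, fun ε h0 h1 => (h ε h0 h1).1⟩, δ, hδ, fun ε h0 h1 => (h ε h0 h1).2⟩
  · rintro ⟨⟨δ, hδ, h⟩, δ', hδ', h'⟩
    exact ⟨min δ δ', lt_min hδ hδ', fun ε h0 h1 =>
      ⟨h ε h0 (h1.trans_le (min_le_left _ _)), h' ε h0 (h1.trans_le (min_le_right _ _))⟩⟩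

/-- The face carrying `(x, y)` is a product of faces; each contains a relative interior point of its
factor and so is the whole factor. -/
lemma relint_prod {σ : Set V} {τ : Set W} (hσ : IsRationalPolyhedron Λ σ)
    (hτ : IsRationalPolyhedron Λ' τ) {x : V} {y : W} (hx : x ∈ intrinsicInterior ℝ σ)
    (hy : y ∈ intrinsicInterior ℝ τ) : (x, y) ∈ intrinsicInterior ℝ (σ ×ˢ τ) := by
  obtain ⟨F, hF, h⟩ := exists_face_relint (hσ.prod hτ) (ω := (x, y))
    ⟨intrinsicInterior_subset hx, intrinsicInterior_subset hy⟩
  obtain ⟨F₁, F₂, h₁, h₂, rfl⟩ := exists_of_isFace_prod hF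
  have h' := intrinsicInterior_subset h
  rwa [h₁.eq_of_relint hσ hx h'.1, h₂.eq_of_relint hτ hy h'.2] at h

open Classical in
/-- Balancing of `X` along `τ` carries over to a complex `Z` whose star at `κ` is modelled on that
of `τ`. -/
lemma WeightedComplex.IsBalanced.sum_mem_of_embedding [IsLattice Λ] [IsLattice Λ']
    {X : WeightedComplex Λ} {Z : WeightedComplex Λ'} (hX : X.IsBalanced) {τ : Set V} {κ : Set W}
    (hτ : τ ∈ X.cells) (hκ : κ ∈ Z.cells) (hdτ : dim τ = X.d - 1) (hdκ : dim κ = Z.d - 1)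
    (e : Set V → Set W) (he : Function.Injective e)
    (hsurj : ∀ ρ, ρ ∈ Z.facets ∧ κ ⊆ ρ ↔ ∃ σ ∈ X.facets, τ ⊆ σ ∧ e σ = ρ)
    (c : ℚ) (hc : ∀ σ ∈ X.facets, τ ⊆ σ → Z.weight (e σ) = X.weight σ * c) (j : V →ₗ[ℝ] W)
    (hj : vectorSpan ℝ τ ≤ (vectorSpan ℝ κ).comap j)
    (hn : ∀ σ ∈ X.facets, τ ⊆ σ → ∀ v, IsNormalVector Λ τ σ v → IsNormalVector Λ' κ (e σ) (j v)) :
    ∑ ρ ∈ Z.facetFinset with κ ⊆ ρ, (Z.weight ρ : ℝ) • normalVector Λ' κ ρ ∈ vectorSpan ℝ κ := by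
  have himg : Z.facetFinset.filter (fun ρ => κ ⊆ ρ) =
      (X.facetFinset.filter fun σ => τ ⊆ σ).image e := by
    ext ρ
    simp only [Finset.mem_filter, mem_facetFinset, Finset.mem_image, hsurj, and_assoc]
  rw [himg, Finset.sum_image he.injOn]
  have h0 := hj (Submodule.smul_mem _ (c : ℝ) ((isBalanced_iff X).1 hX τ hτ hdτ))
  rw [Submodule.mem_comap, map_smul, map_sum, Finset.smul_sum] at h0
  -- The transported normal vectors and the chosen ones of `Z` differ by vectors parallel to `κ`, so
  -- the choice does not affect the claim.
  rw [← sub_add_cancel (∑ σ ∈ X.facetFinset with τ ⊆ σ, _) (∑ σ ∈ X.facetFinset with τ ⊆ σ,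
    (c : ℝ) • j ((X.weight σ : ℝ) • normalVector Λ τ σ)), ← Finset.sum_sub_distrib]
  refine Submodule.add_mem _ (Submodule.sum_mem _ fun σ hσ => ?_) h0
  rw [Finset.mem_filter, mem_facetFinset] at hσ
  obtain ⟨hσ, hsub⟩ := hσ
  obtain ⟨hρ, hκρ⟩ := (hsurj (e σ)).2 ⟨σ, hσ, hsub, rfl⟩
  have h1 := isNormalVector_normalVector (X.polyhedral σ hσ.1) (X.polyhedral τ hτ)
    (X.isFace_of_subset hτ hσ.1 hsub) (by rw [hσ.2, hdτ]; ring)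
  have h2 := isNormalVector_normalVector (Z.polyhedral _ hρ.1) (Z.polyhedral κ hκ)
    (Z.isFace_of_subset hκ hρ.1 hκρ) (by rw [hρ.2, hdκ]; ring)
  have h3 := h2.sub_mem (Z.polyhedral _ hρ.1) (Z.polyhedral κ hκ)
    (Z.isFace_of_subset hκ hρ.1 hκρ) (by rw [hρ.2, hdκ]; ring) (hn σ hσ hsub _ h1)
  rw [hc σ hσ hsub, map_smul, smul_smul, mul_comm (c : ℝ)]
  push_cast
  rw [← smul_sub]
  exact Submodule.smul_mem _ _ h3

lemma WeightedComplex.dim_le (X : WeightedComplex Λ) {τ : Set V} (hτ : τ ∈ X.cells) :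
    dim τ ≤ X.d := by
  obtain ⟨σ, -, h, hd⟩ := X.pure τ hτ
  exact hd ▸ dim_mono h

lemma WeightedComplex.prod_weight (X : WeightedComplex Λ) (Y : WeightedComplex Λ') {σ : Set V}
    {τ : Set W} (hσ : σ.Nonempty) (hτ : τ.Nonempty) :
    (X.prod Y).weight (σ ×ˢ τ) = X.weight σ * Y.weight τ := by
  simp only [WeightedComplex.prod, Set.fst_image_prod _ hτ, Set.snd_image_prod hσ]

lemma WeightedComplex.mem_prod_facets {X : WeightedComplex Λ} {Y : WeightedComplex Λ'}
    {ρ : Set (V × W)} : ρ ∈ (X.prod Y).facets ↔ ∃ σ ∈ X.facets, ∃ τ ∈ Y.facets, ρ = σ ×ˢ τ := by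
  constructor
  · rintro ⟨⟨σ, hσ, τ, hτ, rfl⟩, hd⟩
    rw [dim_prod (X.nonempty σ hσ) (Y.nonempty τ hτ)] at hd
    have h1 := X.dim_le hσ
    have h2 := Y.dim_le hτ
    change _ = X.d + Y.d at hd
    exact ⟨σ, ⟨hσ, by omega⟩, τ, ⟨hτ, by omega⟩, rfl⟩
  · rintro ⟨σ, hσ, τ, hτ, rfl⟩
    exact ⟨⟨σ, hσ.1, τ, hτ.1, rfl⟩, by
      rw [dim_prod (X.nonempty σ hσ.1) (Y.nonempty τ hτ.1), hσ.2, hτ.2]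
      rfl⟩

lemma isNormalVector_prod_left {τ σ : Set V} {ζ : Set W} (hτ : IsRationalPolyhedron Λ τ)
    (hζ : IsRationalPolyhedron Λ' ζ) (hne : τ.Nonempty)
    (hζne : ζ.Nonempty) (hsub : τ ⊆ σ) {v : V} (hv : IsNormalVector Λ τ σ v) :
    IsNormalVector (Λ.prod Λ') (τ ×ˢ ζ) (σ ×ˢ ζ) (v, 0) := by
  obtain ⟨⟨x, hx, hxv⟩, hgen⟩ := hv
  obtain ⟨y, hy⟩ := relint_nonempty hζ hζne
  refine ⟨⟨(x, y), relint_prod hτ hζ hx hy, ?_⟩, ?_⟩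
  · rw [link_prod]
    exact ⟨hxv, zero_mem_link (intrinsicInterior_subset hy)⟩
  · rw [latticeOf_prod hne hζne, latticeOf_prod (hne.mono hsub) hζne, ← hgen]
    ext u
    simp only [AddSubgroup.mem_sup, AddSubgroup.mem_prod, AddSubgroup.mem_zmultiples_iff]
    constructor
    · rintro ⟨a, ha, _, ⟨k, rfl⟩, rfl⟩
      exact ⟨⟨a.1, ha.1, _, ⟨k, rfl⟩, rfl⟩, by simpa using ha.2⟩
    · rintro ⟨⟨a, ha, _, ⟨k, rfl⟩, h⟩, h2⟩
      exact ⟨(a, u.2), ⟨ha, h2⟩, _, ⟨k, rfl⟩, Prod.ext h (by simp)⟩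

lemma isNormalVector_prod_right {τ σ : Set W} {ζ : Set V} (hτ : IsRationalPolyhedron Λ' τ)
    (hζ : IsRationalPolyhedron Λ ζ) (hne : τ.Nonempty)
    (hζne : ζ.Nonempty) (hsub : τ ⊆ σ) {v : W} (hv : IsNormalVector Λ' τ σ v) :
    IsNormalVector (Λ.prod Λ') (ζ ×ˢ τ) (ζ ×ˢ σ) (0, v) := by
  obtain ⟨⟨x, hx, hxv⟩, hgen⟩ := hv
  obtain ⟨y, hy⟩ := relint_nonempty hζ hζne
  refine ⟨⟨(y, x), relint_prod hζ hτ hy hx, ?_⟩, ?_⟩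
  · rw [link_prod]
    exact ⟨zero_mem_link (intrinsicInterior_subset hy), hxv⟩
  · rw [latticeOf_prod hζne hne, latticeOf_prod hζne (hne.mono hsub), ← hgen]
    ext u
    simp only [AddSubgroup.mem_sup, AddSubgroup.mem_prod, AddSubgroup.mem_zmultiples_iff]
    constructor
    · rintro ⟨a, ha, _, ⟨k, rfl⟩, rfl⟩
      exact ⟨by simpa using ha.1, ⟨a.2, ha.2, _, ⟨k, rfl⟩, rfl⟩⟩
    · rintro ⟨h2, ⟨a, ha, _, ⟨k, rfl⟩, h⟩⟩
      exact ⟨(u.1, a), ⟨h2, ha⟩, _, ⟨k, rfl⟩, Prod.ext (by simp) h⟩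

/-- A codimension one cell of the product is a codimension one cell of one factor times a facet of
the other. Its star is the star in the first factor times that fixed facet, with all weights scaled
by the weight of the facet. -/
theorem WeightedComplex.IsBalanced.prod [IsLattice Λ] [IsLattice Λ'] {X : WeightedComplex Λ}
    {Y : WeightedComplex Λ'} (hX : X.IsBalanced) (hY : Y.IsBalanced) :
    (X.prod Y).IsBalanced := by
  rw [isBalanced_iff]
  rintro κ hκ hd
  obtain ⟨σ₀, hσ₀, τ₀, hτ₀, rfl⟩ := id hκ
  have hσne := X.nonempty σ₀ hσ₀
  have hτne := Y.nonempty τ₀ hτ₀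
  have hd' : dim σ₀ + dim τ₀ = X.d + Y.d - 1 := by
    rw [← dim_prod hσne hτne]
    exact hd
  have h1 := X.dim_le hσ₀
  have h2 := Y.dim_le hτ₀
  rcases (show dim σ₀ = X.d - 1 ∧ dim τ₀ = Y.d ∨ dim σ₀ = X.d ∧ dim τ₀ = Y.d - 1 by omega) with
    ⟨hσd, hτd⟩ | ⟨hσd, hτd⟩
  · refine hX.sum_mem_of_embedding hσ₀ hκ hσd hd (fun σ => σ ×ˢ τ₀)
      (fun a c h => by
        have := congrArg (Set.image Prod.fst) h
        simpa only [Set.fst_image_prod _ hτne] using this) ?_ (Y.weight τ₀) ?_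
      (LinearMap.inl ℝ V W) ?_ ?_
    · intro ρ
      constructor
      · rintro ⟨hρ, hsub⟩
        obtain ⟨σ, hσ, τ, hτ, rfl⟩ := mem_prod_facets.1 hρ
        rcases Set.prod_subset_prod_iff.1 hsub with h | h | h
        · refine ⟨σ, hσ, h.1, ?_⟩
          rw [Y.eq_of_dim_le hτ₀ hτ.1 h.2 (by rw [hτd, hτ.2])]
        · exact absurd h hσne.ne_empty
        · exact absurd h hτne.ne_empty
      · rintro ⟨σ, hσ, hsub, rfl⟩
        exact ⟨mem_prod_facets.2 ⟨σ, hσ, τ₀, ⟨hτ₀, hτd⟩, rfl⟩, Set.prod_mono hsub subset_rfl⟩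
    · exact fun σ hσ _ => X.prod_weight Y (X.nonempty σ hσ.1) hτne
    · intro u hu
      rw [Submodule.mem_comap, vectorSpan_prod hσne hτne]
      exact ⟨hu, Submodule.zero_mem _⟩
    · exact fun σ hσ hsub v hv => isNormalVector_prod_left (X.polyhedral _ hσ₀)
        (Y.polyhedral _ hτ₀) hσne hτne hsub hv
  · refine hY.sum_mem_of_embedding hτ₀ hκ hτd hd (fun τ => σ₀ ×ˢ τ)
      (fun a c h => by
        have := congrArg (Set.image Prod.snd) h
        simpa only [Set.snd_image_prod hσne] using this) ?_ (X.weight σ₀) ?_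
      (LinearMap.inr ℝ V W) ?_ ?_
    · intro ρ
      constructor
      · rintro ⟨hρ, hsub⟩
        obtain ⟨σ, hσ, τ, hτ, rfl⟩ := mem_prod_facets.1 hρ
        rcases Set.prod_subset_prod_iff.1 hsub with h | h | h
        · refine ⟨τ, hτ, h.2, ?_⟩
          rw [X.eq_of_dim_le hσ₀ hσ.1 h.1 (by rw [hσd, hσ.2])]
        · exact absurd h hσne.ne_empty
        · exact absurd h hτne.ne_empty
      · rintro ⟨τ, hτ, hsub, rfl⟩
        exact ⟨mem_prod_facets.2 ⟨σ₀, ⟨hσ₀, hσd⟩, τ, hτ, rfl⟩, Set.prod_mono subset_rfl hsub⟩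
    · exact fun τ hτ _ => (X.prod_weight Y hσne (Y.nonempty τ hτ.1)).trans (mul_comm _ _)
    · intro u hu
      rw [Submodule.mem_comap, vectorSpan_prod hσne hτne]
      exact ⟨Submodule.zero_mem _, hu⟩
    · exact fun τ hτ hsub v hv => isNormalVector_prod_right (Y.polyhedral _ hτ₀)
        (X.polyhedral _ hσ₀) hτne hσne hsub hv

end Product

/-! ### Divisors of `max(a, c)` and their local degrees -/

section Divisor

variable {V : Type*} [NormedAddCommGroup V] [NormedSpace ℝ V] {Λ : AddSubgroup V} {ι : Type*}

/-- The map with the additional coordinate `z`. -/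
def consMap (z : V →ₗ[ℝ] ℝ) (Q : V →ₗ[ℝ] (ι → ℝ)) : V →ₗ[ℝ] (Option ι → ℝ) :=
  LinearMap.pi fun o => o.elim z fun i => (LinearMap.proj i).comp Q

@[simp] lemma consMap_none (z : V →ₗ[ℝ] ℝ) (Q : V →ₗ[ℝ] (ι → ℝ)) (u : V) :
    consMap z Q u none = z u := rfl

lemma isIntegralMap_consMap {z : V →ₗ[ℝ] ℝ} {Q : V →ₗ[ℝ] (ι → ℝ)} (hz : IsIntegral Λ z)
    (hQ : IsIntegralMap Λ Q) : IsIntegralMap Λ (consMap z Q)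
  | u, hu, none => hz u hu
  | u, hu, some i => hQ u hu i

lemma consMap_eq_iff {z : V →ₗ[ℝ] ℝ} {Q : V →ₗ[ℝ] (ι → ℝ)} {u : V} {t : ℝ} {w : ι → ℝ} :
    consMap z Q u = (fun o => o.elim t w) ↔ z u = t ∧ Q u = w := by
  constructor
  · intro h
    exact ⟨congrFun h none, funext fun i => congrFun h (some i)⟩
  · rintro ⟨rfl, rfl⟩
    funext o
    cases o <;> rfl

/-- A maximum of two linear functions is affine on `σ` only if their difference has constant
sign on `σ`. -/
lemma IsLinearPart.sign {a c : V →ₗ[ℝ] ℝ} {σ : Set V} {l : V →ₗ[ℝ] ℝ} (hσ : Convex ℝ σ)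
    (h : IsLinearPart Λ (fun x => max (a x) (c x)) σ l) :
    (∀ x ∈ σ, 0 ≤ (a - c) x) ∨ ∀ x ∈ σ, (a - c) x ≤ 0 := by
  by_contra hcon
  push Not at hcon
  obtain ⟨⟨x, hx, hx0⟩, y, hy, hy0⟩ := hcon
  obtain ⟨⟨k, hk⟩, -⟩ := h
  simp only [LinearMap.sub_apply] at hx0 hy0
  have hxy : 0 < (a y - c y) - (a x - c x) := by linarith
  -- At the point of the segment where `a - c` vanishes, an affine interpolation of the maximum
  -- exceeds the maximum.
  set s := (a y - c y) / ((a y - c y) - (a x - c x)) with hs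
  have hs0 : 0 < s := div_pos hy0 hxy
  have hs1 : s < 1 := (div_lt_one hxy).2 (by linarith)
  have hmem := hσ hx hy hs0.le (by linarith : 0 ≤ 1 - s) (by ring)
  have h1 := hk _ hmem
  have h2 := hk x hx
  have h3 := hk y hy
  simp only [map_add, map_smul, smul_eq_mul] at h1
  beta_reduce at h2 h3
  rw [max_eq_right (by linarith)] at h2
  rw [max_eq_left (by linarith)] at h3
  have h4 : s * a x + (1 - s) * a y - (s * c x + (1 - s) * c y) = 0 := by
    have : s * ((a y - c y) - (a x - c x)) = a y - c y := div_mul_cancel₀ _ hxy.ne'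
    linear_combination -this
  rw [max_eq_left (by linarith)] at h1
  have h5 : s * a x + (1 - s) * a y = s * c x + (1 - s) * a y := by
    rw [h1]
    linear_combination -s * h2 - (1 - s) * h3
  have h6 : s * (a x - c x) = 0 := by linear_combination h5
  rcases mul_eq_zero.1 h6 with h | h <;> linarith

lemma IsLinearPart.eq_on_vectorSpan {φ : V → ℝ} {σ : Set V} {l a : V →ₗ[ℝ] ℝ}
    (h : IsLinearPart Λ φ σ l) (ha : ∀ x ∈ σ, φ x = a x) {u : V} (hu : u ∈ vectorSpan ℝ σ) :
    l u = a u := by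
  obtain ⟨⟨k, hk⟩, -⟩ := h
  have : vectorSpan ℝ σ ≤ LinearMap.ker (l - a) := by
    refine Submodule.span_le.2 ?_
    rintro _ ⟨x, hx, y, hy, rfl⟩
    have h1 := hk x hx
    have h2 := hk y hy
    rw [ha x hx] at h1
    rw [ha y hy] at h2
    simp only [vsub_eq_sub, SetLike.mem_coe, LinearMap.mem_ker, LinearMap.sub_apply, map_sub]
    linarith
  have := this hu
  rw [LinearMap.mem_ker, LinearMap.sub_apply, sub_eq_zero] at this
  exact this

lemma eq_zero_on_vectorSpan {σ : Set V} {z : V →ₗ[ℝ] ℝ} (h : ∀ x ∈ σ, z x = 0) {u : V}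
    (hu : u ∈ vectorSpan ℝ σ) : z u = 0 := by
  have : vectorSpan ℝ σ ≤ LinearMap.ker z := by
    refine Submodule.span_le.2 ?_
    rintro _ ⟨x, hx, y, hy, rfl⟩
    simp [h x hx, h y hy]
  exact this hu

variable [FiniteDimensional ℝ V]

/-- A linear function of constant sign on `σ` vanishing at a relative interior point vanishes. -/
lemma eq_zero_of_relint {σ : Set V} (hσ : IsRationalPolyhedron Λ σ) {z : V →ₗ[ℝ] ℝ}
    (h : (∀ x ∈ σ, 0 ≤ z x) ∨ ∀ x ∈ σ, z x ≤ 0) {ω : V} (hω : ω ∈ intrinsicInterior ℝ σ)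
    (h0 : z ω = 0) : ∀ x ∈ σ, z x = 0 := by
  intro x hx
  have hlink : ω - x ∈ link ω σ := by
    rw [link_of_relint hσ hω, ← neg_sub]
    refine Submodule.neg_mem _ (vsub_mem_vectorSpan ℝ hx (intrinsicInterior_subset hω))
  obtain ⟨δ, hδ, hδ'⟩ := hlink
  have h1 := hδ' (δ / 2) (by positivity) (by linarith)
  rcases h with h | h
  · have h2 := h _ h1
    have h3 := h x hx
    simp only [map_add, map_smul, map_sub, smul_eq_mul, h0] at h2
    nlinarith
  · have h2 := h _ h1
    have h3 := h x hx
    simp only [map_add, map_smul, map_sub, smul_eq_mul, h0] at h2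
    nlinarith

open Classical in
/-- The weights of the divisor of `max(a, c)`. -/
lemma divisor_weight [IsLattice Λ] {X : WeightedComplex Λ} (hX : X.IsBalanced)
    {a c : V →ₗ[ℝ] ℝ} {l : Set V → V →ₗ[ℝ] ℝ}
    (hl : ∀ σ ∈ X.cells, IsLinearPart Λ (fun x => max (a x) (c x)) σ (l σ)) {τ : Set V}
    (hτ : τ ∈ X.cells) (hd : dim τ = X.d - 1) :
    (∑ᶠ σ ∈ {σ | σ ∈ X.facets ∧ τ ⊆ σ}, l σ ((X.weight σ : ℝ) • normalVector Λ τ σ)) -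
        l τ (∑ᶠ σ ∈ {σ | σ ∈ X.facets ∧ τ ⊆ σ}, (X.weight σ : ℝ) • normalVector Λ τ σ) =
      if ∀ x ∈ τ, (a - c) x = 0 then ∑ σ ∈ X.facetFinset with τ ⊆ σ,
        (X.weight σ : ℝ) * max ((a - c) (normalVector Λ τ σ)) 0 else 0 := by
  rw [X.finsum_facets, X.finsum_facets]
  have hbal := X.isBalanced_iff.1 hX τ hτ hd
  have hnv : ∀ σ ∈ X.facets, τ ⊆ σ → IsNormalVector Λ τ σ (normalVector Λ τ σ) := fun σ hσ hsub =>
    isNormalVector_normalVector (X.polyhedral σ hσ.1) (X.polyhedral τ hτ)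
      (X.isFace_of_subset hτ hσ.1 hsub) (by rw [hσ.2, hd]; ring)
  have key : ∀ σ ∈ X.cells, ((∀ x ∈ σ, 0 ≤ (a - c) x) ∧ ∀ u ∈ vectorSpan ℝ σ, l σ u = a u) ∨
      ((∀ x ∈ σ, (a - c) x ≤ 0) ∧ ∀ u ∈ vectorSpan ℝ σ, l σ u = c u) := by
    intro σ hσ
    refine ((hl σ hσ).sign (X.polyhedral σ hσ).convex).imp (fun h => ⟨h, fun u hu => ?_⟩)
      fun h => ⟨h, fun u hu => ?_⟩
    · refine (hl σ hσ).eq_on_vectorSpan (fun x hx => max_eq_left ?_) hu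
      have := h x hx
      rw [LinearMap.sub_apply] at this
      linarith
    · refine (hl σ hσ).eq_on_vectorSpan (fun x hx => max_eq_right ?_) hu
      have := h x hx
      rw [LinearMap.sub_apply] at this
      linarith
  split_ifs with h0
  -- On `τ` both functions agree, so `c` is a linear part there. A facet then contributes its own
  -- linear part minus `c` at the normal vector: `a - c` or `0`, according to its side.
  · have hlτ : ∀ u ∈ vectorSpan ℝ τ, l τ u = c u := fun u hu =>
      (hl τ hτ).eq_on_vectorSpan (fun x hx => max_eq_right (by
        have := h0 x hx
        rw [LinearMap.sub_apply] at this
        linarith)) hu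
    rw [hlτ _ (by convert hbal), map_sum, ← Finset.sum_sub_distrib]
    refine Finset.sum_congr (by congr!) fun σ hσ => ?_
    rw [Finset.mem_filter, WeightedComplex.mem_facetFinset] at hσ
    have hv := hnv σ hσ.1 hσ.2
    obtain ⟨ω, hω, δ, hδ, hδ'⟩ := id hv.1
    have h1 := hδ' (δ / 2) (by positivity) (by linarith)
    have hz : (a - c) (ω + (δ / 2) • normalVector Λ τ σ) =
        δ / 2 * (a - c) (normalVector Λ τ σ) := by
      rw [map_add, h0 ω (intrinsicInterior_subset hω), zero_add, map_smul, smul_eq_mul]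
    rw [map_smul, map_smul, smul_eq_mul, smul_eq_mul, ← mul_sub]
    congr 1
    rcases key σ hσ.1.1 with ⟨hs, hl'⟩ | ⟨hs, hl'⟩
    · rw [hl' _ hv.mem.2, max_eq_left]
      · rfl
      · have := hs _ h1
        rw [hz] at this
        exact nonneg_of_mul_nonneg_right this (by positivity)
    · rw [hl' _ hv.mem.2, max_eq_right, sub_self]
      have := hs _ h1
      rw [hz] at this
      by_contra hcon
      push Not at hcon
      have := mul_pos (half_pos hδ) hcon
      linarith
  -- If `τ` leaves the hyperplane `a = c`, all cells containing it lie on one side. One functional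
  -- then serves as linear part on all of them and the two sums cancel, balancing placing the second
  -- argument in the span of `τ`.
  · have huni : ∃ g : V →ₗ[ℝ] ℝ, ∀ σ ∈ X.cells, τ ⊆ σ → ∀ u ∈ vectorSpan ℝ σ, l σ u = g u := by
      push Not at h0
      obtain ⟨x, hx, hx0⟩ := h0
      rcases lt_or_gt_of_ne hx0 with hneg | hpos
      · refine ⟨c, fun σ hσ hsub => ?_⟩
        rcases key σ hσ with ⟨hs, hl'⟩ | ⟨hs, hl'⟩
        · exact absurd (hs x (hsub hx)) (not_le.2 hneg)
        · exact hl'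
      · refine ⟨a, fun σ hσ hsub => ?_⟩
        rcases key σ hσ with ⟨hs, hl'⟩ | ⟨hs, hl'⟩
        · exact hl'
        · exact absurd (hs x (hsub hx)) (not_le.2 hpos)
    obtain ⟨g, hg⟩ := huni
    rw [hg τ hτ subset_rfl _ (by convert hbal), map_sum, sub_eq_zero]
    refine Finset.sum_congr rfl fun σ hσ => ?_
    rw [Finset.mem_filter, WeightedComplex.mem_facetFinset] at hσ
    exact hg σ hσ.1.1 hσ.2 _ (Submodule.smul_mem _ _ (hnv σ hσ.1 hσ.2).mem.2)

-- `N_σ` is `N_τ` plus the normal vector, and `z` vanishes on `N_τ`; so `z` contributes the factor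
-- `|z v|` and the remaining coordinates give the index of `τ`.
omit [FiniteDimensional ℝ V] in
lemma mapIndex_consMap [IsLattice Λ] {τ σ : Set V} {z : V →ₗ[ℝ] ℝ} (hz : IsIntegral Λ z)
    {Q : V →ₗ[ℝ] (ι → ℝ)} (hQ : IsIntegralMap Λ Q) (h0 : ∀ u ∈ vectorSpan ℝ τ, z u = 0) {v : V}
    (hv : IsNormalVector Λ τ σ v) (hv0 : z v ≠ 0) :
    (mapIndex Λ (consMap z Q) σ : ℝ) = |z v| * mapIndex Λ Q τ := by
  rw [mapIndex, hv.map_latticeOf, relIndex_intLattice_option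
    (map_latticeOf_le (isIntegralMap_consMap hz hQ) τ)]
  · rw [consMap_none, mapIndex, AddSubgroup.map_map]
    congr 3
  · rintro _ ⟨u, hu, rfl⟩
    exact h0 u hu.2
  · exact isIntegralMap_consMap hz hQ v hv.mem.1
  · exact hv0

/-- `D` is the codimension one skeleton of `X` with the weights of the divisor of `max(z, 0)`. -/
structure IsDivisorSkeleton (X : WeightedComplex Λ) (z : V →ₗ[ℝ] ℝ) (D : WeightedComplex Λ) :
    Prop where
  sign : ∀ σ ∈ X.cells, (∀ x ∈ σ, 0 ≤ z x) ∨ ∀ x ∈ σ, z x ≤ 0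
  d_eq : D.d = X.d - 1
  mem_facets : ∀ τ, τ ∈ D.facets ↔ τ ∈ X.cells ∧ dim τ = X.d - 1
  weight_eq_zero : ∀ τ ∈ D.facets, (∃ x ∈ τ, z x ≠ 0) → D.weight τ = 0
  weight_eq : ∀ τ ∈ D.facets, (∀ x ∈ τ, z x = 0) → (D.weight τ : ℝ) =
    ∑ᶠ σ ∈ {σ | σ ∈ X.facets ∧ τ ⊆ σ}, (X.weight σ : ℝ) * max (z (normalVector Λ τ σ)) 0

lemma IsDivisor.exists_skeleton [IsLattice Λ] {a c : V →ₗ[ℝ] ℝ} {X D : WeightedComplex Λ}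
    (h : IsDivisor (fun x => max (a x) (c x)) X D) : ∃ X' D' : WeightedComplex Λ,
      X'.IsBalanced ∧ X'.SameCycle X ∧ D'.SameCycle D ∧ IsDivisorSkeleton X' (a - c) D' := by
  classical
  obtain ⟨X', D', l, hX', hXX, hDD, hl, hd, hcells, hw⟩ := h
  have hmem : ∀ τ, τ ∈ D'.facets ↔ τ ∈ X'.cells ∧ dim τ = X'.d - 1 := by
    intro τ
    rw [WeightedComplex.facets, Set.mem_ofPred_eq, hcells, hd, Set.mem_ofPred_eq]
    exact ⟨fun h => ⟨h.1.1, h.2⟩, fun h => ⟨⟨h.1, τ, h.1, subset_rfl, h.2⟩, h.2⟩⟩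
  refine ⟨X', D', hX', hXX, hDD, ⟨fun σ hσ => (hl σ hσ).sign (X'.polyhedral σ hσ).convex, hd, hmem,
    fun τ hτ h0 => ?_, fun τ hτ h0 => ?_⟩⟩
  · have h1 := hw τ hτ
    rw [divisor_weight hX' hl ((hmem τ).1 hτ).1 ((hmem τ).1 hτ).2, if_neg (by push Not; exact h0)]
      at h1
    exact_mod_cast h1
  · rw [hw τ hτ, divisor_weight hX' hl ((hmem τ).1 hτ).1 ((hmem τ).1 hτ).2, if_pos h0,
      X'.finsum_facets]

namespace IsDivisorSkeleton

variable {X D : WeightedComplex Λ} {z : V →ₗ[ℝ] ℝ}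

omit [FiniteDimensional ℝ V] in
lemma support_subset (h : IsDivisorSkeleton X z D) : D.support ⊆ X.support ∩ {x | z x = 0} := by
  rintro x ⟨τ, hτ, hne, hx⟩
  have h0 : ∀ y ∈ τ, z y = 0 := by
    by_contra hcon
    push Not at hcon
    exact hne (h.weight_eq_zero τ hτ hcon)
  refine ⟨?_, h0 x hx⟩
  have h1 := h.weight_eq τ hτ h0
  by_contra hcon
  refine hne (Rat.cast_injective (α := ℝ) ?_)
  rw [h1, Rat.cast_zero]
  refine finsum_mem_eq_zero_of_forall_eq_zero fun σ hσ => ?_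
  have : X.weight σ = 0 := by
    by_contra hσ0
    exact hcon ⟨σ, hσ.1, hσ0, hσ.2 hx⟩
  rw [this, Rat.cast_zero, zero_mul]

variable [Fintype ι]

lemma localDegree_eq_zero (h : IsDivisorSkeleton X z D) {ω : V} (hω : z ω ≠ 0)
    (Q : V →ₗ[ℝ] (ι → ℝ)) (w : ι → ℝ) : D.localDegree Q ω w = 0 := by
  refine finsum_mem_eq_zero_of_forall_eq_zero fun τ hτ => ?_
  obtain ⟨hτ, -, p, hp, -⟩ := hτ
  rw [h.weight_eq_zero τ hτ ⟨ω, mem_of_mem_link (D.polyhedral τ hτ.1) hp, hω⟩, zero_mul]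

/-- The cells whose image under `(z, Q)` contains a generic point of `{z = 0}`. -/
lemma exists_carrier (h : IsDivisorSkeleton X z D) {ω : V} (hω : z ω = 0) {Q : V →ₗ[ℝ] (ι → ℝ)}
    {w : ι → ℝ} (hw : X.IsGenericFor Q w) {σ : Set V} (hσ : σ ∈ X.cells) {u : V}
    (hu : u ∈ link ω σ) (hz : z u = 0) (hQ : Q u = w) :
    ∃ κ ∈ X.cells, κ ⊆ σ ∧ (∀ x ∈ κ, z x = 0) ∧ u ∈ link ω κ ∧ (Fintype.card ι : ℤ) ≤ dim κ := by
  obtain ⟨κ, hκ, hsub, -, hlink, δ, hδ, hrel⟩ := X.exists_carrier hσ hu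
  refine ⟨κ, hκ, hsub, ?_, hlink, ?_⟩
  · refine eq_zero_of_relint (X.polyhedral κ hκ) (h.sign κ hκ)
      (hrel (δ / 2) (by positivity) (by linarith)) ?_
    simp [hω, hz]
  · have htop : (vectorSpan ℝ κ).map Q = ⊤ := by
      by_contra hne
      exact hw κ hκ hne ⟨u, mem_vectorSpan_of_mem_link hlink, hQ⟩
    have h1 := Submodule.finrank_map_le Q (vectorSpan ℝ κ)
    rw [htop, finrank_top, Module.finrank_fintype_fun_eq_card] at h1
    unfold dim
    exact_mod_cast h1

variable [IsLattice Λ]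

/-- The degree of `X` under `(z, Q)` is computed near `(0, w)` on the side `z > 0`. The facets met
there adjoin a wall `τ` in `{z = 0}` and have `z v > 0`; as their index is `z v` times that of `τ`,
the sum around `τ` is the weight of `τ` in the divisor times its index. -/
theorem isGenericValue (h : IsDivisorSkeleton X z D) (hz : IsIntegral Λ z)
    {Q : V →ₗ[ℝ] (ι → ℝ)} (hQ : IsIntegralMap Λ Q) {ω : V} (hω : z ω = 0) {m : ℚ}
    (hm : IsGenericValue (X.localDegree (consMap z Q) ω) m) :
    IsGenericValue (D.localDegree Q ω) m := by
  classical
  by_cases hd : X.d = Fintype.card (Option ι)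
  swap
  · have hm0 : m = 0 := by
      refine hm.unique ⟨Set.univ, isOpen_univ, dense_univ, fun w _ => ?_⟩
      exact X.localDegree_eq_zero hd _ _ _
    rw [hm0]
    refine ⟨Set.univ, isOpen_univ, dense_univ, fun w _ => D.localDegree_eq_zero ?_ _ _ _⟩
    rw [h.d_eq]
    rw [Fintype.card_option] at hd
    push_cast at hd
    omega
  have hdι : X.d = Fintype.card ι + 1 := by rw [hd, Fintype.card_option]; push_cast; rfl
  obtain ⟨hgo, hgd⟩ := X.isOpen_dense_isGenericFor Q
  refine ⟨_, hgo, hgd, fun w hw => ?_⟩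
  set w₀ : Option ι → ℝ := fun o => o.elim 0 w with hw₀
  have hmap : ∀ κ : Set V, w₀ ∈ (vectorSpan ℝ κ).map (consMap z Q) → w ∈ (vectorSpan ℝ κ).map Q := by
    rintro κ ⟨u, hu, huw⟩
    exact ⟨u, hu, (consMap_eq_iff.1 huw).2⟩
  have hpr : ∀ κ : Set V, ((vectorSpan ℝ κ).map (consMap z Q)).map
      (LinearMap.funLeft ℝ ℝ (some : ι → Option ι)) = (vectorSpan ℝ κ).map Q := by
    intro κ
    rw [← Submodule.map_comp]
    congr 1
  -- Over a generic `w` the face carrying a point above `(0, w)` lies in `{z = 0}` and has dimension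
  -- at least `|ι|`, which is the dimension of a wall; so it is the whole wall.
  have hzero : ∀ τ, X.IsWall (consMap z Q) ω w₀ τ → ∀ x ∈ τ, z x = 0 := by
    rintro τ ⟨hτ, hdτ, u, hu, huw⟩
    obtain ⟨hzu, hQu⟩ := consMap_eq_iff.1 huw
    obtain ⟨κ, hκ, hsub, hz0, -, hle⟩ := h.exists_carrier hω hw hτ hu hzu hQu
    have := X.eq_of_dim_le hκ hτ hsub (by
      rw [Fintype.card_option] at hdτ
      push_cast at hdτ
      omega)
    exact this ▸ hz0
  have hwall : ∀ τ, X.IsWall (consMap z Q) ω w₀ τ ↔ τ ∈ D.facets ∧ (∀ x ∈ τ, z x = 0) ∧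
      w ∈ Q '' link ω τ := by
    intro τ
    constructor
    · intro hτ
      obtain ⟨hτ', hdτ, u, hu, huw⟩ := id hτ
      refine ⟨(h.mem_facets τ).2 ⟨hτ', ?_⟩, hzero τ hτ, u, hu, (consMap_eq_iff.1 huw).2⟩
      rw [hd]
      omega
    · rintro ⟨hτ, hz0, u, hu, huw⟩
      obtain ⟨hτ', hdτ⟩ := (h.mem_facets τ).1 hτ
      refine ⟨hτ', by omega, u, hu, consMap_eq_iff.2 ⟨?_, huw⟩⟩
      exact eq_zero_on_vectorSpan hz0 (mem_vectorSpan_of_mem_link hu)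
  have hev := X.localDegree_eventually hd (Q := consMap z Q) (ω := ω) (w₀ := w₀) (by
      intro κ hκ _ hmem
      have htop : (vectorSpan ℝ κ).map Q = ⊤ := by
        by_contra hne
        exact hw κ hκ hne (hmap κ hmem)
      have h1 := Submodule.finrank_map_le (LinearMap.funLeft ℝ ℝ (some : ι → Option ι))
        ((vectorSpan ℝ κ).map (consMap z Q))
      rw [hpr, htop, finrank_top, Module.finrank_fintype_fun_eq_card] at h1
      rw [Fintype.card_option]
      omega)
    (fun _ => LinearMap.proj none) (fun τ => mapIndex Λ Q τ) (by
      intro τ hτ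
      obtain ⟨hτ', hz0, u, hu, huw⟩ := (hwall τ).1 hτ
      have htop : (vectorSpan ℝ τ).map Q = ⊤ := by
        by_contra hne
        exact hw τ hτ.1 hne ⟨u, mem_vectorSpan_of_mem_link hu, huw⟩
      ext y
      rw [LinearMap.mem_ker, LinearMap.proj_apply]
      constructor
      · intro hy
        have : (fun i => y (some i)) ∈ (vectorSpan ℝ τ).map Q := htop ▸ Submodule.mem_top
        obtain ⟨v, hv, hvy⟩ := this
        refine ⟨v, hv, ?_⟩
        funext o
        cases o with
        | none => rw [consMap_none, eq_zero_on_vectorSpan hz0 hv, hy]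
        | some i => exact congrFun hvy i
      · rintro ⟨v, hv, rfl⟩
        exact eq_zero_on_vectorSpan hz0 hv) (by
      intro τ hτ σ hσ hsub hdσ hne
      have hv := isNormalVector_normalVector (X.polyhedral σ hσ) (X.polyhedral τ hτ.1)
        (X.isFace_of_subset hτ.1 hσ hsub) (by rw [hdσ, hτ.2.1])
      exact mapIndex_consMap hz hQ
        (fun u hu => eq_zero_on_vectorSpan (hzero τ hτ) hu) hv hne)
  obtain ⟨N, hN, hNo, hw₀N⟩ := eventually_nhds_iff.1 hev
  obtain ⟨U, hUo, hUd, hU⟩ := hm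
  obtain ⟨hgo', hgd'⟩ := X.isOpen_dense_isGenericFor (consMap z Q)
  have hpos : IsOpen {y : Option ι → ℝ | 0 < y none} :=
    isOpen_lt continuous_const (continuous_apply none)
  have hne : (N ∩ {y : Option ι → ℝ | 0 < y none}).Nonempty := by
    have hcont : Filter.Tendsto (fun t : ℝ => w₀ + t • Pi.single (none : Option ι) (1 : ℝ))
        (nhdsWithin 0 (Set.Ioi 0)) (nhds w₀) := by
      have : Continuous fun t : ℝ => w₀ + t • Pi.single (none : Option ι) (1 : ℝ) := by fun_prop
      have h1 := this.tendsto 0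
      simp only [zero_smul, add_zero] at h1
      exact h1.mono_left nhdsWithin_le_nhds
    obtain ⟨t, ht, ht0⟩ := ((hcont.eventually (hNo.mem_nhds hw₀N)).and self_mem_nhdsWithin).exists
    refine ⟨_, ht, ?_⟩
    simpa [hw₀] using ht0
  obtain ⟨y, ⟨hyN, hy0⟩, hyU, hyg⟩ := (hUd.inter_of_isOpen_left hgd' hUo).inter_open_nonempty _
    (hNo.inter hpos) hne
  have hdeg := hN y hyN hyg
  rw [hU y hyU, Finset.sum_eq_zero, zero_add] at hdeg
  swap
  -- No facet is met over `(0, w)` away from the walls: it would lie in `{z = 0}`, and so could not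
  -- map onto a target in which the coordinate of `z` is free.
  · intro σ hσ
    rw [if_neg]
    rintro ⟨htop, ⟨u, hu, huw⟩, hno⟩
    rw [WeightedComplex.mem_facetFinset] at hσ
    obtain ⟨hzu, hQu⟩ := consMap_eq_iff.1 huw
    obtain ⟨κ, hκ, hsub, hz0, hlink, hle⟩ := h.exists_carrier hω hw hσ.1 hu hzu hQu
    have hle' := dim_mono hsub
    rw [hσ.2, hdι] at hle'
    rcases hle'.lt_or_eq with hlt | heq
    · refine hno κ ((hwall κ).2 ⟨(h.mem_facets κ).2 ⟨hκ, by omega⟩, hz0, u, hlink, hQu⟩) hsub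
    · have hκσ := X.eq_of_dim_le hκ hσ.1 hsub (by rw [hσ.2, hdι, heq])
      subst hκσ
      have : (Pi.single none 1 : Option ι → ℝ) ∈ (vectorSpan ℝ κ).map (consMap z Q) :=
        htop ▸ Submodule.mem_top
      obtain ⟨v, hv, hv1⟩ := this
      have h1 := congrFun hv1 none
      rw [consMap_none, eq_zero_on_vectorSpan hz0 hv] at h1
      simp at h1
  refine Rat.cast_injective (α := ℝ) ?_
  rw [hdeg, D.localDegree_eq_sum (by rw [h.d_eq, hdι]; ring), ← Finset.sum_filter]
  push_cast
  have hsub : X.finite.toFinset.filter (fun τ => X.IsWall (consMap z Q) ω w₀ τ) ⊆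
      D.facetFinset.filter fun τ => w ∈ Q '' link ω τ := by
    intro τ hτ
    obtain ⟨h1, -, h2⟩ := (hwall τ).1 (Finset.mem_filter.1 hτ).2
    exact Finset.mem_filter.2 ⟨WeightedComplex.mem_facetFinset.2 h1, h2⟩
  rw [← Finset.sum_subset hsub fun τ hτ hnot => ?_]
  · refine Finset.sum_congr rfl fun τ hτ => ?_
    obtain ⟨h1, h2, h3⟩ := (hwall τ).1 (Finset.mem_filter.1 hτ).2
    rw [h.weight_eq τ h1 h2, X.finsum_facets, Finset.sum_mul]
    refine Finset.sum_congr (by congr!) fun σ _ => ?_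
    rw [if_neg (not_lt.2 (by exact hy0.le)), sub_zero, LinearMap.proj_apply, consMap_none]
    ring
  · obtain ⟨h1, h2⟩ := Finset.mem_filter.1 hτ
    rw [WeightedComplex.mem_facetFinset] at h1
    rw [h.weight_eq_zero τ h1, Rat.cast_zero, zero_mul]
    by_contra hcon
    push Not at hcon
    have hw' := (hwall τ).2 ⟨h1, hcon, h2⟩
    exact hnot (Finset.mem_filter.2 ⟨X.finite.mem_toFinset.2 hw'.1, hw'⟩)

/-- Where `z` vanishes the degrees are generically constant because they come from `X`; elsewhere
they are zero. -/
lemma isBalanced (h : IsDivisorSkeleton X z D) (hX : X.IsBalanced) (hz : IsIntegral Λ z) :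
    D.IsBalanced := by
  refine WeightedComplex.isBalanced_of_localDegree fun r Q hQ ω => ?_
  by_cases hω : z ω = 0
  · obtain ⟨m, hm⟩ := hX.exists_isGenericValue (isIntegralMap_consMap hz hQ) ω
    exact ⟨m, h.isGenericValue hz hQ hω hm⟩
  · exact ⟨0, Set.univ, isOpen_univ, dense_univ, fun w _ => h.localDegree_eq_zero hω Q w⟩

end IsDivisorSkeleton

namespace IsDivisor

variable [IsLattice Λ] {X D : WeightedComplex Λ} {a c : V →ₗ[ℝ] ℝ}

lemma support_subset (h : IsDivisor (fun x => max (a x) (c x)) X D) :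
    D.support ⊆ X.support ∩ {x | (a - c) x = 0} := by
  obtain ⟨X', D', -, hXX, hDD, hs⟩ := h.exists_skeleton
  rw [← hXX.support_eq, ← hDD.support_eq]
  exact hs.support_subset

lemma isBalanced (h : IsDivisor (fun x => max (a x) (c x)) X D) (hz : IsIntegral Λ (a - c)) :
    D.IsBalanced := by
  obtain ⟨X', D', hX', -, hDD, hs⟩ := h.exists_skeleton
  exact (hs.isBalanced hX' hz).of_sameCycle hDD

lemma isGenericValue [Fintype ι] (h : IsDivisor (fun x => max (a x) (c x)) X D)
    (hz : IsIntegral Λ (a - c)) {Q : V →ₗ[ℝ] (ι → ℝ)} (hQ : IsIntegralMap Λ Q) {ω : V}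
    (hω : (a - c) ω = 0) {m : ℚ}
    (hm : IsGenericValue (X.localDegree (consMap (a - c) Q) ω) m) :
    IsGenericValue (D.localDegree Q ω) m := by
  obtain ⟨X', D', -, hXX, hDD, hs⟩ := h.exists_skeleton
  exact hDD.isGenericValue (hs.isGenericValue hz hQ hω (hXX.symm.isGenericValue hm))

end IsDivisor

end Divisor

/-! ### Successive divisors and the coordinates they add -/

section Chain

variable {V : Type*} [NormedAddCommGroup V] [NormedSpace ℝ V] {Λ : AddSubgroup V}
  {ι κ : Type*}

/-- The map with additional coordinates `z i`. -/
def sumMap (z : κ → V →ₗ[ℝ] ℝ) (Q : V →ₗ[ℝ] (ι → ℝ)) : V →ₗ[ℝ] (κ ⊕ ι → ℝ) :=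
  LinearMap.pi fun o => o.elim z fun i => (LinearMap.proj i).comp Q

@[simp] lemma sumMap_inl (z : κ → V →ₗ[ℝ] ℝ) (Q : V →ₗ[ℝ] (ι → ℝ)) (u : V) (i : κ) :
    sumMap z Q u (Sum.inl i) = z i u := rfl

@[simp] lemma sumMap_inr (z : κ → V →ₗ[ℝ] ℝ) (Q : V →ₗ[ℝ] (ι → ℝ)) (u : V) (i : ι) :
    sumMap z Q u (Sum.inr i) = Q u i := rfl

lemma isIntegralMap_sumMap {z : κ → V →ₗ[ℝ] ℝ} {Q : V →ₗ[ℝ] (ι → ℝ)}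
    (hz : ∀ i, IsIntegral Λ (z i)) (hQ : IsIntegralMap Λ Q) : IsIntegralMap Λ (sumMap z Q)
  | u, hu, Sum.inl i => hz i u hu
  | u, hu, Sum.inr i => hQ u hu i

lemma mapIndex_reindex (e : κ ≃ ι) (Q : V →ₗ[ℝ] (ι → ℝ)) (σ : Set V) :
    mapIndex Λ ((LinearMap.funLeft ℝ ℝ e).comp Q) σ = mapIndex Λ Q σ := by
  have h1 : (latticeOf Λ σ).map ((LinearMap.funLeft ℝ ℝ e).comp Q).toAddMonoidHom =
      ((latticeOf Λ σ).map Q.toAddMonoidHom).map (LinearMap.funLeft ℝ ℝ e).toAddMonoidHom := by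
    rw [AddSubgroup.map_map]
    rfl
  have h2 : intLattice κ = (intLattice ι).map (LinearMap.funLeft ℝ ℝ e).toAddMonoidHom := by
    ext w
    constructor
    · intro hw
      refine ⟨fun i => w (e.symm i), fun i => hw _, ?_⟩
      funext i
      exact congrArg w (e.symm_apply_apply i)
    · rintro ⟨w, hw, rfl⟩
      exact fun i => hw (e i)
  rw [mapIndex, mapIndex, h1, h2]
  exact AddSubgroup.relIndex_map_map_of_injective _ _
    (LinearMap.funLeft_injective_of_surjective ℝ ℝ e e.surjective)

lemma WeightedComplex.isGenericValue_reindex [Fintype ι] [Fintype κ] (X : WeightedComplex Λ)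
    (e : κ ≃ ι) (Q : V →ₗ[ℝ] (ι → ℝ)) (ω : V) {m : ℚ}
    (h : IsGenericValue (X.localDegree ((LinearMap.funLeft ℝ ℝ e).comp Q) ω) m) :
    IsGenericValue (X.localDegree Q ω) m := by
  have hdeg : ∀ w : ι → ℝ, X.localDegree ((LinearMap.funLeft ℝ ℝ e).comp Q) ω (fun i => w (e i)) =
      X.localDegree Q ω w := by
    intro w
    rw [localDegree, localDegree]
    refine finsum_mem_congr (Set.ext fun σ => ?_) fun σ _ => by rw [mapIndex_reindex]
    refine and_congr_right fun _ => and_congr (by rw [Fintype.card_congr e]) ?_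
    constructor
    · rintro ⟨u, hu, huw⟩
      exact ⟨u, hu, LinearMap.funLeft_injective_of_surjective ℝ ℝ e e.surjective huw⟩
    · rintro ⟨u, hu, rfl⟩
      exact ⟨u, hu, rfl⟩
  obtain ⟨U, hUo, hUd, hU⟩ := h
  let g : (ι → ℝ) ≃ₜ (κ → ℝ) := (Homeomorph.piCongrLeft (Y := fun _ => ℝ) e).symm
  exact ⟨g ⁻¹' U, hUo.preimage g.continuous, hUd.preimage g.isOpenMap,
    fun w hw => (hdeg w).symm.trans (hU _ hw)⟩

variable [FiniteDimensional ℝ V] [IsLattice Λ]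

/-- A sequence of intersection products with the divisors of `max(a i, c i)`. -/
structure IsDivisorChain {n : ℕ} (D : Fin (n + 1) → WeightedComplex Λ)
    (a c : Fin n → V →ₗ[ℝ] ℝ) : Prop where
  integral : ∀ i, IsIntegral Λ (a i - c i)
  isDivisor : ∀ i : Fin n, IsDivisor (fun x => max (a i x) (c i x)) (D i.castSucc) (D i.succ)

namespace IsDivisorChain

omit [FiniteDimensional ℝ V] [IsLattice Λ] in
lemma init {n : ℕ} {D : Fin (n + 2) → WeightedComplex Λ} {a c : Fin (n + 1) → V →ₗ[ℝ] ℝ}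
    (h : IsDivisorChain D a c) : IsDivisorChain (fun i => D i.castSucc)
      (fun i => a i.castSucc) fun i => c i.castSucc :=
  ⟨fun _ => h.integral _, fun i => h.isDivisor i.castSucc⟩

/-- `IsDivisor` supplies a balanced representative of the preceding cycle, so looking at the last
divisor suffices; the hypothesis on `D 0` matters only for an empty chain. -/
lemma isBalanced {n : ℕ} {D : Fin (n + 1) → WeightedComplex Λ} {a c : Fin n → V →ₗ[ℝ] ℝ}
    (h : IsDivisorChain D a c) (h0 : (D 0).IsBalanced) : (D (Fin.last n)).IsBalanced := by
  cases n with
  | zero => exact h0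
  | succ n => exact (h.isDivisor (Fin.last n)).isBalanced (h.integral _)

lemma support_subset {n : ℕ} {D : Fin (n + 1) → WeightedComplex Λ} {a c : Fin n → V →ₗ[ℝ] ℝ}
    (h : IsDivisorChain D a c) : (D (Fin.last n)).support ⊆ {x | ∀ i, a i x = c i x} := by
  induction n with
  | zero => exact fun x _ i => i.elim0
  | succ n ih =>
    intro x hx i
    have h1 := (h.isDivisor (Fin.last n)).support_subset hx
    refine Fin.lastCases ?_ (fun j => ?_) i
    · exact sub_eq_zero.1 h1.2
    · exact ih h.init h1.1 j

/-- Each divisor trades itself for an extra coordinate. The last one is removed first and its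
coordinate joins `Q`, so the induction has to run over all index types at once. -/
lemma isGenericValue {n : ℕ} {D : Fin (n + 1) → WeightedComplex Λ} {a c : Fin n → V →ₗ[ℝ] ℝ}
    (h : IsDivisorChain D a c) [Fintype ι] {Q : V →ₗ[ℝ] (ι → ℝ)} (hQ : IsIntegralMap Λ Q) {ω : V}
    (hω : ∀ i, a i ω = c i ω) {m : ℚ}
    (hm : IsGenericValue ((D 0).localDegree (sumMap (fun i => a i - c i) Q) ω) m) :
    IsGenericValue ((D (Fin.last n)).localDegree Q ω) m := by
  induction n generalizing ι with
  | zero =>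
    exact (D 0).isGenericValue_reindex (Equiv.emptySum (Fin 0) ι) Q ω (by
      convert hm using 2
      ext u i
      rcases i with i | i
      · exact i.elim0
      · rfl)
  | succ n ih =>
    refine (h.isDivisor (Fin.last n)).isGenericValue (h.integral _) hQ
      (sub_eq_zero.2 (hω (Fin.last n))) ?_
    refine ih h.init (isIntegralMap_consMap (h.integral _) hQ) (fun i => hω _) ?_
    -- The induction leaves the last difference in the position `none` of the second block; this
    -- relabelling returns it to the end of the first block.
    let f : Fin (n + 1) ⊕ ι → Fin n ⊕ Option ι := Sum.elim
      (Fin.lastCases (Sum.inr none) Sum.inl) fun i => Sum.inr (some i)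
    let g : Fin n ⊕ Option ι → Fin (n + 1) ⊕ ι := Sum.elim (fun i => Sum.inl i.castSucc)
      fun o => o.elim (Sum.inl (Fin.last n)) Sum.inr
    let e : Fin (n + 1) ⊕ ι ≃ Fin n ⊕ Option ι :=
      { toFun := f
        invFun := g
        left_inv := by
          rintro (i | i)
          · refine Fin.lastCases ?_ (fun j => ?_) i <;> simp [f, g]
          · simp [f, g]
        right_inv := by
          rintro (i | (_ | i)) <;> simp [f, g] }
    refine (D 0).isGenericValue_reindex e _ ω ?_
    convert hm using 2
    ext u i
    rcases i with i | i
    · refine Fin.lastCases ?_ (fun j => ?_) i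
      · simp [e, f, LinearMap.funLeft_apply]
      · simp [e, f, LinearMap.funLeft_apply]
    · rfl

end IsDivisorChain

end Chain

/-! ### Existence of divisors -/

section Existence

variable {V : Type*} [NormedAddCommGroup V] [NormedSpace ℝ V] {Λ : AddSubgroup V}

/-- The codimension one skeleton with prescribed weights. -/
def WeightedComplex.skeleton (X : WeightedComplex Λ) (w : Set V → ℚ) : WeightedComplex Λ where
  cells := {ρ | ρ ∈ X.cells ∧ ∃ τ ∈ X.cells, ρ ⊆ τ ∧ dim τ = X.d - 1}
  finite := X.finite.subset fun _ h => h.1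
  nonempty σ h := X.nonempty σ h.1
  polyhedral σ h := X.polyhedral σ h.1
  face_mem := by
    rintro σ ⟨hσ, τ, hτ, hsub, hd⟩ F hF
    exact ⟨X.face_mem σ hσ F hF, τ, hτ, hF.subset.trans hsub, hd⟩
  inter_face σ h τ h' := X.inter_face σ h.1 τ h'.1
  d := X.d - 1
  pure := by
    rintro σ ⟨hσ, τ, hτ, hsub, hd⟩
    exact ⟨τ, ⟨hτ, τ, hτ, subset_rfl, hd⟩, hsub, hd⟩
  weight := w

variable [FiniteDimensional ℝ V] [IsLattice Λ]

/-- Refining along the hyperplane `a = c` makes the maximum equal to `a` or `c` on each cell, and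
balancing survives because the cycle is unchanged. -/
lemma exists_isDivisor {X : WeightedComplex Λ} (hX : X.IsBalanced) {a c : V →ₗ[ℝ] ℝ}
    (ha : IsIntegral Λ a) (hc : IsIntegral Λ c) :
    ∃ D, IsDivisor (fun x => max (a x) (c x)) X D := by
  classical
  have hpoly : ∀ l : V →ₗ[ℝ] ℝ, IsIntegral Λ l → IsRationalPolyhedron Λ {x | l x ≤ 0} :=
    fun l hl => ⟨{(l, 0)}, by simpa using fun u hu => hl u hu, by simp⟩
  have hac : IsIntegral Λ (a - c) := fun u hu => by
    obtain ⟨k, hk⟩ := ha u hu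
    obtain ⟨k', hk'⟩ := hc u hu
    exact ⟨k - k', by rw [LinearMap.sub_apply, hk, hk']; push_cast; rfl⟩
  have hca : IsIntegral Λ (c - a) := fun u hu => by
    obtain ⟨k, hk⟩ := hac u hu
    exact ⟨-k, by rw [← neg_sub, LinearMap.neg_apply, hk]; push_cast; rfl⟩
  obtain ⟨C, hC, href⟩ := exists_refining_complex (Λ := Λ)
    {{x | (a - c) x ≤ 0}, {x | (c - a) x ≤ 0}} (by simp)
    (by
      rintro P (rfl | rfl)
      · exact hpoly _ hac
      · exact hpoly _ hca)
  have hsign : ∀ σ ∈ (X.refine C hC).cells, (∀ x ∈ σ, c x ≤ a x) ∨ ∀ x ∈ σ, a x ≤ c x := by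
    rintro σ ⟨-, τ, -, ζ, hζ, rfl⟩
    obtain ⟨ω, hω⟩ := relint_nonempty (C.polyhedral ζ hζ) (C.nonempty ζ hζ)
    rcases le_total (a ω) (c ω) with h | h
    · refine Or.inr fun x hx => ?_
      have := href {x | (a - c) x ≤ 0} (Or.inl rfl) ζ hζ ω hω (sub_nonpos.2 h) hx.2
      exact sub_nonpos.1 this
    · refine Or.inl fun x hx => ?_
      have := href {x | (c - a) x ≤ 0} (Or.inr rfl) ζ hζ ω hω (sub_nonpos.2 h) hx.2
      exact sub_nonpos.1 this
  have hl : ∀ σ ∈ (X.refine C hC).cells, ∃ l : V →ₗ[ℝ] ℝ,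
      IsLinearPart Λ (fun x => max (a x) (c x)) σ l := by
    intro σ hσ
    rcases hsign σ hσ with h | h
    · exact ⟨a, ⟨0, fun x hx => by simp [h x hx]⟩, fun u hu => ha u hu.1⟩
    · exact ⟨c, ⟨0, fun x hx => by simp [h x hx]⟩, fun u hu => hc u hu.1⟩
  choose! l hl using hl
  have hbal : (X.refine C hC).IsBalanced := hX.of_sameCycle (X.refine_sameCycle C hC).symm
  -- The defining formula gives a real number; it is rational because it is zero or a sum of
  -- rational weights times the integers `max(z v, 0)`.
  have hrat : ∀ τ, ∃ q : ℚ, τ ∈ (X.refine C hC).cells → dim τ = (X.refine C hC).d - 1 → (q : ℝ) =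
      (∑ᶠ σ ∈ {σ | σ ∈ (X.refine C hC).facets ∧ τ ⊆ σ},
        l σ (((X.refine C hC).weight σ : ℝ) • normalVector Λ τ σ)) -
        l τ (∑ᶠ σ ∈ {σ | σ ∈ (X.refine C hC).facets ∧ τ ⊆ σ},
          ((X.refine C hC).weight σ : ℝ) • normalVector Λ τ σ) := by
    intro τ
    by_cases hτ : τ ∈ (X.refine C hC).cells ∧ dim τ = (X.refine C hC).d - 1
    swap
    · exact ⟨0, fun h h' => absurd ⟨h, h'⟩ hτ⟩
    obtain ⟨hτ, hd⟩ := hτ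
    have hint : ∀ σ, ∃ k : ℤ, σ ∈ (X.refine C hC).facets → τ ⊆ σ →
        (a - c) (normalVector Λ τ σ) = k := by
      intro σ
      by_cases hσ : σ ∈ (X.refine C hC).facets ∧ τ ⊆ σ
      · have hv := isNormalVector_normalVector ((X.refine C hC).polyhedral σ hσ.1.1)
          ((X.refine C hC).polyhedral τ hτ) ((X.refine C hC).isFace_of_subset hτ hσ.1.1 hσ.2)
          (by rw [hσ.1.2, hd]; ring)
        obtain ⟨k, hk⟩ := hac _ hv.mem.1
        exact ⟨k, fun _ _ => hk⟩
      · exact ⟨0, fun h h' => absurd ⟨h, h'⟩ hσ⟩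
    choose k hk using hint
    refine ⟨if ∀ x ∈ τ, (a - c) x = 0 then ∑ σ ∈ (X.refine C hC).facetFinset with τ ⊆ σ,
        (X.refine C hC).weight σ * max (k σ : ℚ) 0 else 0, fun _ _ => ?_⟩
    rw [divisor_weight hbal hl hτ hd]
    split_ifs
    · push_cast
      refine Finset.sum_congr rfl fun σ hσ => ?_
      rw [Finset.mem_filter, WeightedComplex.mem_facetFinset] at hσ
      rw [hk σ hσ.1 hσ.2]
    · simp
  choose w hw using hrat
  exact ⟨_, _, (X.refine C hC).skeleton w, l, hbal, X.refine_sameCycle C hC,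
    WeightedComplex.SameCycle.refl _, hl, rfl, rfl, fun τ hτ => hw τ hτ.1.1 hτ.2⟩

lemma exists_isDivisorChain {n : ℕ} {X : WeightedComplex Λ} (hX : X.IsBalanced)
    {a c : Fin n → V →ₗ[ℝ] ℝ} (ha : ∀ i, IsIntegral Λ (a i)) (hc : ∀ i, IsIntegral Λ (c i)) :
    ∃ D : Fin (n + 1) → WeightedComplex Λ, D 0 = X ∧ IsDivisorChain D a c := by
  have hac : ∀ i, IsIntegral Λ (a i - c i) := fun i u hu => by
    obtain ⟨k, hk⟩ := ha i u hu
    obtain ⟨k', hk'⟩ := hc i u hu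
    exact ⟨k - k', by rw [LinearMap.sub_apply, hk, hk']; push_cast; rfl⟩
  induction n with
  | zero => exact ⟨fun _ => X, rfl, fun i => i.elim0, fun i => i.elim0⟩
  | succ n ih =>
    obtain ⟨D, hD0, hD⟩ := ih (fun i => ha i.castSucc) (fun i => hc i.castSucc)
      fun i => hac i.castSucc
    obtain ⟨D', hD'⟩ := exists_isDivisor (hD.isBalanced (hD0 ▸ hX)) (ha (Fin.last n))
      (hc (Fin.last n))
    refine ⟨Fin.snoc (α := fun _ => WeightedComplex Λ) D D', ?_, hac, fun i => ?_⟩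
    · rw [← hD0, ← Fin.castSucc_zero, Fin.snoc_castSucc]
    · refine Fin.lastCases ?_ (fun j => ?_) i
      · rw [Fin.snoc_castSucc, Fin.succ_last, Fin.snoc_last]
        exact hD'
      · rw [Fin.snoc_castSucc, Fin.succ_castSucc, Fin.snoc_castSucc]
        exact hD.isDivisor j

end Existence

/-! ### Projection of cycles supported on the diagonal -/

section Pushforward

variable {V : Type*} [NormedAddCommGroup V] [NormedSpace ℝ V] {Λ : AddSubgroup V} {ι : Type*}

/-- The diagonal embedding. -/
def diag (V : Type*) [NormedAddCommGroup V] [NormedSpace ℝ V] : V →ₗ[ℝ] V × V :=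
  LinearMap.prod LinearMap.id LinearMap.id

@[simp] lemma diag_apply (x : V) : diag V x = (x, x) := rfl

lemma eq_image_diag {σ : Set (V × V)} (h : ∀ p ∈ σ, p.1 = p.2) :
    σ = diag V '' (LinearMap.fst ℝ V V '' σ) := by
  rw [Set.image_image]
  ext p
  constructor
  · intro hp
    exact ⟨p, hp, Prod.ext rfl (h p hp)⟩
  · rintro ⟨q, hq, rfl⟩
    have : diag V (LinearMap.fst ℝ V V q) = q := Prod.ext rfl (h q hq)
    beta_reduce
    rwa [this]

lemma fst_image_diag (ρ : Set V) : LinearMap.fst ℝ V V '' (diag V '' ρ) = ρ := by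
  rw [Set.image_image]
  simp

lemma vectorSpan_diag (ρ : Set V) : vectorSpan ℝ (diag V '' ρ) = (vectorSpan ℝ ρ).map (diag V) := by
  rw [vectorSpan, vectorSpan, Submodule.map_span]
  congr 1
  ext p
  constructor
  · rintro ⟨_, ⟨x, hx, rfl⟩, _, ⟨y, hy, rfl⟩, rfl⟩
    exact ⟨x - y, ⟨x, hx, y, hy, rfl⟩, map_sub _ _ _⟩
  · rintro ⟨_, ⟨x, hx, y, hy, rfl⟩, rfl⟩
    exact ⟨_, ⟨x, hx, rfl⟩, _, ⟨y, hy, rfl⟩, (map_sub _ _ _).symm⟩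

lemma dim_diag (ρ : Set V) : dim (diag V '' ρ) = dim ρ := by
  have hinj : Function.Injective (diag V) := fun x y h => congrArg Prod.fst h
  unfold dim
  rw [vectorSpan_diag, ← (Submodule.equivMapOfInjective (diag V) hinj _).finrank_eq]

lemma map_fst_latticeOf_diag (ρ : Set V) :
    (latticeOf (Λ.prod Λ) (diag V '' ρ)).map (LinearMap.fst ℝ V V).toAddMonoidHom =
      latticeOf Λ ρ := by
  ext u
  rw [latticeOf, vectorSpan_diag]
  constructor
  · rintro ⟨p, ⟨hp, x, hx, rfl⟩, rfl⟩
    exact ⟨hp.1, hx⟩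
  · rintro ⟨hu, hu'⟩
    exact ⟨(u, u), ⟨⟨hu, hu⟩, u, hu', rfl⟩, rfl⟩

lemma link_diag (ρ : Set V) (ω : V) : link (ω, ω) (diag V '' ρ) = diag V '' link ω ρ := by
  ext p
  constructor
  · rintro ⟨δ, hδ, h⟩
    have hp : p.1 = p.2 := by
      obtain ⟨x, -, hx⟩ := h (δ / 2) (by positivity) (by linarith)
      have h1 := congrArg Prod.fst hx
      have h2 := congrArg Prod.snd hx
      simp only [diag_apply, Prod.fst_add, Prod.snd_add, Prod.smul_fst, Prod.smul_snd] at h1 h2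
      have h3 := add_left_cancel (h1.symm.trans h2)
      exact smul_right_injective V (by positivity : δ / 2 ≠ 0) h3
    refine ⟨p.1, ⟨δ, hδ, fun ε h0 h1 => ?_⟩, Prod.ext rfl hp⟩
    obtain ⟨x, hx, hxp⟩ := h ε h0 h1
    have : x = ω + ε • p.1 := congrArg Prod.fst hxp
    exact this ▸ hx
  · rintro ⟨u, ⟨δ, hδ, h⟩, rfl⟩
    exact ⟨δ, hδ, fun ε h0 h1 => ⟨_, h ε h0 h1, rfl⟩⟩

variable [FiniteDimensional ℝ V]

/-- On the diagonal the projection is inverted by `diag` and identifies the lattices. Every facet of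
nonzero weight therefore has index one and its own image, and degrees agree term by term; facets of
weight zero may leave the diagonal but do not count. -/
lemma IsPushforward.isGenericValue [Fintype ι] {X : WeightedComplex (Λ.prod Λ)}
    {P : WeightedComplex Λ} (h : IsPushforward (LinearMap.fst ℝ V V) X P)
    (hsupp : X.support ⊆ {p | p.1 = p.2}) {Q : V →ₗ[ℝ] (ι → ℝ)} {ω : V} {m : ℚ}
    (hm : IsGenericValue (X.localDegree (Q.comp (LinearMap.fst ℝ V V)) (ω, ω)) m) :
    IsGenericValue (P.localDegree Q ω) m := by
  classical
  obtain ⟨X', P', -, hXX, hPP, hd, hcells, hw⟩ := h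
  refine hPP.isGenericValue ((hXX.symm.isGenericValue hm).congr
    ⟨Set.univ, isOpen_univ, dense_univ, fun w _ => ?_⟩)
  rw [← hXX.support_eq] at hsupp
  by_cases hd' : X'.d = Fintype.card ι
  swap
  · rw [X'.localDegree_eq_zero hd', P'.localDegree_eq_zero (by rwa [hd])]
  rw [X'.localDegree_eq_sum hd', P'.localDegree_eq_sum (hd.trans hd'), ← Finset.sum_filter,
    ← Finset.sum_filter]
  have hsum : ∀ ρ ∈ P'.facetFinset.filter (fun ρ => w ∈ Q '' link ω ρ),
      P'.weight ρ * mapIndex Λ Q ρ = ∑ σ ∈ X'.facetFinset with LinearMap.fst ℝ V V '' σ = ρ,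
        X'.weight σ * (((latticeOf (Λ.prod Λ) σ).map
          (LinearMap.fst ℝ V V).toAddMonoidHom).relIndex (latticeOf Λ ρ) : ℚ) *
            mapIndex Λ Q ρ := by
    intro ρ hρ
    rw [Finset.mem_filter, WeightedComplex.mem_facetFinset] at hρ
    rw [hw ρ hρ.1, X'.finsum_facets, Finset.sum_mul]
    refine Finset.sum_congr (by congr!) fun σ _ => rfl
  rw [Finset.sum_congr rfl hsum, Finset.sum_comm' (t' := X'.facetFinset)
    (s' := fun σ => P'.facetFinset.filter fun ρ => w ∈ Q '' link ω ρ ∧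
      LinearMap.fst ℝ V V '' σ = ρ)]
  swap
  · intro ρ σ
    simp only [Finset.mem_filter]
    tauto
  rw [Finset.sum_filter]
  refine Finset.sum_congr rfl fun σ hσ => ?_
  rw [WeightedComplex.mem_facetFinset] at hσ
  by_cases hσ0 : X'.weight σ = 0
  · rw [hσ0, zero_mul, ite_self, Finset.sum_eq_zero]
    exact fun ρ _ => by rw [zero_mul, zero_mul]
  have hdiag : ∀ p ∈ σ, p.1 = p.2 := fun p hp => hsupp ⟨σ, hσ, hσ0, hp⟩
  obtain ⟨ρ, rfl⟩ : ∃ ρ, σ = diag V '' ρ := ⟨_, eq_image_diag hdiag⟩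
  have hρ : ρ ∈ P'.facets := by
    refine ⟨?_, ?_⟩
    · rw [hcells]
      refine ⟨_, hσ.1, ⟨_, hσ, subset_rfl, ?_⟩, (fst_image_diag ρ).symm⟩
      rintro _ ⟨x, -, rfl⟩ _ ⟨y, -, rfl⟩ hxy
      exact congrArg (diag V) hxy
    · rw [hd, ← hσ.2, dim_diag]
  have hiff : w ∈ (Q.comp (LinearMap.fst ℝ V V)) '' link (ω, ω) (diag V '' ρ) ↔
      w ∈ Q '' link ω ρ := by
    rw [link_diag, Set.image_image]
    rfl
  have hidx : mapIndex (Λ.prod Λ) (Q.comp (LinearMap.fst ℝ V V)) (diag V '' ρ) =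
      mapIndex Λ Q ρ := by
    rw [mapIndex, mapIndex, ← map_fst_latticeOf_diag (Λ := Λ) ρ, AddSubgroup.map_map]
    rfl
  simp only [hiff]
  split_ifs with hwρ
  · have : P'.facetFinset.filter (fun ρ' => w ∈ Q '' link ω ρ' ∧
        LinearMap.fst ℝ V V '' (diag V '' ρ) = ρ') = {ρ} := by
      ext ρ'
      simp only [Finset.mem_filter, WeightedComplex.mem_facetFinset, Finset.mem_singleton,
        fst_image_diag]
      constructor
      · exact fun h => h.2.2.symm
      · rintro rfl
        exact ⟨hρ, hwρ, rfl⟩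
    rw [this, Finset.sum_singleton, map_fst_latticeOf_diag, AddSubgroup.relIndex_self, hidx]
    simp
  · refine (Finset.sum_eq_zero fun ρ' hρ' => absurd ?_ hwρ).symm
    simp only [Finset.mem_filter, fst_image_diag] at hρ'
    obtain ⟨-, h1, rfl⟩ := hρ'
    exact h1

/-- The subcomplex of cells contained in a facet of nonzero weight. -/
def WeightedComplex.prune (X : WeightedComplex Λ) : WeightedComplex Λ where
  cells := {κ | κ ∈ X.cells ∧ ∃ σ ∈ X.facets, X.weight σ ≠ 0 ∧ κ ⊆ σ}
  finite := X.finite.subset fun _ h => h.1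
  nonempty σ h := X.nonempty σ h.1
  polyhedral σ h := X.polyhedral σ h.1
  face_mem := by
    rintro κ ⟨hκ, σ, hσ, hne, hsub⟩ F hF
    exact ⟨X.face_mem κ hκ F hF, σ, hσ, hne, hF.subset.trans hsub⟩
  inter_face σ h τ h' := X.inter_face σ h.1 τ h'.1
  d := X.d
  pure := by
    rintro κ ⟨-, σ, hσ, hne, hsub⟩
    exact ⟨σ, ⟨hσ.1, σ, hσ, hne, subset_rfl⟩, hsub, hσ.2⟩
  weight := X.weight

lemma WeightedComplex.mem_prune_facets {X : WeightedComplex Λ} {σ : Set V} :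
    σ ∈ X.prune.facets ↔ σ ∈ X.facets ∧ X.weight σ ≠ 0 := by
  constructor
  · rintro ⟨⟨hσ, σ', hσ', hne, hsub⟩, hd⟩
    have := X.eq_of_dim_le hσ hσ'.1 hsub (by rw [hσ'.2]; exact hd.ge)
    exact ⟨⟨hσ, hd⟩, this ▸ hne⟩
  · rintro ⟨hσ, hne⟩
    exact ⟨⟨hσ.1, σ, hσ, hne, subset_rfl⟩, hσ.2⟩

lemma WeightedComplex.prune_sameCycle (X : WeightedComplex Λ) : X.prune.SameCycle X := by
  classical
  obtain ⟨C, hC, -⟩ := SameCycle.refl X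
  refine ⟨C, hC, fun γ => ?_⟩
  rw [refinedWeight_eq_sum, refinedWeight_eq_sum]
  refine Finset.sum_subset (fun σ hσ => ?_) fun σ hσ hnot => ?_
  · simp only [Finset.mem_filter, mem_facetFinset, mem_prune_facets] at hσ ⊢
    exact ⟨hσ.1.1, hσ.2⟩
  · simp only [Finset.mem_filter, mem_facetFinset, mem_prune_facets] at hσ hnot
    by_contra hne
    exact hnot ⟨⟨hσ.1, hne⟩, hσ.2⟩

omit [FiniteDimensional ℝ V] in
lemma IsRationalPolyhedron.preimage_diag {σ : Set (V × V)}
    (hσ : IsRationalPolyhedron (Λ.prod Λ) σ) : IsRationalPolyhedron Λ (diag V ⁻¹' σ) := by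
  classical
  obtain ⟨s, hs, rfl⟩ := hσ
  refine ⟨s.image fun p => (p.1.comp (diag V), p.2), ?_, ?_⟩
  · intro p hp u hu
    obtain ⟨q, hq, rfl⟩ := Finset.mem_image.1 hp
    exact hs q hq (u, u) ⟨hu, hu⟩
  · ext x
    simp only [Set.mem_preimage, Set.mem_ofPred_eq, Finset.forall_mem_image]
    rfl

omit [FiniteDimensional ℝ V] in
lemma isFace_image_diag_iff {F P : Set V} : IsFace (diag V '' F) (diag V '' P) ↔ IsFace F P := by
  have hinj : Function.Injective (diag V) := fun x y h => congrArg Prod.fst h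
  constructor
  · rintro ⟨hne, l, hl⟩
    refine ⟨Set.image_nonempty.1 hne, l.comp (diag V), ?_⟩
    ext x
    rw [← hinj.mem_set_image, hl, Set.mem_ofPred_eq, hinj.mem_set_image, Set.forall_mem_image]
    rfl
  · rintro ⟨hne, l, hl⟩
    refine ⟨hne.image _, l.comp (LinearMap.fst ℝ V V), ?_⟩
    ext p
    constructor
    · rintro ⟨x, hx, rfl⟩
      rw [hl] at hx
      refine ⟨⟨x, hx.1, rfl⟩, ?_⟩
      rw [Set.forall_mem_image]
      exact hx.2
    · rintro ⟨⟨x, hx, rfl⟩, h⟩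
      rw [Set.forall_mem_image] at h
      refine ⟨x, ?_, rfl⟩
      rw [hl]
      exact ⟨hx, h⟩

/-- Once facets of weight zero are discarded, the whole complex lies on the diagonal. The projection
carries it isomorphically to a complex in `V`, so no subdivision of the images is needed. -/
lemma exists_isPushforward [IsLattice Λ] {X : WeightedComplex (Λ.prod Λ)} (hX : X.IsBalanced)
    (hsupp : X.support ⊆ {p | p.1 = p.2}) : ∃ P : WeightedComplex Λ,
      IsPushforward (LinearMap.fst ℝ V V) X P := by
  classical
  have hdiag : ∀ σ ∈ X.prune.cells, σ = diag V '' (LinearMap.fst ℝ V V '' σ) := by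
    rintro σ ⟨-, σ', hσ', hne, hsub⟩
    exact eq_image_diag fun p hp => hsupp ⟨σ', hσ', hne, hsub hp⟩
  have hinj : ∀ σ ∈ X.prune.cells, Set.InjOn (LinearMap.fst ℝ V V) σ := by
    intro σ hσ p hp q hq hpq
    rw [hdiag σ hσ] at hp hq
    obtain ⟨x, -, rfl⟩ := hp
    obtain ⟨y, -, rfl⟩ := hq
    exact congrArg (diag V) hpq
  have hpure : ∀ σ ∈ X.prune.cells, ∃ σ' ∈ X.prune.facets, σ ⊆ σ' := by
    intro σ hσ
    obtain ⟨σ', h1, h2, h3⟩ := X.prune.pure σ hσ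
    exact ⟨σ', ⟨h1, h3⟩, h2⟩
  have hpoly : ∀ σ ∈ X.prune.cells, IsRationalPolyhedron Λ (LinearMap.fst ℝ V V '' σ) := by
    intro σ hσ
    have h1 := (X.prune.polyhedral σ hσ).preimage_diag
    have h2 : diag V ⁻¹' σ = LinearMap.fst ℝ V V '' σ := by
      conv_lhs => rw [hdiag σ hσ]
      exact Set.preimage_image_eq _ fun x y h => congrArg Prod.fst h
    rwa [h2] at h1
  let P : WeightedComplex Λ :=
    { cells := {ρ | ∃ σ ∈ X.prune.cells, (∃ σ' ∈ X.prune.facets, σ ⊆ σ' ∧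
        Set.InjOn (LinearMap.fst ℝ V V) σ') ∧ ρ = LinearMap.fst ℝ V V '' σ}
      finite := by
        refine (X.prune.finite.image fun σ => LinearMap.fst ℝ V V '' σ).subset ?_
        rintro ρ ⟨σ, hσ, -, rfl⟩
        exact ⟨σ, hσ, rfl⟩
      nonempty := by
        rintro ρ ⟨σ, hσ, -, rfl⟩
        exact (X.prune.nonempty σ hσ).image _
      polyhedral := by
        rintro ρ ⟨σ, hσ, -, rfl⟩
        exact hpoly σ hσ
      face_mem := by
        rintro ρ ⟨σ, hσ, ⟨σ', hσ', hsub, hi⟩, rfl⟩ F hF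
        have h1 := isFace_image_diag_iff.2 hF
        rw [← hdiag σ hσ] at h1
        exact ⟨_, X.prune.face_mem σ hσ _ h1, ⟨σ', hσ', h1.subset.trans hsub, hi⟩,
          (fst_image_diag F).symm⟩
      inter_face := by
        rintro ρ ⟨σ, hσ, -, rfl⟩ ρ' ⟨σ', hσ', -, rfl⟩ hne
        rw [← isFace_image_diag_iff, Set.image_inter fun x y h => congrArg Prod.fst h,
          ← hdiag σ hσ, ← hdiag σ' hσ']
        refine X.prune.inter_face σ hσ σ' hσ' ?_
        rw [hdiag σ hσ, hdiag σ' hσ', ← Set.image_inter fun x y h => congrArg Prod.fst h]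
        exact hne.image _
      d := X.d
      pure := by
        rintro ρ ⟨σ, hσ, ⟨σ', hσ', hsub, hi⟩, rfl⟩
        refine ⟨_, ⟨σ', hσ'.1, ⟨σ', hσ', subset_rfl, hi⟩, rfl⟩, Set.image_mono hsub, ?_⟩
        rw [← dim_diag, ← hdiag σ' hσ'.1]
        exact hσ'.2
      weight := fun ρ => ∑ᶠ σ ∈ {σ | σ ∈ X.prune.facets ∧ LinearMap.fst ℝ V V '' σ = ρ},
        X.prune.weight σ * (((latticeOf (Λ.prod Λ) σ).map
          (LinearMap.fst ℝ V V).toAddMonoidHom).relIndex (latticeOf Λ ρ) : ℚ) }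
  exact ⟨P, X.prune, P, hX.of_sameCycle X.prune_sameCycle.symm, X.prune_sameCycle,
    WeightedComplex.SameCycle.refl P, rfl, rfl, fun ρ _ => rfl⟩

lemma IsPushforward.congr [IsLattice Λ] {X : WeightedComplex (Λ.prod Λ)} {P P' : WeightedComplex Λ}
    (h : IsPushforward (LinearMap.fst ℝ V V) X P) (hP : P.SameCycle P') :
    IsPushforward (LinearMap.fst ℝ V V) X P' := by
  obtain ⟨X₁, P₁, h1, h2, h3, h4⟩ := h
  exact ⟨X₁, P₁, h1, h2, h3.trans hP, h4⟩

end Pushforward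

/-- A nonzero relative index is a finite one, so a positive multiple of every vector of `K` lies in
`H`. -/
lemma span_eq_of_relIndex_ne_zero {E : Type*} [AddCommGroup E] [Module ℝ E] {H K : AddSubgroup E}
    (h : H.relIndex K ≠ 0) : Submodule.span ℝ (K : Set E) ≤ Submodule.span ℝ (H : Set E) := by
  refine Submodule.span_le.2 fun u hu => ?_
  obtain ⟨k, hk, -, hmem⟩ := AddSubgroup.exists_nsmul_mem_of_relIndex_ne_zero h hu
  have h1 : ((k : ℝ)) • u ∈ Submodule.span ℝ (H : Set E) := by
    rw [Nat.cast_smul_eq_nsmul]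
    exact Submodule.subset_span hmem.1
  exact (Submodule.smul_mem_iff _ (Nat.cast_ne_zero.2 (by omega))).1 h1

/-! ### Nonzero degrees force surjectivity -/

section Support

variable {V : Type*} [NormedAddCommGroup V] [NormedSpace ℝ V] [FiniteDimensional ℝ V]
  {Λ : AddSubgroup V} {ι : Type*} [Fintype ι]

lemma intLattice_span : Submodule.span ℝ (intLattice ι : Set (ι → ℝ)) = ⊤ := by
  classical
  rw [eq_top_iff, ← (Pi.basisFun ℝ ι).span_eq]
  refine Submodule.span_mono ?_
  rintro _ ⟨i, rfl⟩ j
  rw [Pi.basisFun_apply, Pi.single_apply]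
  split_ifs
  · exact ⟨1, by simp⟩
  · exact ⟨0, by simp⟩

omit [FiniteDimensional ℝ V] in
lemma map_eq_top_of_mapIndex_ne_zero {σ : Set V} {Q : V →ₗ[ℝ] (ι → ℝ)}
    (h : mapIndex Λ Q σ ≠ 0) : (vectorSpan ℝ σ).map Q = ⊤ := by
  refine top_le_iff.1 ?_
  rw [← intLattice_span]
  refine (span_eq_of_relIndex_ne_zero h).trans (Submodule.span_le.2 ?_)
  rintro _ ⟨u, hu, rfl⟩
  exact ⟨u, hu.2, rfl⟩

/-- A nonzero generic local degree forces the images of the facets to cover everything. -/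
lemma WeightedComplex.exists_facet_of_isGenericValue {Z : WeightedComplex Λ}
    {Q : V →ₗ[ℝ] (ι → ℝ)} {ω : V} {m : ℚ} (hm : IsGenericValue (Z.localDegree Q ω) m)
    (hm0 : m ≠ 0) (w : ι → ℝ) : ∃ σ ∈ Z.facets, Z.weight σ ≠ 0 ∧ w ∈ Q '' link ω σ := by
  obtain ⟨U, -, hUd, hU⟩ := hm
  have hfin : {σ | σ ∈ Z.facets ∧ dim σ = Fintype.card ι ∧ Z.weight σ ≠ 0 ∧
      (vectorSpan ℝ σ).map Q = ⊤}.Finite := Z.finite.subset fun σ h => h.1.1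
  -- On the span of each of these facets `Q` is an isomorphism, so the images of the links are
  -- closed; a finite union of them containing a dense set is everything.
  have hclosed : IsClosed (⋃ σ ∈ {σ | σ ∈ Z.facets ∧ dim σ = Fintype.card ι ∧ Z.weight σ ≠ 0 ∧
      (vectorSpan ℝ σ).map Q = ⊤}, Q '' link ω σ) := by
    refine hfin.isClosed_biUnion fun σ hσ => ?_
    obtain ⟨hσ, hd, -, htop⟩ := hσ
    obtain ⟨g, -, hg, hg'⟩ := exists_section hd htop
    have : Q '' link ω σ = g ⁻¹' link ω σ := by
      ext w
      constructor
      · rintro ⟨u, hu, rfl⟩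
        rwa [Set.mem_preimage, hg' u (mem_vectorSpan_of_mem_link hu)]
      · exact fun h => ⟨g w, h, hg w⟩
    rw [this]
    exact (link_closed (Z.polyhedral σ hσ.1)).preimage g.continuous_of_finiteDimensional
  have hsub : U ⊆ ⋃ σ ∈ {σ | σ ∈ Z.facets ∧ dim σ = Fintype.card ι ∧ Z.weight σ ≠ 0 ∧
      (vectorSpan ℝ σ).map Q = ⊤}, Q '' link ω σ := by
    intro w hw
    have h1 := hU w hw
    by_contra hcon
    refine hm0 (h1.symm.trans (finsum_mem_eq_zero_of_forall_eq_zero fun σ hσ => ?_))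
    by_contra hne
    refine hcon (Set.mem_biUnion ⟨hσ.1, hσ.2.1, left_ne_zero_of_mul hne,
      map_eq_top_of_mapIndex_ne_zero (Nat.cast_ne_zero.1 (right_ne_zero_of_mul hne))⟩ hσ.2.2)
  have hall : w ∈ ⋃ σ ∈ {σ | σ ∈ Z.facets ∧ dim σ = Fintype.card ι ∧ Z.weight σ ≠ 0 ∧
      (vectorSpan ℝ σ).map Q = ⊤}, Q '' link ω σ :=
    closure_minimal hsub hclosed (hUd w)
  obtain ⟨σ, hσ, hw⟩ := Set.mem_iUnion₂.1 hall
  exact ⟨σ, hσ.1, hσ.2.2.1, hw⟩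

end Support

/-! ### The map `(u, v) ↦ (u - v, Q u)` and its index -/

section Degree

variable {V : Type*} [NormedAddCommGroup V] [NormedSpace ℝ V] {n : ℕ}
  (b : Module.Basis (Fin n) ℝ V) {ι : Type*}

/-- The differences of the coordinates of the two factors. -/
noncomputable def coordDiff (i : Fin n) : V × V →ₗ[ℝ] ℝ :=
  (b.coord i).comp (LinearMap.fst ℝ V V) - (b.coord i).comp (LinearMap.snd ℝ V V)

/-- The map `(u, v) ↦ (u - v, Q u)`. -/
noncomputable def doubleMap (Q : V →ₗ[ℝ] (ι → ℝ)) : V × V →ₗ[ℝ] (Fin n ⊕ ι → ℝ) :=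
  sumMap (coordDiff b) (Q.comp (LinearMap.fst ℝ V V))

lemma doubleMap_eq_iff (Q : V →ₗ[ℝ] (ι → ℝ)) {u : V × V} {w : Fin n ⊕ ι → ℝ} :
    doubleMap b Q u = w ↔ u.1 - u.2 = b.equivFun.symm (fun i => w (Sum.inl i)) ∧
      Q u.1 = fun i => w (Sum.inr i) := by
  rw [LinearEquiv.eq_symm_apply]
  constructor
  · rintro rfl
    refine ⟨?_, rfl⟩
    funext i
    simp [doubleMap, coordDiff]
  · rintro ⟨h1, h2⟩
    funext i
    rcases i with i | i
    · have := congrFun h1 i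
      simpa [doubleMap, coordDiff] using this
    · exact congrFun h2 i

lemma map_latticeSpan : (latticeSpan b).map b.equivFun.toLinearMap.toAddMonoidHom =
    intLattice (Fin n) := by
  ext w
  constructor
  · rintro ⟨u, hu, rfl⟩
    exact fun i => isIntegral_coord b i u hu
  · intro hw
    choose k hk using hw
    refine ⟨∑ i, k i • b i, AddSubgroup.sum_mem _ fun i _ => AddSubgroup.zsmul_mem _
      (AddSubgroup.subset_closure (Set.mem_range_self i)) _, ?_⟩
    funext i
    rw [hk]
    change b.equivFun (∑ i, k i • b i) i = _
    simp [Finsupp.single_apply]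

lemma isIntegralMap_doubleMap {Q : V →ₗ[ℝ] (ι → ℝ)} (hQ : IsIntegralMap (latticeSpan b) Q) :
    IsIntegralMap ((latticeSpan b).prod (latticeSpan b)) (doubleMap b Q) := by
  refine isIntegralMap_sumMap (fun i u hu => ?_) fun u hu => hQ u.1 hu.1
  obtain ⟨k, hk⟩ := isIntegral_coord b i u.1 hu.1
  obtain ⟨k', hk'⟩ := isIntegral_coord b i u.2 hu.2
  exact ⟨k - k', by simp only [coordDiff, LinearMap.sub_apply, LinearMap.comp_apply,
    LinearMap.fst_apply, LinearMap.snd_apply, hk, hk', Int.cast_sub]⟩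

variable [FiniteDimensional ℝ V]

-- Project the target to its first `n` coordinates. The image of `N_σ × N_τ` becomes `N_σ + N_τ`,
-- signs being immaterial in a group, while the kernel comes from the pairs with `u = v` and is
-- `Q(N_σ ∩ N_τ)`.
omit [FiniteDimensional ℝ V] in
lemma mapIndex_doubleMap {Q : V →ₗ[ℝ] (ι → ℝ)} (hQ : IsIntegralMap (latticeSpan b) Q)
    {σ τ : Set V} (hσ : σ.Nonempty) (hτ : τ.Nonempty) :
    mapIndex ((latticeSpan b).prod (latticeSpan b)) (doubleMap b Q) (σ ×ˢ τ) =
      (latticeOf (latticeSpan b) σ ⊔ latticeOf (latticeSpan b) τ).relIndex (latticeSpan b) *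
        ((latticeOf (latticeSpan b) σ ⊓ latticeOf (latticeSpan b) τ).map
          Q.toAddMonoidHom).relIndex (intLattice ι) := by
  have hM := isIntegralMap_doubleMap b hQ
  rw [mapIndex, relIndex_eq_map_mul_inf_ker
    (LinearMap.funLeft ℝ ℝ (Sum.inl : Fin n → Fin n ⊕ ι)).toAddMonoidHom (map_latticeOf_le hM _)]
  have e1 : (intLattice (Fin n ⊕ ι)).map
      (LinearMap.funLeft ℝ ℝ (Sum.inl : Fin n → Fin n ⊕ ι)).toAddMonoidHom =
      (latticeSpan b).map b.equivFun.toLinearMap.toAddMonoidHom := by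
    rw [map_latticeSpan]
    ext w
    constructor
    · rintro ⟨y, hy, rfl⟩
      exact fun i => hy _
    · intro hw
      refine ⟨Sum.elim w 0, ?_, rfl⟩
      rintro (i | i)
      · exact hw i
      · exact ⟨0, by simp⟩
  have e2 : ((latticeOf ((latticeSpan b).prod (latticeSpan b)) (σ ×ˢ τ)).map
      (doubleMap b Q).toAddMonoidHom).map
        (LinearMap.funLeft ℝ ℝ (Sum.inl : Fin n → Fin n ⊕ ι)).toAddMonoidHom =
      (latticeOf (latticeSpan b) σ ⊔ latticeOf (latticeSpan b) τ).map
        b.equivFun.toLinearMap.toAddMonoidHom := by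
    rw [latticeOf_prod hσ hτ]
    have hval : ∀ u v, LinearMap.funLeft ℝ ℝ (Sum.inl : Fin n → Fin n ⊕ ι)
        (doubleMap b Q (u, v)) = b.equivFun (u - v) := by
      intro u v
      funext i
      simp [doubleMap, coordDiff, LinearMap.funLeft_apply]
    ext w
    constructor
    · rintro ⟨_, ⟨⟨u, v⟩, ⟨hu, hv⟩, rfl⟩, rfl⟩
      refine ⟨u - v, ?_, (hval u v).symm⟩
      exact sub_mem (AddSubgroup.mem_sup_left hu) (AddSubgroup.mem_sup_right hv)
    · rintro ⟨y, hy, rfl⟩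
      obtain ⟨u, hu, v, hv, rfl⟩ := AddSubgroup.mem_sup.1 hy
      refine ⟨_, ⟨(u, -v), ⟨hu, AddSubgroup.neg_mem _ hv⟩, rfl⟩, ?_⟩
      refine (hval u (-v)).trans ?_
      rw [sub_neg_eq_add]
      rfl
  let j : (ι → ℝ) →ₗ[ℝ] (Fin n ⊕ ι → ℝ) :=
    LinearMap.pi (Sum.elim (fun _ => 0) fun i => LinearMap.proj i)
  have hj : Function.Injective j := fun x y h => funext fun i => congrFun h (Sum.inr i)
  have e3 : intLattice (Fin n ⊕ ι) ⊓
      (LinearMap.funLeft ℝ ℝ (Sum.inl : Fin n → Fin n ⊕ ι)).toAddMonoidHom.ker =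
      (intLattice ι).map j.toAddMonoidHom := by
    ext w
    constructor
    · rintro ⟨hw, hw0⟩
      refine ⟨fun i => w (Sum.inr i), fun i => hw _, ?_⟩
      funext i
      rcases i with i | i
      · exact (congrFun hw0 i).symm
      · rfl
    · rintro ⟨y, hy, rfl⟩
      refine ⟨?_, rfl⟩
      rintro (i | i)
      · exact ⟨0, by simp [j]⟩
      · exact hy i
  have e4 : (latticeOf ((latticeSpan b).prod (latticeSpan b)) (σ ×ˢ τ)).map
      (doubleMap b Q).toAddMonoidHom ⊓
      (LinearMap.funLeft ℝ ℝ (Sum.inl : Fin n → Fin n ⊕ ι)).toAddMonoidHom.ker =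
      ((latticeOf (latticeSpan b) σ ⊓ latticeOf (latticeSpan b) τ).map
          Q.toAddMonoidHom).map j.toAddMonoidHom := by
    rw [latticeOf_prod hσ hτ]
    ext w
    constructor
    · rintro ⟨⟨⟨u, v⟩, ⟨hu, hv⟩, hw⟩, hw0⟩
      obtain ⟨h1, h2⟩ := (doubleMap_eq_iff b Q).1 hw
      have h3 : (fun i => w (Sum.inl i)) = 0 := hw0
      rw [h3, map_zero, sub_eq_zero] at h1
      simp only at h1 h2 hu hv
      subst h1
      refine ⟨_, ⟨u, ⟨hu, hv⟩, rfl⟩, ?_⟩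
      funext i
      rcases i with i | i
      · exact (congrFun h3 i).symm
      · exact congrFun h2 i
    · rintro ⟨_, ⟨u, ⟨hu, hv⟩, rfl⟩, rfl⟩
      refine ⟨⟨(u, u), ⟨hu, hv⟩, ?_⟩, rfl⟩
      refine (doubleMap_eq_iff b Q).2 ⟨?_, rfl⟩
      rw [sub_self]
      exact (map_zero b.equivFun.symm).symm
  rw [e1, e2, e3, e4]
  congr 1
  · exact AddSubgroup.relIndex_map_map_of_injective _ _ b.equivFun.injective
  · exact AddSubgroup.relIndex_map_map_of_injective _ _ hj

end Degree

/-! ### Degrees and Minkowski multiplicities as sums over pairs of facets -/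

section ProductDegree

variable {V W : Type*} [NormedAddCommGroup V] [NormedSpace ℝ V] [FiniteDimensional ℝ V]
  [NormedAddCommGroup W] [NormedSpace ℝ W] [FiniteDimensional ℝ W]
  {Λ : AddSubgroup V} {Λ' : AddSubgroup W} {κ : Type*} [Fintype κ]

open Classical in
lemma WeightedComplex.localDegree_prod (X : WeightedComplex Λ) (Y : WeightedComplex Λ')
    (hd : X.d + Y.d = Fintype.card κ) (M : V × W →ₗ[ℝ] (κ → ℝ)) (ω : V × W) (w : κ → ℝ) :
    (X.prod Y).localDegree M ω w = ∑ p ∈ X.facetFinset ×ˢ Y.facetFinset,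
      if w ∈ M '' link ω (p.1 ×ˢ p.2) then
        X.weight p.1 * Y.weight p.2 * mapIndex (Λ.prod Λ') M (p.1 ×ˢ p.2) else 0 := by
  have himg : (X.prod Y).facetFinset =
      (X.facetFinset ×ˢ Y.facetFinset).image fun p => p.1 ×ˢ p.2 := by
    ext ρ
    simp only [mem_facetFinset, mem_prod_facets, Finset.mem_image, Finset.mem_product, Prod.exists]
    constructor
    · rintro ⟨σ, hσ, τ, hτ, rfl⟩
      exact ⟨σ, τ, ⟨hσ, hτ⟩, rfl⟩
    · rintro ⟨σ, τ, ⟨hσ, hτ⟩, rfl⟩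
      exact ⟨σ, hσ, τ, hτ, rfl⟩
  rw [(X.prod Y).localDegree_eq_sum hd, himg, Finset.sum_image]
  · refine Finset.sum_congr rfl fun p hp => ?_
    rw [Finset.mem_product, mem_facetFinset, mem_facetFinset] at hp
    rw [X.prod_weight Y (X.nonempty _ hp.1.1) (Y.nonempty _ hp.2.1)]
  · intro p hp q hq h
    simp only [Finset.mem_coe, Finset.mem_product, mem_facetFinset] at hp hq
    have h1 := congrArg (Set.image Prod.fst) h
    have h2 := congrArg (Set.image Prod.snd) h
    simp only at h1 h2
    rw [Set.fst_image_prod _ (Y.nonempty _ hp.2.1), Set.fst_image_prod _ (Y.nonempty _ hq.2.1)] at h1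
    rw [Set.snd_image_prod (X.nonempty _ hp.1.1), Set.snd_image_prod (X.nonempty _ hq.1.1)] at h2
    exact Prod.ext h1 h2

omit [FiniteDimensional ℝ V] in
open Classical in
lemma minkowskiMult_eq_sum (X Y : WeightedComplex Λ) (γ : Set V) (v : V) :
    minkowskiMult X Y γ v = ∑ p ∈ X.facetFinset ×ˢ Y.facetFinset,
      if γ ⊆ p.1 ∧ γ ⊆ p.2 ∧ v ∈ linkAlong γ p.1 - linkAlong γ p.2 then
        X.weight p.1 * Y.weight p.2 * ((latticeOf Λ p.1 ⊔ latticeOf Λ p.2).relIndex Λ : ℚ)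
      else 0 := by
  rw [minkowskiMult, ← Finset.sum_filter, ← finsum_mem_coe_finset]
  congr! 3 with p
  simp only [Finset.coe_filter, Finset.mem_product, WeightedComplex.mem_facetFinset,
    Set.mem_ofPred_eq, and_assoc]

end ProductDegree

/-! ### The degree of the product along the diagonal -/

section Transversal

variable {V : Type*} [NormedAddCommGroup V] [NormedSpace ℝ V] [FiniteDimensional ℝ V] {n : ℕ}
  (b : Module.Basis (Fin n) ℝ V) {ι : Type*} [Fintype ι]

omit [FiniteDimensional ℝ V] in
lemma sup_eq_top_of_relIndex_ne_zero {Λ : AddSubgroup V} [IsLattice Λ] {σ τ : Set V}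
    (h : (latticeOf Λ σ ⊔ latticeOf Λ τ).relIndex Λ ≠ 0) :
    vectorSpan ℝ σ ⊔ vectorSpan ℝ τ = ⊤ := by
  refine top_le_iff.1 ?_
  rw [← IsLattice.span_eq_top (Λ := Λ)]
  refine (span_eq_of_relIndex_ne_zero h).trans (Submodule.span_le.2 fun u hu => ?_)
  obtain ⟨x, hx, y, hy, rfl⟩ := AddSubgroup.mem_sup.1 hu
  exact Submodule.add_mem_sup hx.2 hy.2

lemma dim_inf_of_sup_eq_top {σ τ : Set V} (h : vectorSpan ℝ σ ⊔ vectorSpan ℝ τ = ⊤) :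
    (Module.finrank ℝ (vectorSpan ℝ σ ⊓ vectorSpan ℝ τ : Submodule ℝ V) : ℤ) =
      dim σ + dim τ - Module.finrank ℝ V := by
  have h1 := Submodule.finrank_sup_add_finrank_inf_eq (vectorSpan ℝ σ) (vectorSpan ℝ τ)
  rw [h, finrank_top] at h1
  unfold dim
  omega

variable {X Y : WeightedComplex (latticeSpan b)} {γ : Set V} {ω : V}

/-- Facets that meet along a cell of too large dimension do not contribute. -/
lemma localDegree_doubleMap_eq_zero {Q : V →ₗ[ℝ] (ι → ℝ)}
    (hQ : IsIntegralMap (latticeSpan b) Q)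
    (hX : ∀ σ ∈ X.facets, ω ∈ σ → γ ⊆ σ) (hY : ∀ τ ∈ Y.facets, ω ∈ τ → γ ⊆ τ)
    (hd : X.d + Y.d - Module.finrank ℝ V < dim γ) (w : Fin n ⊕ ι → ℝ) :
    (X.prod Y).localDegree (doubleMap b Q) (ω, ω) w = 0 := by
  classical
  by_cases hd' : X.d + Y.d = Fintype.card (Fin n ⊕ ι)
  swap
  · exact (X.prod Y).localDegree_eq_zero hd' _ _ _
  rw [X.localDegree_prod Y hd']
  refine Finset.sum_eq_zero fun p hp => ?_
  rw [Finset.mem_product, WeightedComplex.mem_facetFinset, WeightedComplex.mem_facetFinset] at hp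
  obtain ⟨hσ, hτ⟩ := hp
  rw [ite_eq_right_iff]
  rintro ⟨u, hu, -⟩
  rw [link_prod] at hu
  have h1 := hX _ hσ (mem_of_mem_link (X.polyhedral _ hσ.1) hu.1)
  have h2 := hY _ hτ (mem_of_mem_link (Y.polyhedral _ hτ.1) hu.2)
  rw [mapIndex_doubleMap b hQ (X.nonempty _ hσ.1) (Y.nonempty _ hτ.1)]
  by_cases h : (latticeOf (latticeSpan b) p.1 ⊔ latticeOf (latticeSpan b) p.2).relIndex
      (latticeSpan b) = 0
  · rw [h]
    simp
  -- A nonzero index makes the two spans transversal; their intersection then has the expected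
  -- dimension, too small to contain the directions of `γ`.
  · have h3 := dim_inf_of_sup_eq_top (sup_eq_top_of_relIndex_ne_zero h)
    rw [hσ.2, hτ.2] at h3
    have h4 := Submodule.finrank_mono (le_inf (vectorSpan_mono ℝ h1) (vectorSpan_mono ℝ h2))
    unfold dim at hd
    omega

/-- The local degree of the product at the diagonal computes the Minkowski multiplicity. -/
lemma localDegree_doubleMap_eq {Q : V →ₗ[ℝ] (ι → ℝ)} (hQ : IsIntegralMap (latticeSpan b) Q)
    (hX : ∀ σ ∈ X.facets, ω ∈ σ → γ ⊆ σ) (hY : ∀ τ ∈ Y.facets, ω ∈ τ → γ ⊆ τ)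
    (hγ : IsRationalPolyhedron (latticeSpan b) γ) (hω : ω ∈ intrinsicInterior ℝ γ)
    (hd : X.d + Y.d - Module.finrank ℝ V = dim γ) (hι : dim γ = Fintype.card ι)
    (htop : (vectorSpan ℝ γ).map Q = ⊤) (w : Fin n ⊕ ι → ℝ) :
    (X.prod Y).localDegree (doubleMap b Q) (ω, ω) w =
      minkowskiMult X Y γ (b.equivFun.symm fun i => w (Sum.inl i)) *
        mapIndex (latticeSpan b) Q γ := by
  classical
  have hn : Module.finrank ℝ V = n := by
    rw [Module.finrank_eq_card_basis b, Fintype.card_fin]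
  have hd' : X.d + Y.d = Fintype.card (Fin n ⊕ ι) := by
    rw [Fintype.card_sum, Fintype.card_fin]
    push_cast
    omega
  rw [X.localDegree_prod Y hd', minkowskiMult_eq_sum, Finset.sum_mul]
  refine Finset.sum_congr rfl fun p hp => ?_
  rw [Finset.mem_product, WeightedComplex.mem_facetFinset, WeightedComplex.mem_facetFinset] at hp
  obtain ⟨hσ, hτ⟩ := hp
  rw [mapIndex_doubleMap b hQ (X.nonempty _ hσ.1) (Y.nonempty _ hτ.1)]
  by_cases h : (latticeOf (latticeSpan b) p.1 ⊔ latticeOf (latticeSpan b) p.2).relIndex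
      (latticeSpan b) = 0
  · rw [h]
    simp
  have h3 := dim_inf_of_sup_eq_top (sup_eq_top_of_relIndex_ne_zero h)
  rw [hσ.2, hτ.2, hd] at h3
  have hiff : w ∈ doubleMap b Q '' link (ω, ω) (p.1 ×ˢ p.2) ↔ γ ⊆ p.1 ∧ γ ⊆ p.2 ∧
      (b.equivFun.symm fun i => w (Sum.inl i)) ∈ linkAlong γ p.1 - linkAlong γ p.2 := by
    rw [link_prod]
    constructor
    · rintro ⟨u, ⟨hu1, hu2⟩, huw⟩
      have h1 := hX _ hσ (mem_of_mem_link (X.polyhedral _ hσ.1) hu1)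
      have h2 := hY _ hτ (mem_of_mem_link (Y.polyhedral _ hτ.1) hu2)
      refine ⟨h1, h2, ?_⟩
      rw [linkAlong_eq (X.polyhedral _ hσ.1) hγ h1 hω, linkAlong_eq (Y.polyhedral _ hτ.1) hγ h2 hω]
      exact ⟨u.1, hu1, u.2, hu2, ((doubleMap_eq_iff b Q).1 huw).1⟩
    · rintro ⟨h1, h2, hv⟩
      rw [linkAlong_eq (X.polyhedral _ hσ.1) hγ h1 hω,
        linkAlong_eq (Y.polyhedral _ hτ.1) hγ h2 hω] at hv
      obtain ⟨u, hu, u', hu', huv⟩ := hv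
      -- Translating `u` and `u'` by the same vector parallel to `γ` keeps them in the links and
      -- keeps their difference, while `Q u` can be given any value.
      have hmem : (fun i => w (Sum.inr i)) - Q u ∈ (vectorSpan ℝ γ).map Q := htop ▸ Submodule.mem_top
      obtain ⟨y, hy, hQy⟩ := hmem
      have hyγ : y ∈ link ω γ := by
        rw [link_of_relint hγ hω]
        exact hy
      have hωγ := intrinsicInterior_subset hω
      refine ⟨(u + y, u' + y),
        ⟨link_add (X.polyhedral _ hσ.1) (h1 hωγ) hu (link_mono h1 hyγ),
          link_add (Y.polyhedral _ hτ.1) (h2 hωγ) hu' (link_mono h2 hyγ)⟩,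
        (doubleMap_eq_iff b Q).2 ⟨?_, ?_⟩⟩
      · rw [← huv]
        simp
      · rw [map_add, hQy]
        abel
  by_cases hw : w ∈ doubleMap b Q '' link (ω, ω) (p.1 ×ˢ p.2)
  · rw [if_pos hw, if_pos (hiff.1 hw)]
    obtain ⟨h1, h2, -⟩ := hiff.1 hw
    have hspan : vectorSpan ℝ γ = vectorSpan ℝ p.1 ⊓ vectorSpan ℝ p.2 :=
      Submodule.eq_of_le_of_finrank_eq (le_inf (vectorSpan_mono ℝ h1) (vectorSpan_mono ℝ h2)) (by
        unfold dim at h3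
        exact_mod_cast h3.symm)
    have hlat : latticeOf (latticeSpan b) p.1 ⊓ latticeOf (latticeSpan b) p.2 =
        latticeOf (latticeSpan b) γ := by
      ext u
      rw [latticeOf, latticeOf, latticeOf, hspan]
      exact ⟨fun h => ⟨h.1.1, h.1.2, h.2.2⟩, fun h => ⟨⟨h.1, h.2.1⟩, h.1, h.2.2⟩⟩
    rw [hlat, mapIndex]
    push_cast
    ring
  · rw [if_neg hw, if_neg (mt hiff.2 hw), zero_mul]

end Transversal

/-! ### Local degrees of the stable intersection -/

section Main

variable {V : Type*} [NormedAddCommGroup V] [NormedSpace ℝ V] [FiniteDimensional ℝ V] {n : ℕ}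
  (b : Module.Basis (Fin n) ℝ V) {ι : Type*} [Fintype ι]
  {X Y : WeightedComplex (latticeSpan b)} {γ : Set V} {ω : V}

/-- A nonzero generic degree puts `ω` into the support of the stable intersection. -/
lemma mem_stableSupport_of_isGenericValue {Q : V →ₗ[ℝ] (ι → ℝ)} {m : ℚ}
    (hm : IsGenericValue ((X.prod Y).localDegree (doubleMap b Q) (ω, ω)) m) (hm0 : m ≠ 0) :
    ω ∈ stableSupport X Y := by
  refine Set.eq_univ_of_forall fun v => ?_
  obtain ⟨ρ, hρ, hne, u, hu, huw⟩ := WeightedComplex.exists_facet_of_isGenericValue hm hm0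
    (Sum.elim (b.equivFun v) fun _ => 0)
  obtain ⟨σ, hσ, τ, hτ, rfl⟩ := WeightedComplex.mem_prod_facets.1 hρ
  rw [X.prod_weight Y (X.nonempty _ hσ.1) (Y.nonempty _ hτ.1)] at hne
  rw [link_prod] at hu
  refine ⟨u.1, ⟨σ, hσ, left_ne_zero_of_mul hne, mem_of_mem_link (X.polyhedral _ hσ.1) hu.1, hu.1⟩,
    u.2, ⟨τ, hτ, right_ne_zero_of_mul hne, mem_of_mem_link (Y.polyhedral _ hτ.1) hu.2, hu.2⟩, ?_⟩
  refine ((doubleMap_eq_iff b Q).1 huw).1.trans ?_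
  exact b.equivFun.symm_apply_apply v

omit [FiniteDimensional ℝ V] in
/-- The stable support contains a cell as soon as it contains a relative interior point. -/
lemma subset_stableSupport (hX : ∀ σ ∈ X.facets, ω ∈ σ → γ ⊆ σ)
    (hY : ∀ τ ∈ Y.facets, ω ∈ τ → γ ⊆ τ) (hω : ω ∈ stableSupport X Y) :
    γ ⊆ stableSupport X Y := by
  refine fun ω' hω' => Set.eq_univ_of_forall fun v => ?_
  have hv : v ∈ X.linkSupport ω - Y.linkSupport ω := by
    rw [show X.linkSupport ω - Y.linkSupport ω = Set.univ from hω]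
    trivial
  obtain ⟨u, ⟨σ, hσ, hσ0, hωσ, δ, hδ, hu⟩, u', ⟨τ, hτ, hτ0, hωτ, δ', hδ', hu'⟩, rfl⟩ := hv
  have hσω' := hX σ hσ hωσ hω'
  have hτω' := hY τ hτ hωτ hω'
  -- Seen from `ω'`, the points `ω + ε • u` and `ω + ε • u'` of `σ` and `τ` are link directions;
  -- their difference, rescaled by `ε⁻¹`, is `u - u'` again.
  set ε := min δ δ' / 2 with hε
  have hε0 : 0 < ε := half_pos (lt_min hδ hδ')
  have hε1 : ε < min δ δ' := half_lt_self (lt_min hδ hδ')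
  have h1 := sub_mem_link (X.polyhedral σ hσ.1) hσω'
    (hu ε hε0 (hε1.trans_le (min_le_left _ _)))
  have h2 := sub_mem_link (Y.polyhedral τ hτ.1) hτω'
    (hu' ε hε0 (hε1.trans_le (min_le_right _ _)))
  refine ⟨_, ⟨σ, hσ, hσ0, hσω', link_smul (X.polyhedral σ hσ.1) hσω' (inv_pos.2 hε0).le h1⟩, _,
    ⟨τ, hτ, hτ0, hτω', link_smul (Y.polyhedral τ hτ.1) hτω' (inv_pos.2 hε0).le h2⟩, ?_⟩
  change ε⁻¹ • (ω + ε • u - ω') - ε⁻¹ • (ω + ε • u' - ω') = u - u'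
  rw [← smul_sub, sub_sub_sub_cancel_right, add_sub_add_left_eq_sub, ← smul_sub,
    inv_smul_smul₀ hε0.ne']

/-- The function depends on `w` only through a surjective linear map to `V`, and such a map takes
dense open sets to dense open sets. -/
lemma isGenericValue_of_mul {f : V → ℚ} {c : ℚ} (hc : c ≠ 0) {m : ℚ}
    (hm : IsGenericValue
      (fun w : Fin n ⊕ ι → ℝ => f (b.equivFun.symm fun i => w (Sum.inl i)) * c) m) :
    IsGenericValue f (m / c) := by
  let g : (Fin n ⊕ ι → ℝ) →ₗ[ℝ] V := b.equivFun.symm.toLinearMap.comp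
    (LinearMap.funLeft ℝ ℝ (Sum.inl : Fin n → Fin n ⊕ ι))
  have hg : Function.Surjective g :=
    b.equivFun.symm.surjective.comp (LinearMap.funLeft_surjective_of_injective ℝ ℝ _ Sum.inl_injective)
  obtain ⟨U, hUo, hUd, hU⟩ := hm
  refine ⟨g '' U, g.isOpenMap_of_finiteDimensional hg U hUo,
    hg.denseRange.dense_image g.continuous_of_finiteDimensional hUd, ?_⟩
  rintro _ ⟨w, hw, rfl⟩
  rw [eq_div_iff hc]
  exact hU w hw

/-- The generic degree of the product at the diagonal is the degree of the stable intersection. -/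
lemma localDegree_stableIntersection {C : PolyComplex (latticeSpan b)}
    (hC : ∀ σ ∈ (X.toPolyComplex.inter Y.toPolyComplex).cells, C.Refines σ)
    (hγ : γ ∈ C.cells) (hω : ω ∈ intrinsicInterior ℝ γ) {Q : V →ₗ[ℝ] (ι → ℝ)}
    (hQ : IsIntegralMap (latticeSpan b) Q) (hd : dim γ = Fintype.card ι)
    (htop : (vectorSpan ℝ γ).map Q = ⊤) {m : ℚ}
    (hm : IsGenericValue ((X.prod Y).localDegree (doubleMap b Q) (ω, ω)) m) (w : ι → ℝ) :
    (stableIntersection X Y).localDegree Q ω w = m := by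
  classical
  have hm0 : (∀ w, (X.prod Y).localDegree (doubleMap b Q) (ω, ω) w = 0) → m = 0 := fun h =>
    hm.unique ⟨Set.univ, isOpen_univ, dense_univ, fun w _ => h w⟩
  have hn : Module.finrank ℝ V = n := by
    rw [Module.finrank_eq_card_basis b, Fintype.card_fin]
  by_cases hr : X.d + Y.d - Module.finrank ℝ V = Fintype.card ι
  swap
  · rw [(stableIntersection X Y).localDegree_eq_zero hr, hm0 fun w => ?_]
    refine (X.prod Y).localDegree_eq_zero ?_ _ _ _
    change X.d + Y.d ≠ _
    rw [Fintype.card_sum, Fintype.card_fin]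
    push_cast
    omega
  by_cases hωI : ∃ κ ∈ (X.toPolyComplex.inter Y.toPolyComplex).cells, ω ∈ κ
  swap
  · have h1 : (stableIntersection X Y).localDegree Q ω w = 0 := by
      refine finsum_mem_eq_zero_of_forall_eq_zero fun κ hκ => ?_
      obtain ⟨hκ, -, u, hu, -⟩ := hκ
      exact absurd ⟨κ, hκ.1.1, mem_of_mem_link ((stableIntersection X Y).polyhedral κ hκ.1) hu⟩ hωI
    rw [h1, hm0 fun w => ?_]
    refine finsum_mem_eq_zero_of_forall_eq_zero fun ρ hρ => ?_
    obtain ⟨hρ, -, u, hu, -⟩ := hρ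
    obtain ⟨σ, hσ, τ, hτ, rfl⟩ := WeightedComplex.mem_prod_facets.1 hρ
    rw [link_prod] at hu
    have h1 := mem_of_mem_link (X.polyhedral _ hσ.1) hu.1
    have h2 := mem_of_mem_link (Y.polyhedral _ hτ.1) hu.2
    exact absurd ⟨σ ∩ τ, PolyComplex.mem_inter_cells hσ.1 hτ.1 ⟨ω, h1, h2⟩, h1, h2⟩ hωI
  obtain ⟨κ, hκ, hωκ⟩ := hωI
  -- `γ₀` is the smallest cell of the common refinement through `ω`, so it lies in all facets
  -- through `ω`; weights of the stable intersection belong to such cells, not to the cells `γ` of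
  -- the finer `C`.
  obtain ⟨γ₀, hγ₀, -, hω₀⟩ := PolyComplex.exists_relint _ hκ hωκ
  have hmin : ∀ κ ∈ (X.toPolyComplex.inter Y.toPolyComplex).cells, ω ∈ κ → γ₀ ⊆ κ :=
    fun κ hκ hωκ => PolyComplex.subset_of_relint _ hγ₀ hκ hω₀ hωκ
  have hω₀' := intrinsicInterior_subset hω₀
  obtain ⟨-, σ₀, hσ₀, τ₀, hτ₀, heq⟩ := id hγ₀
  have hmem₀ : ω ∈ σ₀ ∩ τ₀ := heq ▸ hω₀'
  have hminX : ∀ σ ∈ X.facets, ω ∈ σ → γ₀ ⊆ σ := fun σ hσ hωσ =>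
    (hmin _ (PolyComplex.mem_inter_cells hσ.1 hτ₀ ⟨ω, hωσ, hmem₀.2⟩) ⟨hωσ, hmem₀.2⟩).trans
      Set.inter_subset_left
  have hminY : ∀ τ ∈ Y.facets, ω ∈ τ → γ₀ ⊆ τ := fun τ hτ hωτ =>
    (hmin _ (PolyComplex.mem_inter_cells hσ₀ hτ.1 ⟨ω, hmem₀.1, hωτ⟩) ⟨hmem₀.1, hωτ⟩).trans
      Set.inter_subset_right
  have hγγ₀ : γ ⊆ γ₀ := hC γ₀ hγ₀ γ hγ ω hω hω₀'
  have hle := dim_mono hγγ₀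
  have hpoly := PolyComplex.polyhedral _ γ₀ hγ₀
  -- If `γ₀` is larger than the expected dimension, both degrees vanish: no facet of the stable
  -- intersection can contain it, and transversal pairs of facets meet in too small a dimension.
  rcases hle.lt_or_eq with hlt | hdim
  · rw [hm0 fun w => localDegree_doubleMap_eq_zero b hQ hminX hminY (by rw [hr, ← hd]; exact hlt) w]
    refine finsum_mem_eq_zero_of_forall_eq_zero fun κ hκ => ?_
    obtain ⟨hκ, hdκ, u, hu, -⟩ := hκ
    have h1 := dim_mono (hmin κ hκ.1.1
      (mem_of_mem_link ((stableIntersection X Y).polyhedral κ hκ.1) hu))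
    omega
  have htop₀ : (vectorSpan ℝ γ₀).map Q = ⊤ :=
    top_le_iff.1 (htop ▸ Submodule.map_mono (vectorSpan_mono ℝ hγγ₀))
  have hd₀ : dim γ₀ = Fintype.card ι := hdim ▸ hd
  have hidx : (mapIndex (latticeSpan b) Q γ₀ : ℚ) ≠ 0 := Nat.cast_ne_zero.2
    (mapIndex_ne_zero hpoly ⟨ω, hω₀'⟩ hQ htop₀)
  have hformula := localDegree_doubleMap_eq b hQ hminX hminY hpoly hω₀ (hr.trans hd₀.symm) hd₀ htop₀
  have hgen : IsGenericValue (minkowskiMult X Y γ₀) (m / mapIndex (latticeSpan b) Q γ₀) :=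
    isGenericValue_of_mul (ι := ι) b hidx
      (hm.congr ⟨Set.univ, isOpen_univ, dense_univ, fun w _ => hformula w⟩)
  have hfac : ∀ κ ∈ (stableIntersection X Y).facets, ω ∈ κ → κ = γ₀ := by
    intro κ hκ hωκ
    refine (PolyComplex.eq_of_dim_le _ hγ₀ hκ.1.1 (hmin κ hκ.1.1 hωκ) ?_).symm
    rw [hκ.2, hd₀]
    exact hr.le
  rw [(stableIntersection X Y).localDegree_eq_sum hr]
  by_cases hmem : γ₀ ∈ (stableIntersection X Y).facets
  · rw [Finset.sum_eq_single_of_mem γ₀ (WeightedComplex.mem_facetFinset.2 hmem)]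
    · have hw : w ∈ Q '' link ω γ₀ := by
        have : w ∈ (vectorSpan ℝ γ₀).map Q := htop₀ ▸ Submodule.mem_top
        obtain ⟨u, hu, rfl⟩ := this
        refine ⟨u, ?_, rfl⟩
        rw [link_of_relint hpoly hω₀]
        exact hu
      rw [if_pos hw]
      -- The weight is a chosen generic value; existence comes from the degree of the product and
      -- uniqueness makes the choice harmless.
      have hweight : (stableIntersection X Y).weight γ₀ = m / mapIndex (latticeSpan b) Q γ₀ :=
        (Classical.epsilon_spec (p := IsGenericValue (minkowskiMult X Y γ₀)) ⟨_, hgen⟩).unique hgen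
      rw [hweight, div_mul_cancel₀ _ hidx]
    · intro κ hκ hne
      rw [if_neg]
      rintro ⟨u, hu, -⟩
      rw [WeightedComplex.mem_facetFinset] at hκ
      exact hne (hfac κ hκ (mem_of_mem_link ((stableIntersection X Y).polyhedral κ hκ.1) hu))
  -- A nonzero degree would put `ω`, and with it all of `γ₀`, into the stable support and make `γ₀`
  -- a facet.
  · have hzero : m = 0 := by
      by_contra hne
      refine hmem ⟨⟨hγ₀, γ₀, hγ₀, subset_rfl, hd₀.trans hr.symm, ?_⟩, hd₀.trans hr.symm⟩
      exact subset_stableSupport b hminX hminY (mem_stableSupport_of_isGenericValue b hm hne)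
    rw [hzero]
    refine Finset.sum_eq_zero fun κ hκ => ?_
    rw [WeightedComplex.mem_facetFinset] at hκ
    rw [if_neg]
    rintro ⟨u, hu, -⟩
    exact hmem (hfac κ hκ (mem_of_mem_link ((stableIntersection X Y).polyhedral κ hκ.1) hu) ▸ hκ)

end Main

/-! ### Comparison of the two products -/

section AllermannRau

variable {V : Type*} [NormedAddCommGroup V] [NormedSpace ℝ V] [FiniteDimensional ℝ V] {n : ℕ}
  {b : Module.Basis (Fin n) ℝ V} {ι : Type*} [Fintype ι]
  {X Y P : WeightedComplex (latticeSpan b)}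

lemma isAllermannRauProduct_iff : IsAllermannRauProduct b X Y P ↔
    ∃ D : Fin (n + 1) → WeightedComplex ((latticeSpan b).prod (latticeSpan b)),
      D 0 = X.prod Y ∧ IsDivisorChain D (fun i => (b.coord i).comp (LinearMap.fst ℝ V V))
        (fun i => (b.coord i).comp (LinearMap.snd ℝ V V)) ∧
      IsPushforward (LinearMap.fst ℝ V V) (D (Fin.last n)) P := by
  constructor
  · rintro ⟨D, h0, h1, h2⟩
    refine ⟨D, h0, ⟨fun i u hu => ?_, h1⟩, h2⟩
    obtain ⟨k, hk⟩ := isIntegral_coord b i u.1 hu.1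
    obtain ⟨k', hk'⟩ := isIntegral_coord b i u.2 hu.2
    exact ⟨k - k', by simp only [LinearMap.sub_apply, LinearMap.comp_apply,
      LinearMap.fst_apply, LinearMap.snd_apply, hk, hk', Int.cast_sub]⟩
  · rintro ⟨D, h0, h1, h2⟩
    exact ⟨D, h0, h1.isDivisor, h2⟩

lemma support_subset_diagonal {D : Fin (n + 1) → WeightedComplex ((latticeSpan b).prod (latticeSpan b))}
    (h : IsDivisorChain D (fun i => (b.coord i).comp (LinearMap.fst ℝ V V))
        (fun i => (b.coord i).comp (LinearMap.snd ℝ V V))) :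
    (D (Fin.last n)).support ⊆ {p | p.1 = p.2} := by
  intro p hp
  exact b.ext_elem_iff.2 fun i => h.support_subset hp i

lemma IsAllermannRauProduct.isGenericValue (h : IsAllermannRauProduct b X Y P)
    {Q : V →ₗ[ℝ] (ι → ℝ)} (hQ : IsIntegralMap (latticeSpan b) Q) {ω : V} {m : ℚ}
    (hm : IsGenericValue ((X.prod Y).localDegree (doubleMap b Q) (ω, ω)) m) :
    IsGenericValue (P.localDegree Q ω) m := by
  obtain ⟨D, h0, hD, hP⟩ := isAllermannRauProduct_iff.1 h
  refine hP.isGenericValue (support_subset_diagonal hD) ?_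
  refine hD.isGenericValue (fun u hu => hQ u.1 hu.1) (fun i => rfl) ?_
  rw [h0]
  exact hm

/-- On a complete complex refining both sides, both degrees at `ω` are the generic degree of `X × Y`
at `(ω, ω)` under `doubleMap`, which exists because products of balanced complexes are balanced. -/
theorem IsAllermannRauProduct.sameCycle (hX : X.IsBalanced) (hY : Y.IsBalanced)
    (h : IsAllermannRauProduct b X Y P) : P.SameCycle (stableIntersection X Y) := by
  obtain ⟨C, hC, href⟩ := exists_refining_complex
    (P.cells ∪ (X.toPolyComplex.inter Y.toPolyComplex).cells)
    (P.finite.union (PolyComplex.finite _))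
    (fun R hR => hR.elim (P.polyhedral R) (PolyComplex.polyhedral _ R))
  refine WeightedComplex.sameCycle_of_localDegree hC (fun σ hσ => href σ (Or.inl hσ))
    (fun σ hσ => href σ (Or.inr hσ.1)) fun γ hγ ω hω r Q hQ hd htop => ?_
  obtain ⟨m, hm⟩ := (hX.prod hY).exists_isGenericValue (isIntegralMap_doubleMap b hQ) (ω, ω)
  obtain ⟨U, -, hU, hUm⟩ := h.isGenericValue hQ hm
  obtain ⟨w, hw⟩ := hU.nonempty
  refine ⟨w, (hUm w hw).trans ?_⟩
  exact (localDegree_stableIntersection b (fun σ hσ => href σ (Or.inr hσ)) hγ hω hQ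
    (by rw [hd, Fintype.card_fin]) htop hm w).symm

/-- Some product exists, and it is the same cycle as the stable intersection, hence as `P`; the
definition of push-forward allows `P` in its place. -/
theorem isAllermannRauProduct_of_sameCycle (hX : X.IsBalanced) (hY : Y.IsBalanced)
    (h : P.SameCycle (stableIntersection X Y)) : IsAllermannRauProduct b X Y P := by
  have hfst : ∀ i, IsIntegral ((latticeSpan b).prod (latticeSpan b))
      ((b.coord i).comp (LinearMap.fst ℝ V V)) := fun i u hu => isIntegral_coord b i u.1 hu.1
  have hsnd : ∀ i, IsIntegral ((latticeSpan b).prod (latticeSpan b))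
      ((b.coord i).comp (LinearMap.snd ℝ V V)) := fun i u hu => isIntegral_coord b i u.2 hu.2
  obtain ⟨D, h0, hD⟩ := exists_isDivisorChain (hX.prod hY) hfst hsnd
  obtain ⟨P', hP'⟩ := exists_isPushforward (hD.isBalanced (h0 ▸ hX.prod hY))
    (support_subset_diagonal hD)
  have hprod : IsAllermannRauProduct b X Y P' := isAllermannRauProduct_iff.2 ⟨D, h0, hD, hP'⟩
  exact isAllermannRauProduct_iff.2
    ⟨D, h0, hD, hP'.congr ((hprod.sameCycle hX hY).trans h.symm)⟩

omit [FiniteDimensional ℝ V] in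
lemma support_stableIntersection_subset :
    (stableIntersection X Y).support ⊆ stableSupport X Y := by
  rintro ω ⟨γ, ⟨⟨-, γ', -, hsub, -, hS⟩, -⟩, -, hω⟩
  exact hS (hsub hω)

/-- For nonnegative weights the stable support is contained in the support of the product. -/
lemma IsAllermannRauProduct.stableSupport_subset (hX : X.IsBalanced) (hY : Y.IsBalanced)
    (h : IsAllermannRauProduct b X Y P) (hX0 : ∀ σ ∈ X.facets, 0 ≤ X.weight σ)
    (hY0 : ∀ τ ∈ Y.facets, 0 ≤ Y.weight τ) : stableSupport X Y ⊆ P.support := by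
  classical
  intro ω hω
  obtain ⟨σ, hσ, hσ0, hωσ, τ, hτ, hτ0, hωτ, hsup⟩ : ∃ σ ∈ X.facets, X.weight σ ≠ 0 ∧ ω ∈ σ ∧
      ∃ τ ∈ Y.facets, Y.weight τ ≠ 0 ∧ ω ∈ τ ∧ vectorSpan ℝ σ ⊔ vectorSpan ℝ τ = ⊤ := by
    -- Without a transversal pair of facets through `ω`, the difference of the link supports would
    -- lie in finitely many proper subspaces and could not be everything.
    by_contra hcon
    push Not at hcon
    obtain ⟨v, hv⟩ := (isOpen_dense_compl_submodules
      ((fun p : Set V × Set V => vectorSpan ℝ p.1 ⊔ vectorSpan ℝ p.2) ''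
        {p | p.1 ∈ X.cells ∧ p.2 ∈ Y.cells ∧ vectorSpan ℝ p.1 ⊔ vectorSpan ℝ p.2 ≠ ⊤})
      (((X.finite.prod Y.finite).subset fun p hp => ⟨hp.1, hp.2.1⟩).image _)
      (by rintro _ ⟨p, hp, rfl⟩; exact hp.2.2)).2.nonempty
    have hmem : v ∈ X.linkSupport ω - Y.linkSupport ω := by
      rw [show X.linkSupport ω - Y.linkSupport ω = Set.univ from hω]
      trivial
    obtain ⟨u, ⟨σ, hσ, hσ0, hωσ, hu⟩, u', ⟨τ, hτ, hτ0, hωτ, hu'⟩, rfl⟩ := hmem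
    refine hv _ ⟨(σ, τ), ⟨hσ.1, hτ.1, hcon σ hσ hσ0 hωσ τ hτ hτ0 hωτ⟩, rfl⟩ ?_
    exact Submodule.sub_mem _ (Submodule.mem_sup_left (mem_vectorSpan_of_mem_link hu))
      (Submodule.mem_sup_right (mem_vectorSpan_of_mem_link hu'))
  have hn : Module.finrank ℝ V = n := by
    rw [Module.finrank_eq_card_basis b, Fintype.card_fin]
  set L := vectorSpan ℝ σ ⊓ vectorSpan ℝ τ with hL
  obtain ⟨Q, hQ, hQL⟩ := exists_integralMap (latticeSpan b) L
  have hM := isIntegralMap_doubleMap b hQ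
  have hdim := dim_inf_of_sup_eq_top hsup
  rw [hσ.2, hτ.2, ← hL, hn] at hdim
  have hd : X.d + Y.d = Fintype.card (Fin n ⊕ Fin (Module.finrank ℝ L)) := by
    rw [Fintype.card_sum, Fintype.card_fin, Fintype.card_fin]
    push_cast
    omega
  have hρ : σ ×ˢ τ ∈ (X.prod Y).cells := ⟨σ, hσ.1, τ, hτ.1, rfl⟩
  have htop : (vectorSpan ℝ (σ ×ˢ τ)).map (doubleMap b Q) = ⊤ := by
    rw [vectorSpan_prod ⟨ω, hωσ⟩ ⟨ω, hωτ⟩]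
    refine top_le_iff.1 fun w _ => ?_
    have h1 : (b.equivFun.symm fun i => w (Sum.inl i)) ∈ vectorSpan ℝ σ ⊔ vectorSpan ℝ τ :=
      hsup ▸ Submodule.mem_top
    obtain ⟨u, hu, u', hu', huv⟩ := Submodule.mem_sup.1 h1
    have h2 : (fun i => w (Sum.inr i)) - Q u ∈ L.map Q := hQL ▸ Submodule.mem_top
    obtain ⟨y, hy, hQy⟩ := h2
    refine ⟨(u + y, -u' + y), ⟨Submodule.add_mem _ hu hy.1,
      Submodule.add_mem _ (Submodule.neg_mem _ hu') hy.2⟩, (doubleMap_eq_iff b Q).2 ⟨?_, ?_⟩⟩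
    · rw [← huv]
      simp
    · rw [map_add, hQy]
      abel
  -- A direction into `σ × τ` in general position has a generic image `w`. Over it the pair `(σ, τ)`
  -- contributes a positive term and no term is negative, so the generic degree is positive.
  obtain ⟨y, hy, hyF⟩ := exists_generic_sub ((X.prod Y).polyhedral _ hρ) ⟨(ω, ω), hωσ, hωτ⟩ (ω, ω)
    ((fun κ => ((vectorSpan ℝ κ).map (doubleMap b Q)).comap (doubleMap b Q)) ''
      {κ | κ ∈ (X.prod Y).cells ∧ (vectorSpan ℝ κ).map (doubleMap b Q) ≠ ⊤})
    (((X.prod Y).finite.subset fun κ h => h.1).image _) (by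
      rintro _ ⟨κ, ⟨-, hκ⟩, rfl⟩ hle
      exact hκ (top_le_iff.1 (htop ▸ Submodule.map_le_iff_le_comap.2 hle)))
  set w := doubleMap b Q (y - (ω, ω)) with hw
  have hgen : (X.prod Y).IsGenericFor (doubleMap b Q) w := fun κ hκ hne hmem =>
    hyF _ ⟨κ, ⟨hκ, hne⟩, rfl⟩ hmem
  have hmemw : w ∈ doubleMap b Q '' link (ω, ω) (σ ×ˢ τ) :=
    ⟨_, sub_mem_link ((X.prod Y).polyhedral _ hρ) ⟨hωσ, hωτ⟩ hy, rfl⟩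
  have hpos : 0 < (X.prod Y).localDegree (doubleMap b Q) (ω, ω) w := by
    rw [X.localDegree_prod Y hd]
    refine Finset.sum_pos' (fun p hp => ?_) ⟨(σ, τ), ?_, ?_⟩
    · rw [Finset.mem_product, WeightedComplex.mem_facetFinset, WeightedComplex.mem_facetFinset] at hp
      have h1 := hX0 _ hp.1
      have h2 := hY0 _ hp.2
      split_ifs
      · positivity
      · exact le_rfl
    · rw [Finset.mem_product, WeightedComplex.mem_facetFinset, WeightedComplex.mem_facetFinset]
      exact ⟨hσ, hτ⟩
    · rw [if_pos hmemw]
      have h1 : 0 < X.weight σ := lt_of_le_of_ne (hX0 σ hσ) hσ0.symm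
      have h2 : 0 < Y.weight τ := lt_of_le_of_ne (hY0 τ hτ) hτ0.symm
      have h3 : 0 < mapIndex ((latticeSpan b).prod (latticeSpan b)) (doubleMap b Q) (σ ×ˢ τ) :=
        Nat.pos_of_ne_zero (mapIndex_ne_zero ((X.prod Y).polyhedral _ hρ)
          ⟨(ω, ω), hωσ, hωτ⟩ hM htop)
      have h4 : (0 : ℚ) < mapIndex ((latticeSpan b).prod (latticeSpan b)) (doubleMap b Q)
        (σ ×ˢ τ) := by exact_mod_cast h3
      positivity
  obtain ⟨m, hm⟩ := (hX.prod hY).exists_isGenericValue hM (ω, ω)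
  have hm0 : m ≠ 0 := by
    obtain ⟨hgo, hgd⟩ := (X.prod Y).isOpen_dense_isGenericFor (doubleMap b Q)
    have : IsGenericValue ((X.prod Y).localDegree (doubleMap b Q) (ω, ω))
        ((X.prod Y).localDegree (doubleMap b Q) (ω, ω) w) :=
      ⟨_, hgo, hgd, fun w' hw' => (hX.prod hY).localDegree_eq hM (ω, ω) hw' hgen⟩
    rw [hm.unique this]
    exact hpos.ne'
  obtain ⟨ρ, hρ, hρ0, u, hu, -⟩ := WeightedComplex.exists_facet_of_isGenericValue
    (h.isGenericValue hQ hm) hm0 0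
  exact ⟨ρ, hρ, hρ0, mem_of_mem_link (P.polyhedral ρ hρ.1) hu⟩

end AllermannRau

end TropInt

/-- That the support lies in the stable support holds for all weights, facets of the stable
intersection being chosen inside it; only the opposite inclusion uses nonnegativity. -/
theorem mainTheorem11 {V : Type*} [NormedAddCommGroup V] [NormedSpace ℝ V]
    [FiniteDimensional ℝ V] {n : ℕ} (b : Module.Basis (Fin n) ℝ V)
    (X Y : TropInt.WeightedComplex (TropInt.latticeSpan b))
    (hX : X.IsBalanced) (hY : Y.IsBalanced) :
    ∀ P : TropInt.WeightedComplex (TropInt.latticeSpan b),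
      (TropInt.IsAllermannRauProduct b X Y P ↔
        P.SameCycle (TropInt.stableIntersection X Y)) ∧
      (TropInt.IsAllermannRauProduct b X Y P →
        (∀ σ ∈ X.facets, 0 ≤ X.weight σ) → (∀ τ ∈ Y.facets, 0 ≤ Y.weight τ) →
          P.support = TropInt.stableSupport X Y) := fun _ =>
  ⟨⟨fun h => h.sameCycle hX hY, TropInt.isAllermannRauProduct_of_sameCycle hX hY⟩,
    fun h hX0 hY0 => ((h.sameCycle hX hY).support_eq.trans_subset
      TropInt.support_stableIntersection_subset).antisymm (h.stableSupport_subset hX hY hX0 hY0)⟩
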